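/- An outerplanar graph is a graph that has a crossing-free drawing with all vertices on the outer face; a \emph{maximal outerpath} is an outerplanar graph with the maximum number of edges (among the outerplanar graphs on the same vertex set) that has an outerplanar drawing whose weak dual (internal faces, adjacent if they share an edge) is a path. All drawings below are crossing-free drawings in the plane. For a graph $G$, let $\operatorname{seg}(G)$ be the minimum, over all straight-line drawings of $G$, of the number of segments, a segment being a maximal set of edges that together form a line segment. Let $\operatorname{arc}(G)$ be the minimum number of circular arcs (line segments are allowed as circular arcs of infinite radius) of which a drawing of $G$ can consist, that is, the edges are partitioned into classes each of which forms one circular arc. Let $\operatorname{arc}_2(G)$ be the minimum number of pseudo-2-arcs of which a drawing of $G$ can consist; here an arrangement of pseudo-2-arcs is a set of curves without self-intersections, possibly closed, any two of which intersect at most twice, where a point at which two curves share a tangent counts as two intersections. \textbf{Proposition.} For every integer $r \ge 0$ there are maximal outerpaths $P_r$, $Q_r$, $U_r$ (where $Q_0$ is the graph without vertices) such that \begin{enumerate} \item[(i)] $P_r$ has $n = 2r+6$ vertices and $\operatorname{seg}(P_r) \le r+5 = \frac n2 + 2$; \item[(ii)] $Q_r$ has $n = 3r$ vertices and $\operatorname{arc}(Q_r)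 \le r+1 = \frac n3 + 1$; \item[(iii)] $U_r$ has $n = 16r+6$ vertices and $\operatorname{arc}_2(U_r) \le 5r+3 = \frac{5n+18}{16}$. \end{enumerate} -/

import Mathlib

namespace OuterpathDrawing

/-! ### Crossing-free drawings in the plane (identified with `ℂ`) -/

/-- `A` is (the trace of) a simple curve from `p` to `q`. -/
def IsSimpleArc (A : Set ℂ) (p q : ℂ) : Prop :=
  ∃ γ : Path p q, Function.Injective γ ∧ Set.range γ = A

/-- `A` is (the trace of) a simple closed curve. -/
def IsSimpleClosedCurve (A : Set ℂ) : Prop :=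
  ∃ γ : Circle → ℂ, Continuous γ ∧ Function.Injective γ ∧ Set.range γ = A

/-- A crossing-free drawing of `G` in the plane: vertices are mapped injectively to points,
every edge is a simple curve joining its end vertices and containing no other vertex,
and two distinct edges meet in common end vertices only.
(The values of `curve` at pairs that are not edges are irrelevant.) -/
structure PlanarDrawing {V : Type*} (G : SimpleGraph V) where
  /-- the position of a vertex -/
  pos : V → ℂ
  pos_injective : Function.Injective pos
  /-- the curve that represents an edge -/
  curve : Sym2 V → Set ℂ
  curve_isSimpleArc : ∀ u v : V, G.Adj u v → IsSimpleArc (curve s(u, v)) (pos u) (pos v)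
  pos_notMem_curve : ∀ e ∈ G.edgeSet, ∀ w : V, w ∉ e → pos w ∉ curve e
  curve_inter_curve : ∀ e ∈ G.edgeSet, ∀ f ∈ G.edgeSet, e ≠ f →
    curve e ∩ curve f ⊆ pos '' {w | w ∈ e ∧ w ∈ f}

namespace PlanarDrawing

/-- The set of points covered by a set of edges. -/
def union {V : Type*} {G : SimpleGraph V} (D : PlanarDrawing G) (F : Set (Sym2 V)) : Set ℂ :=
  ⋃ e ∈ F, D.curve e

/-- The set of points covered by the whole drawing. -/
def support {V : Type*} {G : SimpleGraph V} (D : PlanarDrawing G) : Set ℂ :=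
  Set.range D.pos ∪ D.union G.edgeSet

/-- The drawing is a straight-line drawing. -/
def IsStraightLine {V : Type*} {G : SimpleGraph V} (D : PlanarDrawing G) : Prop :=
  ∀ u v : V, G.Adj u v → D.curve s(u, v) = segment ℝ (D.pos u) (D.pos v)

/-- An internal face: a bounded connected component of the complement of the drawing. -/
def IsInternalFace {V : Type*} {G : SimpleGraph V} (D : PlanarDrawing G) (F : Set ℂ) : Prop :=
  (∃ x ∈ D.supportᶜ, F = connectedComponentIn D.supportᶜ x) ∧ Bornology.IsBounded F

/-- The weak dual: its vertices are the internal faces, and two internal faces are adjacent if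
some edge lies on the boundary of both. -/
def weakDual {V : Type*} {G : SimpleGraph V} (D : PlanarDrawing G) :
    SimpleGraph {F : Set ℂ // D.IsInternalFace F} where
  Adj F F' := F ≠ F' ∧ ∃ e ∈ G.edgeSet,
    D.curve e ⊆ frontier (F : Set ℂ) ∧ D.curve e ⊆ frontier (F' : Set ℂ)
  symm := ⟨fun _ _ h => ⟨h.1.symm, h.2.imp fun _ he => ⟨he.1, he.2.2, he.2.1⟩⟩⟩
  loopless := ⟨fun _ h => h.1 rfl⟩

/-- An outerplane drawing, normalized in the usual way: the vertices lie on a circle and the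
edges are pairwise non-crossing straight chords of that circle. In particular all vertices lie on
the outer face. -/
def IsOuterplane {V : Type*} {G : SimpleGraph V} (D : PlanarDrawing G) : Prop :=
  D.IsStraightLine ∧ ∀ v : V, D.pos v ∈ Metric.sphere (0 : ℂ) 1

end PlanarDrawing

/-! ### Maximal outerpaths -/

/-- `G` is outerplanar. -/
def IsOuterplanar {V : Type*} (G : SimpleGraph V) : Prop :=
  ∃ D : PlanarDrawing G, D.IsOuterplane

/-- `G` is an outerplanar graph with the maximum number of edges (among all outerplanar graphs
on the same vertices). -/
def IsMaximalOuterplanar {V : Type*} (G : SimpleGraph V) : Prop :=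
  IsOuterplanar G ∧
    ∀ H : SimpleGraph V, IsOuterplanar H → H.edgeSet.encard ≤ G.edgeSet.encard

/-- `G` is an outerpath: it has an outerplane drawing whose weak dual is a path. -/
def IsOuterpath {V : Type*} (G : SimpleGraph V) : Prop :=
  ∃ D : PlanarDrawing G, D.IsOuterplane ∧
    ∃ m : ℕ, Nonempty (D.weakDual ≃g SimpleGraph.pathGraph m)

/-- `G` is a maximal outerpath. -/
def IsMaximalOuterpath {V : Type*} (G : SimpleGraph V) : Prop :=
  IsMaximalOuterplanar G ∧ IsOuterpath G

/-! ### Segment number -/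

/-- `A` is a (nondegenerate) line segment. -/
def IsLineSegment (A : Set ℂ) : Prop :=
  ∃ a b : ℂ, a ≠ b ∧ A = segment ℝ a b

/-- A segment of a straight-line drawing: a maximal set of edges that together form a line
segment. -/
def PlanarDrawing.IsSegment {V : Type*} {G : SimpleGraph V} (D : PlanarDrawing G)
    (F : Set (Sym2 V)) : Prop :=
  Maximal (fun F : Set (Sym2 V) => F ⊆ G.edgeSet ∧ IsLineSegment (D.union F)) F

/-- The segment number of a straight-line drawing. -/
noncomputable def PlanarDrawing.segmentNumber {V : Type*} {G : SimpleGraph V}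
    (D : PlanarDrawing G) : ℕ∞ :=
  {F : Set (Sym2 V) | D.IsSegment F}.encard

/-- The segment number `seg(G)`: the smallest segment number over all crossing-free straight-line
drawings of `G` (`⊤` if there is none). -/
noncomputable def seg {V : Type*} (G : SimpleGraph V) : ℕ∞ :=
  sInf {s : ℕ∞ | ∃ D : PlanarDrawing G, D.IsStraightLine ∧ s = D.segmentNumber}

/-! ### Arc number -/

/-- `A` is a circular arc, where line segments count as circular arcs of infinite radius. -/
def IsCircularArc (A : Set ℂ) : Prop :=
  IsLineSegment A ∨ ∃ (c : ℂ) (R s t : ℝ), 0 < R ∧ s < t ∧ t < s + 2 * Real.pi ∧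
    A = circleMap c R '' Set.Icc s t

/-- The edges of `G` are partitioned into the sets `E i`. -/
def IsEdgePartition {V : Type*} (G : SimpleGraph V) {N : ℕ} (E : Fin N → Set (Sym2 V)) : Prop :=
  (⋃ i, E i) = G.edgeSet ∧ Pairwise fun i j => Disjoint (E i) (E j)

/-- The arc number `arc(G)`: the smallest number of circular arcs that a crossing-free drawing of
`G` can consist of (`⊤` if there is no such drawing). -/
noncomputable def arc {V : Type*} (G : SimpleGraph V) : ℕ∞ :=
  sInf {s : ℕ∞ | ∃ (D : PlanarDrawing G) (N : ℕ) (E : Fin N → Set (Sym2 V)),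
    s = N ∧ IsEdgePartition G E ∧ ∀ i, IsCircularArc (D.union (E i))}

/-! ### Drawings on pseudo-`k`-arcs -/

/-- The curves `A` and `B`, which meet at `p`, do not share a tangent at `p`: some `C¹` change of
coordinates near `p` takes `A` into the horizontal and `B` into the vertical axis. -/
def MeetTransversally (A B : Set ℂ) (p : ℂ) : Prop :=
  ∃ φ : OpenPartialHomeomorph ℂ ℂ, p ∈ φ.source ∧ φ p = 0 ∧
    ContDiffOn ℝ 1 φ φ.source ∧ ContDiffOn ℝ 1 φ.symm φ.target ∧
    ∀ x ∈ φ.source, (x ∈ A → (φ x).im = 0) ∧ (x ∈ B → (φ x).re = 0)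

/-- The number of intersections of two curves, where a point at which the curves share a tangent
counts twice. -/
noncomputable def intersectionNumber (A B : Set ℂ) : ℕ∞ :=
  (A ∩ B).encard + {p ∈ A ∩ B | ¬ MeetTransversally A B p}.encard

/-- An arrangement of pseudo-`k`-arcs: curves without self-intersections, which may be closed if
`k ≥ 2`, any two of which intersect at most `k` times. -/
def IsPseudoArcArrangement (k : ℕ) {N : ℕ} (A : Fin N → Set ℂ) : Prop :=
  (∀ i, (∃ p q : ℂ, IsSimpleArc (A i) p q) ∨ (2 ≤ k ∧ IsSimpleClosedCurve (A i))) ∧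
    ∀ i j, i ≠ j → intersectionNumber (A i) (A j) ≤ k

/-- `arc_k(G)`: the smallest number of pseudo-`k`-arcs, forming an arrangement, that a crossing-free
drawing of `G` can consist of (`⊤` if there is no such drawing). -/
noncomputable def pseudoArc (k : ℕ) {V : Type*} (G : SimpleGraph V) : ℕ∞ :=
  sInf {s : ℕ∞ | ∃ (D : PlanarDrawing G) (N : ℕ) (E : Fin N → Set (Sym2 V)),
    s = N ∧ IsEdgePartition G E ∧ IsPseudoArcArrangement k fun i => D.union (E i)}

end OuterpathDrawing

/-!
All three families consist of strips of triangles (`IsStripPattern`): the `k`-th vertex is joined to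
`k - 1` and to a vertex `p k`, so that a new triangle is glued to a side at vertex `k - 1` of the
previous one. Every strip is a maximal outerpath (`IsStripPattern.isMaximalOuterpath`). For an
outerplane drawing, put each new vertex on the unit circle half-way between the ends of the side to
which its triangle is glued. The line through that side separates the earlier vertices from the
later ones (`stripSide`); hence the triangles do not overlap, they are the internal faces, and only
consecutive ones share a side. The strip has `2 n - 3` edges, and no outerplanar graph has more,
because straight chords of a circle that do not cross come from a family of pairs of reals without
interleaving, in which each pair is extremal at one of its ends
(`card_add_three_le_of_noncrossing`).

The drawings with few curves are `x`-monotone (`MonotoneLayout`): each edge is a part of the graph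
of one of finitely many functions. Such a drawing is crossing-free as soon as no vertex lies inside
an edge and different functions agree at vertices only, and the edges on one function form a single
arc if they cover an interval (`MonotoneLayout.union_arcEdges`).

* Segments (`seg_fan_le`): with `2 k + 2 = n`, draw the fan with its hub at the origin, one side on
  a horizontal line and the other on a line of slope `1`, such that the spokes to `j` and to
  `k + 1 + j` are opposite. Then `k` segments pass through the hub, and the spoke to the apex and
  the two sides make three more.
* Circular arcs (`arc_arcStrip_le`): let every third vertex be the centre of a fan, and place these
  centres at equal distances on the horizontal axis. The axis and one circular arc of radius
  `√7 / 2` for each centre, bent alternately upwards and downwards, carry all edges.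
* Pseudo-2-arcs (`pseudoArc_wireStrip_le`): here the arrangement and the vertex degrees have period
  `16`, and five new curves begin in each period, one of which is closed. The curves consist of
  piecewise linear wires in columns of width one; the wires are straight
  within each column and cross there at most in the middle, at a vertex. As a wire is shorter than two periods, it
  suffices to compare the wires of one period with those of the same and of the next one; this
  shows that they meet at vertices only (`wire_meet`), and that two curves have at most two common
  vertices, where they cross, or a single one (`commonSpec`). A single common vertex counts at most
  twice even if one of the curves has a corner there.
-/

namespace OuterpathDrawing

/-! ### Orientation, chords of the unit circle, triangles -/

/-- Twice the signed area of the triangle `a b c`. -/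
def cross (a b c : ℂ) : ℝ :=
  (b.re - a.re) * (c.im - a.im) - (b.im - a.im) * (c.re - a.re)

lemma cross_affine (a b z w : ℂ) {s t : ℝ} (h : s + t = 1) :
    cross a b (s • z + t • w) = s * cross a b z + t * cross a b w := by
  obtain rfl : t = 1 - s := by linarith
  simp only [cross, Complex.add_re, Complex.add_im, Complex.smul_re, Complex.smul_im, smul_eq_mul]
  ring

@[simp] lemma cross_left (a b : ℂ) : cross a b a = 0 := by simp [cross]

@[simp] lemma cross_right (a b : ℂ) : cross a b b = 0 := by simp [cross]; ring

lemma cross_rotate (a b c : ℂ) : cross b c a = cross a b c := by simp [cross]; ring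

lemma continuous_cross (a b : ℂ) : Continuous (cross a b) := by
  unfold cross
  fun_prop

/-- The orientation of three points of the unit circle in terms of their angles. -/
lemma cross_exp (α β γ : ℝ) :
    cross (Complex.exp (α * Complex.I)) (Complex.exp (β * Complex.I)) (Complex.exp (γ * Complex.I))
      = 4 * Real.sin ((β - α) / 2) * Real.sin ((γ - β) / 2) * Real.sin ((γ - α) / 2) := by
  simp only [cross, Complex.exp_ofReal_mul_I_re, Complex.exp_ofReal_mul_I_im]
  obtain ⟨u, rfl⟩ : ∃ u, α = 2 * u := ⟨α / 2, by ring⟩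
  obtain ⟨v, rfl⟩ : ∃ v, β = 2 * v := ⟨β / 2, by ring⟩
  obtain ⟨w, rfl⟩ : ∃ w, γ = 2 * w := ⟨γ / 2, by ring⟩
  have e1 : (2 * v - 2 * u) / 2 = v - u := by ring
  have e2 : (2 * w - 2 * v) / 2 = w - v := by ring
  have e3 : (2 * w - 2 * u) / 2 = w - u := by ring
  rw [e1, e2, e3]
  simp only [Real.sin_sub, Real.sin_two_mul, Real.cos_two_mul]
  have hu := Real.sin_sq_add_cos_sq u
  have hv := Real.sin_sq_add_cos_sq v
  have hw := Real.sin_sq_add_cos_sq w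
  generalize Real.sin u = a at *
  generalize Real.cos u = b at *
  generalize Real.sin v = c at *
  generalize Real.cos v = d at *
  generalize Real.sin w = e at *
  generalize Real.cos w = f at *
  have hb : b ^ 2 = 1 - a ^ 2 := by linarith
  have hd : d ^ 2 = 1 - c ^ 2 := by linarith
  have hf : f ^ 2 = 1 - e ^ 2 := by linarith
  have : (4 * (c * b - d * a) * (e * d - f * c) * (e * b - f * a)) =
    4 * (c * d * e ^ 2 * b ^ 2 - c * b * a * d * e * f * 1 - e * f * c ^ 2 * b ^ 2 +
      f ^ 2 * c * c * a * b
      - a * b * d ^ 2 * e ^ 2 + d ^ 2 * a ^ 2 * e * f + c * d * e * f * a * b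
      - f ^ 2 * a ^ 2 * c * d) + 0 := by ring
  rw [this, hb, hd, hf]
  ring

lemma sin_half_pos {x : ℝ} (h0 : 0 < x) (h1 : x < 2 * Real.pi) : 0 < Real.sin (x / 2) :=
  Real.sin_pos_of_pos_of_lt_pi (by linarith) (by linarith)

lemma cross_exp_pos {α β γ : ℝ} (h1 : α < β) (h2 : β < γ) (h3 : γ < α + 2 * Real.pi) :
    0 < cross (Complex.exp (α * Complex.I)) (Complex.exp (β * Complex.I))
      (Complex.exp (γ * Complex.I)) := by
  rw [cross_exp]
  have := sin_half_pos (x := β - α) (by linarith) (by linarith)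
  have := sin_half_pos (x := γ - β) (by linarith) (by linarith)
  have := sin_half_pos (x := γ - α) (by linarith) (by linarith)
  positivity

/-- A point of the line through `a ≠ b` has an affine coordinate. -/
lemma exists_affine_of_cross_eq_zero {a b z : ℂ} (hab : a ≠ b) (h : cross a b z = 0) :
    ∃ t : ℝ, z = (1 - t) • a + t • b := by
  have hN : (b.re - a.re) ^ 2 + (b.im - a.im) ^ 2 ≠ 0 := by
    intro h0
    apply hab
    apply Complex.ext <;> nlinarith [sq_nonneg (b.re - a.re), sq_nonneg (b.im - a.im)]
  refine ⟨((z.re - a.re) * (b.re - a.re) + (z.im - a.im) * (b.im - a.im)) /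
    ((b.re - a.re) ^ 2 + (b.im - a.im) ^ 2), ?_⟩
  unfold cross at h
  apply Complex.ext
  · simp only [Complex.add_re, Complex.smul_re, smul_eq_mul]
    field_simp
    linear_combination (-(b.im - a.im)) * h
  · simp only [Complex.add_im, Complex.smul_im, smul_eq_mul]
    field_simp
    linear_combination (b.re - a.re) * h

lemma normSq_affine (a b : ℂ) (t : ℝ) :
    Complex.normSq ((1 - t) • a + t • b) = (1 - t) * Complex.normSq a + t * Complex.normSq b
      - t * (1 - t) * Complex.normSq (b - a) := by
  simp only [Complex.normSq_apply, Complex.add_re, Complex.smul_re, Complex.add_im,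
    Complex.smul_im, smul_eq_mul, Complex.sub_re, Complex.sub_im]
  ring

lemma normSq_of_mem_sphere {a : ℂ} (h : a ∈ Metric.sphere (0 : ℂ) 1) : Complex.normSq a = 1 := by
  rw [Complex.normSq_eq_norm_sq]
  simp at h
  simp [h]

lemma mem_segment_of_affine {a b z : ℂ} {t : ℝ} (h0 : 0 ≤ t) (h1 : t ≤ 1)
    (h : z = (1 - t) • a + t • b) : z ∈ segment ℝ a b :=
  ⟨1 - t, t, by linarith, h0, by ring, h.symm⟩

lemma exists_affine_of_mem_segment {a b z : ℂ} (h : z ∈ segment ℝ a b) :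
    ∃ t : ℝ, 0 ≤ t ∧ t ≤ 1 ∧ z = (1 - t) • a + t • b := by
  obtain ⟨s, t, hs, ht, hst, rfl⟩ := h
  exact ⟨t, ht, by linarith, by rw [← hst]; simp⟩

/-- A line through two points of the unit circle meets the closed unit disk in the chord. -/
lemma mem_chord_of_cross_eq_zero {a b z : ℂ} (ha : a ∈ Metric.sphere (0 : ℂ) 1)
    (hb : b ∈ Metric.sphere (0 : ℂ) 1) (hab : a ≠ b) (hz : z ∈ Metric.closedBall (0 : ℂ) 1)
    (h : cross a b z = 0) : z ∈ segment ℝ a b := by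
  obtain ⟨t, ht⟩ := exists_affine_of_cross_eq_zero hab h
  have h1 := normSq_affine a b t
  rw [← ht, normSq_of_mem_sphere ha, normSq_of_mem_sphere hb] at h1
  have h2 : Complex.normSq z ≤ 1 := by
    rw [Complex.normSq_eq_norm_sq]
    simp at hz
    nlinarith [norm_nonneg z]
  have h3 : 0 < Complex.normSq (b - a) := Complex.normSq_pos.2 (sub_ne_zero.2 hab.symm)
  have h4 : 0 ≤ t * (1 - t) := by
    by_contra hneg
    push Not at hneg
    nlinarith [mul_pos (neg_pos.2 hneg) h3]
  refine mem_segment_of_affine ?_ ?_ ht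
  · by_contra hneg
    push Not at hneg
    nlinarith
  · by_contra hneg
    push Not at hneg
    nlinarith

/-- A chord meets the unit circle in its ends only. -/
lemma eq_or_eq_of_mem_chord {a b w : ℂ} (ha : a ∈ Metric.sphere (0 : ℂ) 1)
    (hb : b ∈ Metric.sphere (0 : ℂ) 1) (hw : w ∈ Metric.sphere (0 : ℂ) 1)
    (h : w ∈ segment ℝ a b) : w = a ∨ w = b := by
  obtain ⟨t, -, -, ht⟩ := exists_affine_of_mem_segment h
  have h1 := normSq_affine a b t
  rw [← ht, normSq_of_mem_sphere ha, normSq_of_mem_sphere hb, normSq_of_mem_sphere hw] at h1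
  have h2 : t * (1 - t) * Complex.normSq (b - a) = 0 := by linarith
  rcases mul_eq_zero.1 h2 with h3 | h3
  · rcases mul_eq_zero.1 h3 with h4 | h4
    · left; rw [ht, h4]; simp
    · right; rw [ht, h4, show t = 1 by linarith]; simp
  · left
    have : b = a := sub_eq_zero.1 (Complex.normSq_eq_zero.1 h3)
    rw [ht, this, ← add_smul]; simp

/-- The open triangle with corners `A`, `B`, `C`, in barycentric coordinates. -/
def openTriangle (A B C : ℂ) : Set ℂ :=
  {z | 0 < cross A B z / cross A B C ∧ 0 < cross B C z / cross A B C ∧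
    0 < cross C A z / cross A B C}

/-- The closed triangle with corners `A`, `B`, `C`, in barycentric coordinates. -/
def closedTriangle (A B C : ℂ) : Set ℂ :=
  {z | 0 ≤ cross A B z / cross A B C ∧ 0 ≤ cross B C z / cross A B C ∧
    0 ≤ cross C A z / cross A B C}

lemma cross_div_affine (a b z w : ℂ) (r : ℝ) {s t : ℝ} (h : s + t = 1) :
    cross a b (s • z + t • w) / r = s * (cross a b z / r) + t * (cross a b w / r) := by
  rw [cross_affine _ _ _ _ h]; ring

lemma convex_openTriangle (A B C : ℂ) : Convex ℝ (openTriangle A B C) := by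
  have key : ∀ u v s t : ℝ, 0 ≤ s → 0 ≤ t → s + t = 1 → 0 < u → 0 < v → 0 < s * u + t * v := by
    intro u v s t hs ht hst hu hv
    rcases hs.eq_or_lt with h | h
    · obtain rfl : t = 1 := by linarith
      subst h; simpa using hv
    · have := mul_pos h hu
      have := mul_nonneg ht hv.le
      linarith
  rintro z ⟨h1, h2, h3⟩ w ⟨h4, h5, h6⟩ s t hs ht hst
  refine ⟨?_, ?_, ?_⟩ <;> rw [cross_div_affine _ _ _ _ _ hst] <;> apply key <;> assumption

lemma convex_closedTriangle (A B C : ℂ) : Convex ℝ (closedTriangle A B C) := by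
  rintro z ⟨h1, h2, h3⟩ w ⟨h4, h5, h6⟩ s t hs ht hst
  refine ⟨?_, ?_, ?_⟩ <;> rw [cross_div_affine _ _ _ _ _ hst] <;> positivity

lemma isOpen_openTriangle (A B C : ℂ) : IsOpen (openTriangle A B C) := by
  have h : ∀ a b : ℂ, Continuous fun z => cross a b z / cross A B C :=
    fun a b => (continuous_cross a b).div_const _
  exact (isOpen_lt continuous_const (h A B)).inter
    ((isOpen_lt continuous_const (h B C)).inter (isOpen_lt continuous_const (h C A)))

lemma isClosed_closedTriangle (A B C : ℂ) : IsClosed (closedTriangle A B C) := by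
  have h : ∀ a b : ℂ, Continuous fun z => cross a b z / cross A B C :=
    fun a b => (continuous_cross a b).div_const _
  exact (isClosed_le continuous_const (h A B)).inter
    ((isClosed_le continuous_const (h B C)).inter (isClosed_le continuous_const (h C A)))

lemma openTriangle_subset (A B C : ℂ) : openTriangle A B C ⊆ closedTriangle A B C :=
  fun _ h => ⟨h.1.le, h.2.1.le, h.2.2.le⟩

lemma eq_barycentric {A B C : ℂ} (hC : cross A B C ≠ 0) (z : ℂ) : z =
    (cross B C z / cross A B C) • A +
    (cross C A z / cross A B C) • B + (cross A B z / cross A B C) • C := by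
  apply Complex.ext
  · simp only [Complex.add_re, Complex.smul_re, smul_eq_mul]
    field_simp
    simp only [cross]; ring
  · simp only [Complex.add_im, Complex.smul_im, smul_eq_mul]
    field_simp
    simp only [cross]; ring

lemma barycentric_sum {A B C : ℂ} (hC : cross A B C ≠ 0) (z : ℂ) :
    cross B C z / cross A B C + cross C A z / cross A B C
    + cross A B z / cross A B C = 1 := by
  field_simp
  simp only [cross]; ring

lemma mem_closedTriangle_left {A B C : ℂ} (hC : cross A B C ≠ 0) : A ∈ closedTriangle A B C := by
  refine ⟨by simp, ?_, by simp⟩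
  rw [cross_rotate, div_self hC]; norm_num

lemma mem_closedTriangle_mid {A B C : ℂ} (hC : cross A B C ≠ 0) : B ∈ closedTriangle A B C := by
  refine ⟨by simp, by simp, ?_⟩
  rw [cross_rotate B C A, cross_rotate A B C, div_self hC]; norm_num

lemma mem_closedTriangle_right {A B C : ℂ} (hC : cross A B C ≠ 0) : C ∈ closedTriangle A B C := by
  refine ⟨?_, by simp, by simp⟩
  rw [div_self hC]; norm_num

lemma openTriangle_nonempty {A B C : ℂ} (hC : cross A B C ≠ 0) : (openTriangle A B C).Nonempty := by
  refine ⟨(1 / 3 : ℝ) • A + (1 / 3 : ℝ) • B + (1 / 3 : ℝ) • C, ?_⟩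
  have h1 : cross A B ((1 / 3 : ℝ) • A + (1 / 3 : ℝ) • B + (1 / 3 : ℝ) • C)
    = cross A B C / 3 := by simp [cross]; ring
  have h2 : cross B C ((1 / 3 : ℝ) • A + (1 / 3 : ℝ) • B + (1 / 3 : ℝ) • C)
    = cross A B C / 3 := by simp [cross]; ring
  have h3 : cross C A ((1 / 3 : ℝ) • A + (1 / 3 : ℝ) • B + (1 / 3 : ℝ) • C)
    = cross A B C / 3 := by simp [cross]; ring
  have : cross A B C / 3 / cross A B C = 1 / 3 := by field_simp
  refine ⟨?_, ?_, ?_⟩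
  · rw [h1, this]; norm_num
  · rw [h2, this]; norm_num
  · rw [h3, this]; norm_num

/-- A closed triangle consists of the open triangle and its three sides. -/
lemma mem_openTriangle_or_side {A B C : ℂ} (hC : cross A B C ≠ 0) {z : ℂ}
    (hz : z ∈ closedTriangle A B C) :
    z ∈ openTriangle A B C ∨ z ∈ segment ℝ A B ∨ z ∈ segment ℝ B C ∨ z ∈ segment ℝ A C := by
  have e := eq_barycentric hC z
  have s := barycentric_sum hC z
  obtain ⟨h1, h2, h3⟩ := hz
  rcases h1.eq_or_lt with g1 | g1
  · right; left
    rw [← g1] at e s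
    exact ⟨_, _, h2, h3, by linarith, by rw [zero_smul, add_zero] at e; exact e.symm⟩
  rcases h2.eq_or_lt with g2 | g2
  · right; right; left
    rw [← g2] at e s
    exact ⟨_, _, h3, h1, by linarith, by rw [zero_smul, zero_add] at e; exact e.symm⟩
  rcases h3.eq_or_lt with g3 | g3
  · right; right; right
    rw [← g3] at e s
    exact ⟨_, _, h2, h1, by linarith, by rw [zero_smul, add_zero] at e; exact e.symm⟩
  exact Or.inl ⟨g1, g2, g3⟩

lemma closedTriangle_subset_closure {A B C : ℂ} (hC : cross A B C ≠ 0) :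
    closedTriangle A B C ⊆ closure (openTriangle A B C) := by
  intro z hz
  obtain ⟨w, hw⟩ := openTriangle_nonempty hC
  have h : openSegment ℝ z w ⊆ openTriangle A B C := by
    rintro _ ⟨s, t, hs, ht, hst, rfl⟩
    obtain ⟨h1, h2, h3⟩ := hz
    obtain ⟨h4, h5, h6⟩ := hw
    refine ⟨?_, ?_, ?_⟩ <;> rw [cross_div_affine _ _ _ _ _ hst] <;> positivity
  have := closure_mono h
  rw [closure_openSegment] at this
  exact this (left_mem_segment ℝ z w)

lemma closure_openTriangle {A B C : ℂ} (hC : cross A B C ≠ 0) :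
    closure (openTriangle A B C) = closedTriangle A B C :=
  (closure_minimal (openTriangle_subset A B C) (isClosed_closedTriangle A B C)).antisymm
    (closedTriangle_subset_closure hC)

lemma frontier_openTriangle {A B C : ℂ} (hC : cross A B C ≠ 0) :
    frontier (openTriangle A B C) = closedTriangle A B C \ openTriangle A B C := by
  rw [frontier, closure_openTriangle hC, (isOpen_openTriangle A B C).interior_eq]

lemma side_subset_frontier_left {A B C : ℂ} (hC : cross A B C ≠ 0) :
    segment ℝ A B ⊆ frontier (openTriangle A B C) := by
  rw [frontier_openTriangle hC]
  intro z hz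
  refine ⟨(convex_closedTriangle A B C).segment_subset (mem_closedTriangle_left hC)
    (mem_closedTriangle_mid hC) hz, fun h => ?_⟩
  obtain ⟨s, t, -, -, hst, rfl⟩ := hz
  have := h.1
  rw [cross_affine _ _ _ _ hst] at this
  simp at this

lemma side_subset_frontier_right {A B C : ℂ} (hC : cross A B C ≠ 0) :
    segment ℝ A C ⊆ frontier (openTriangle A B C) := by
  rw [frontier_openTriangle hC]
  intro z hz
  refine ⟨(convex_closedTriangle A B C).segment_subset (mem_closedTriangle_left hC)
    (mem_closedTriangle_right hC) hz, fun h => ?_⟩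
  obtain ⟨s, t, -, -, hst, rfl⟩ := hz
  have := h.2.2
  rw [cross_affine _ _ _ _ hst] at this
  simp at this

lemma side_subset_frontier_mid {A B C : ℂ} (hC : cross A B C ≠ 0) :
    segment ℝ B C ⊆ frontier (openTriangle A B C) := by
  rw [frontier_openTriangle hC]
  intro z hz
  refine ⟨(convex_closedTriangle A B C).segment_subset (mem_closedTriangle_mid hC)
    (mem_closedTriangle_right hC) hz, fun h => ?_⟩
  obtain ⟨s, t, -, -, hst, rfl⟩ := hz
  have := h.2.1
  rw [cross_affine _ _ _ _ hst] at this
  simp at this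

/-! ### Strips of triangles and their drawing on the circle -/

/-- The function `p` describes a strip of triangles `{p k, k - 1, k}`, `k ≥ 2`, each of which is
glued to the side `{k - 1, p k}` of its predecessor. -/
structure IsStripPattern (p : ℕ → ℕ) : Prop where
  two : p 2 = 0
  succ : ∀ k, 2 ≤ k → p (k + 1) = p k ∨ p (k + 1) = k - 1

/-- `{i, j}` with `i < j` is a side of a triangle of the strip. -/
def StripEdge (p : ℕ → ℕ) (i j : ℕ) : Prop := i + 1 = j ∨ (2 ≤ j ∧ i = p j)

/-- The graph of the first `n - 2` triangles of a strip. -/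
def stripGraph (p : ℕ → ℕ) (n : ℕ) : SimpleGraph (Fin n) where
  Adj u v := u ≠ v ∧ (StripEdge p u v ∨ StripEdge p v u)
  symm := ⟨fun _ _ h => ⟨h.1.symm, h.2.symm⟩⟩
  loopless := ⟨fun _ h => h.1 rfl⟩

namespace IsStripPattern

variable {p : ℕ → ℕ}

lemma add_two_le (hp : IsStripPattern p) {k : ℕ} (hk : 2 ≤ k) : p k + 2 ≤ k := by
  induction k, hk using Nat.le_induction with
  | base => simp [hp.two]
  | succ k hk ih => rcases hp.succ k hk with h | h <;> omega

lemma lt_of_edge (hp : IsStripPattern p) {i j : ℕ} (h : StripEdge p i j) : i < j := by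
  rcases h with h | ⟨h, rfl⟩
  · omega
  · have := hp.add_two_le h; omega

/-- The side `{m, p (m + 1)}` separates the earlier vertices from the later ones. -/
lemma le_or_eq_of_edge (hp : IsStripPattern p) {i j m : ℕ} (hm : 1 ≤ m) (hj : m < j)
    (h : StripEdge p i j) : m ≤ i ∨ i = p (m + 1) := by
  rcases h with h | ⟨-, rfl⟩
  · omega
  · induction j, hj using Nat.le_induction with
    | base => right; rfl
    | succ j hj ih =>
      rcases hp.succ j (by omega) with h | h
      · rw [h]; exact ih
      · left; omega

end IsStripPattern

/-- The angles at which the vertices of a strip are placed on the unit circle: a new vertex is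
placed half-way between the ends of the side to which its triangle is glued. (The `min` only serves
the termination of the recursion.) -/
noncomputable def stripAngle (p : ℕ → ℕ) : ℕ → ℝ
  | 0 => 0
  | 1 => 1
  | k + 2 => (stripAngle p (k + 1) + stripAngle p (min (p (k + 2)) k)) / 2
termination_by k => k
decreasing_by all_goals omega

/-- The position of a vertex of a strip on the unit circle. -/
noncomputable def stripPos (p : ℕ → ℕ) (k : ℕ) : ℂ := Complex.exp (stripAngle p k * Complex.I)

/-- An affine functional that vanishes on the side `{m, p (m + 1)}` of the strip and is positive
at the later vertices. -/
noncomputable def stripSide (p : ℕ → ℕ) (m : ℕ) (z : ℂ) : ℝ :=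
  (stripAngle p m - stripAngle p (p (m + 1))) * cross (stripPos p m) (stripPos p (p (m + 1))) z

lemma stripSide_affine (p : ℕ → ℕ) (m : ℕ) (z w : ℂ) {s t : ℝ} (h : s + t = 1) :
    stripSide p m (s • z + t • w) = s * stripSide p m z + t * stripSide p m w := by
  rw [stripSide, cross_affine _ _ _ _ h, stripSide, stripSide]; ring

lemma stripPos_mem_sphere (p : ℕ → ℕ) (k : ℕ) : stripPos p k ∈ Metric.sphere (0 : ℂ) 1 := by
  simp [stripPos, Complex.norm_exp_ofReal_mul_I]

lemma sin_half_mul_nonneg {x y : ℝ} (hx : |x| ≤ 1) (hy : |y| ≤ 1) (h : 0 ≤ x * y) :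
    0 ≤ Real.sin (x / 2) * Real.sin (y / 2) := by
  have hpi := Real.pi_gt_three
  rw [abs_le] at hx hy
  rcases mul_nonneg_iff.1 h with ⟨h1, h2⟩ | ⟨h1, h2⟩
  · exact mul_nonneg (Real.sin_nonneg_of_nonneg_of_le_pi (by linarith) (by linarith))
      (Real.sin_nonneg_of_nonneg_of_le_pi (by linarith) (by linarith))
  · exact mul_nonneg_of_nonpos_of_nonpos
      (Real.sin_nonpos_of_nonpos_of_neg_pi_le (by linarith) (by linarith))
      (Real.sin_nonpos_of_nonpos_of_neg_pi_le (by linarith) (by linarith))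

lemma sin_half_mul_neg {x y : ℝ} (hx : |x| ≤ 1) (hy : |y| ≤ 1) (h : x * y < 0) :
    Real.sin (x / 2) * Real.sin (y / 2) < 0 := by
  have hpi := Real.pi_gt_three
  rw [abs_le] at hx hy
  rcases mul_neg_iff.1 h with ⟨h1, h2⟩ | ⟨h1, h2⟩
  · exact mul_neg_of_pos_of_neg (Real.sin_pos_of_pos_of_lt_pi (by linarith) (by linarith))
      (Real.sin_neg_of_neg_of_neg_pi_lt (by linarith) (by linarith))
  · exact mul_neg_of_neg_of_pos (Real.sin_neg_of_neg_of_neg_pi_lt (by linarith) (by linarith))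
      (Real.sin_pos_of_pos_of_lt_pi (by linarith) (by linarith))

namespace IsStripPattern

variable {p : ℕ → ℕ}

lemma angle_succ (hp : IsStripPattern p) {m : ℕ} (hm : 1 ≤ m) :
    stripAngle p (m + 1) = (stripAngle p m + stripAngle p (p (m + 1))) / 2 := by
  obtain ⟨k, rfl⟩ : ∃ k, m = k + 1 := ⟨m - 1, by omega⟩
  have := hp.add_two_le (k := k + 2) (by omega)
  rw [show k + 1 + 1 = k + 2 from rfl, stripAngle, min_eq_left (by omega)]

lemma angle_ne (hp : IsStripPattern p) {m : ℕ} (hm : 1 ≤ m) :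
    stripAngle p m ≠ stripAngle p (p (m + 1)) := by
  induction m, hm using Nat.le_induction with
  | base => simp [hp.two, stripAngle]
  | succ m hm ih =>
    rw [hp.angle_succ hm]
    intro h
    apply ih
    rcases hp.succ (m + 1) (by omega) with h' | h' <;> rw [h'] at h
    · linarith
    · rw [Nat.add_sub_cancel] at h; linarith

lemma angle_mem (hp : IsStripPattern p) (m : ℕ) : 0 ≤ stripAngle p m ∧ stripAngle p m ≤ 1 := by
  induction m using Nat.strong_induction_on with
  | _ m ih =>
    match m with
    | 0 => simp [stripAngle]
    | 1 => simp [stripAngle]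
    | m + 2 =>
      have h := hp.add_two_le (k := m + 2) (by omega)
      rw [hp.angle_succ (by omega)]
      have h1 := ih (m + 1) (by omega)
      have h2 := ih (p (m + 2)) (by omega)
      constructor <;> linarith [h1.1, h1.2, h2.1, h2.2]

/-- The intervals between `m` and `p (m + 1)` are nested. -/
lemma inside_of_inside_succ (hp : IsStripPattern p) {m : ℕ} (hm : 1 ≤ m) {x : ℝ}
    (h : (x - stripAngle p (m + 1)) * (x - stripAngle p (p (m + 2))) < 0) :
    (x - stripAngle p m) * (x - stripAngle p (p (m + 1))) < 0 := by
  rw [hp.angle_succ hm] at h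
  rcases hp.succ (m + 1) (by omega) with h' | h' <;> rw [show m + 2 = m + 1 + 1 from rfl, h'] at h
  · nlinarith [sq_nonneg (x - stripAngle p (p (m + 1)))]
  · rw [Nat.add_sub_cancel] at h
    nlinarith [sq_nonneg (x - stripAngle p m)]

lemma inside_of_lt (hp : IsStripPattern p) {m j : ℕ} (hm : 1 ≤ m) (hj : m < j) :
    (stripAngle p j - stripAngle p m) * (stripAngle p j - stripAngle p (p (m + 1))) < 0 := by
  obtain ⟨d, rfl⟩ : ∃ d, j = m + 1 + d := ⟨j - (m + 1), by omega⟩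
  induction d generalizing m with
  | zero =>
    rw [add_zero, hp.angle_succ hm]
    have := hp.angle_ne hm
    nlinarith [mul_self_pos.2 (sub_ne_zero.2 this)]
  | succ d ih =>
    have := ih (m := m + 1) (by omega) (by omega)
    rw [show m + 1 + 1 + d = m + 1 + (d + 1) by omega] at this
    exact hp.inside_of_inside_succ hm this

lemma not_inside_of_le (hp : IsStripPattern p) {m j : ℕ} (hm : 1 ≤ m) (hj : j ≤ m) :
    0 ≤ (stripAngle p j - stripAngle p m) * (stripAngle p j - stripAngle p (p (m + 1))) := by
  induction m, hm using Nat.le_induction with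
  | base =>
    rw [hp.two]
    interval_cases j <;> simp
  | succ m hm ih =>
    rcases Nat.lt_or_ge m j with h | h
    · obtain rfl : j = m + 1 := by omega
      simp
    · by_contra hneg
      push Not at hneg
      exact absurd (hp.inside_of_inside_succ hm hneg) (not_lt.2 (ih h))

lemma angle_injective (hp : IsStripPattern p) : Function.Injective (stripAngle p) := by
  have key : ∀ i j, i < j → stripAngle p i ≠ stripAngle p j := by
    intro i j hij h
    rcases Nat.lt_or_ge 1 j with hj | hj
    · have h1 := hp.inside_of_lt (m := j - 1) (j := j) (by omega) (by omega)
      have h2 := hp.not_inside_of_le (m := j - 1) (j := i) (by omega) (by omega)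
      rw [h] at h2
      exact absurd h1 (not_lt.2 h2)
    · obtain rfl : j = 1 := by omega
      obtain rfl : i = 0 := by omega
      simp [stripAngle] at h
  intro i j h
  rcases lt_trichotomy i j with h' | h' | h'
  · exact absurd h (key i j h')
  · exact h'
  · exact absurd h.symm (key j i h')

lemma pos_injective (hp : IsStripPattern p) : Function.Injective (stripPos p) := by
  intro i j h
  apply hp.angle_injective
  have hpi := Real.pi_gt_three
  have h1 := congrArg Complex.re h
  simp only [stripPos, Complex.exp_ofReal_mul_I_re] at h1
  have hi := hp.angle_mem i
  have hj := hp.angle_mem j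
  exact Real.injOn_cos ⟨hi.1, by linarith⟩ ⟨hj.1, by linarith⟩ h1

lemma stripSide_pos_eq (p : ℕ → ℕ) (m j : ℕ) : stripSide p m (stripPos p j) =
    -(4 * ((stripAngle p (p (m + 1)) - stripAngle p m) *
      Real.sin ((stripAngle p (p (m + 1)) - stripAngle p m) / 2)) *
      (Real.sin ((stripAngle p j - stripAngle p m) / 2) *
        Real.sin ((stripAngle p j - stripAngle p (p (m + 1))) / 2))) := by
  rw [stripSide, stripPos, stripPos, stripPos, cross_exp]
  ring

lemma abs_angle_sub_le (hp : IsStripPattern p) (i j : ℕ) :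
    |stripAngle p i - stripAngle p j| ≤ 1 := by
  have hi := hp.angle_mem i
  have hj := hp.angle_mem j
  rw [abs_le]
  constructor <;> linarith [hi.1, hi.2, hj.1, hj.2]

lemma mul_sin_pos (hp : IsStripPattern p) {m : ℕ} (hm : 1 ≤ m) :
    0 < (stripAngle p (p (m + 1)) - stripAngle p m) *
      Real.sin ((stripAngle p (p (m + 1)) - stripAngle p m) / 2) := by
  have hne := hp.angle_ne hm
  have h1 := abs_le.1 (hp.abs_angle_sub_le (p (m + 1)) m)
  have hpi := Real.pi_gt_three
  rcases lt_or_gt_of_ne (sub_ne_zero.2 hne.symm) with h | h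
  · exact mul_pos_of_neg_of_neg h
      (Real.sin_neg_of_neg_of_neg_pi_lt (by linarith) (by linarith [h1.1]))
  · exact mul_pos h (Real.sin_pos_of_pos_of_lt_pi (by linarith) (by linarith [h1.2]))

lemma stripSide_pos_of_lt (hp : IsStripPattern p) {m j : ℕ} (hm : 1 ≤ m) (hj : m < j) :
    0 < stripSide p m (stripPos p j) := by
  rw [stripSide_pos_eq, neg_pos]
  exact mul_neg_of_pos_of_neg (mul_pos (by norm_num) (hp.mul_sin_pos hm))
    (sin_half_mul_neg (hp.abs_angle_sub_le _ _) (hp.abs_angle_sub_le _ _) (hp.inside_of_lt hm hj))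

lemma stripSide_nonpos_of_le (hp : IsStripPattern p) {m j : ℕ} (hm : 1 ≤ m) (hj : j ≤ m) :
    stripSide p m (stripPos p j) ≤ 0 := by
  rw [stripSide_pos_eq, neg_nonpos]
  exact mul_nonneg (mul_pos (by norm_num) (hp.mul_sin_pos hm)).le
    (sin_half_mul_nonneg (hp.abs_angle_sub_le _ _) (hp.abs_angle_sub_le _ _)
      (hp.not_inside_of_le hm hj))

@[simp] lemma stripSide_self (p : ℕ → ℕ) (m : ℕ) : stripSide p m (stripPos p m) = 0 := by
  simp [stripSide]

@[simp] lemma stripSide_other (p : ℕ → ℕ) (m : ℕ) :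
    stripSide p m (stripPos p (p (m + 1))) = 0 := by
  simp [stripSide]

lemma mem_side_of_stripSide_eq_zero (hp : IsStripPattern p) {m : ℕ} (hm : 1 ≤ m) {z : ℂ}
    (hz : z ∈ Metric.closedBall (0 : ℂ) 1) (h : stripSide p m z = 0) :
    z ∈ segment ℝ (stripPos p m) (stripPos p (p (m + 1))) := by
  rcases mul_eq_zero.1 h with h | h
  · exact absurd (sub_eq_zero.1 h) (hp.angle_ne hm)
  · refine mem_chord_of_cross_eq_zero (stripPos_mem_sphere p _) (stripPos_mem_sphere p _) ?_ hz h
    exact fun h => hp.angle_ne hm (congrArg _ (hp.pos_injective h))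

lemma eq_of_stripSide_eq_zero (hp : IsStripPattern p) {m j : ℕ} (hm : 1 ≤ m)
    (h : stripSide p m (stripPos p j) = 0) : j = m ∨ j = p (m + 1) := by
  have h1 := hp.mem_side_of_stripSide_eq_zero hm
    (Metric.sphere_subset_closedBall (stripPos_mem_sphere p j)) h
  have h2 := eq_or_eq_of_mem_chord (stripPos_mem_sphere p _) (stripPos_mem_sphere p _)
    (stripPos_mem_sphere p _) h1
  exact h2.imp (fun h => hp.pos_injective h) (fun h => hp.pos_injective h)

lemma edge_side (hp : IsStripPattern p) {m : ℕ} (hm : 1 ≤ m) : StripEdge p (p (m + 1)) m := by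
  rcases Nat.lt_or_ge 1 m with h | h
  · rcases hp.succ m h with h' | h'
    · exact Or.inr ⟨h, h'⟩
    · left; omega
  · obtain rfl : m = 1 := by omega
    left; rw [hp.two]

end IsStripPattern

/-- The side of a strip with the given ends. -/
noncomputable def stripSegment (p : ℕ → ℕ) (i j : ℕ) : Set ℂ :=
  segment ℝ (stripPos p i) (stripPos p j)

namespace IsStripPattern

variable {p : ℕ → ℕ}

lemma mem_of_pos_mem_segment (hp : IsStripPattern p) {i j w : ℕ}
    (h : stripPos p w ∈ stripSegment p i j) : w = i ∨ w = j :=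
  (eq_or_eq_of_mem_chord (stripPos_mem_sphere p _) (stripPos_mem_sphere p _)
    (stripPos_mem_sphere p _) h).imp (fun h => hp.pos_injective h) (fun h => hp.pos_injective h)

lemma stripSide_nonpos_of_mem (hp : IsStripPattern p) {m i j : ℕ} (hm : 1 ≤ m) (hi : i ≤ m)
    (hj : j ≤ m) {z : ℂ} (hz : z ∈ stripSegment p i j) : stripSide p m z ≤ 0 := by
  obtain ⟨s, t, hs, ht, hst, rfl⟩ := hz
  rw [stripSide_affine p m _ _ hst]
  nlinarith [hp.stripSide_nonpos_of_le hm hi, hp.stripSide_nonpos_of_le hm hj]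

/-- Two sides of a strip that have a point in common have an end in common at that point. -/
lemma exists_common_end_of_lt (hp : IsStripPattern p) {i j k l : ℕ} (hij : StripEdge p i j)
    (hkl : StripEdge p k l) (hjl : j < l) {z : ℂ} (h1 : z ∈ stripSegment p i j)
    (h2 : z ∈ stripSegment p k l) : z = stripPos p k ∧ (k = i ∨ k = j) := by
  have hi := hp.lt_of_edge hij
  have hk := hp.lt_of_edge hkl
  -- separate the later side from the earlier one by the side to which the triangle of `l` is glued
  obtain ⟨m, rfl⟩ : ∃ m, l = m + 1 := ⟨l - 1, by omega⟩
  have hm : 1 ≤ m := by omega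
  have hz : z = stripPos p k := by
    have h3 := hp.stripSide_nonpos_of_mem hm (by omega) (by omega) h1
    obtain ⟨s, t, hs, ht, hst, rfl⟩ := h2
    rw [stripSide_affine p m _ _ hst] at h3
    have h4 := hp.stripSide_pos_of_lt hm (Nat.lt_succ_self m)
    have h5 : stripSide p m (stripPos p k) = 0 := by
      rcases hp.le_or_eq_of_edge hm (Nat.lt_succ_self m) hkl with h | h
      · obtain rfl : k = m := by omega
        simp
      · rw [h]; simp
    rw [h5] at h3
    have : t = 0 := by
      rcases ht.eq_or_lt with h | h
      · exact h.symm
      · nlinarith [mul_pos h h4]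
    obtain rfl : s = 1 := by linarith
    simp [this]
  exact ⟨hz, hp.mem_of_pos_mem_segment (hz ▸ h1)⟩

lemma exists_common_end_of_eq (hp : IsStripPattern p) {i k l : ℕ} (hil : StripEdge p i l)
    (hkl : StripEdge p k l) (hik : i ≠ k) {z : ℂ} (h1 : z ∈ stripSegment p i l)
    (h2 : z ∈ stripSegment p k l) : z = stripPos p l := by
  have hi := hp.lt_of_edge hil
  have hk := hp.lt_of_edge hkl
  obtain ⟨s, t, hs, ht, hst, rfl⟩ := h1
  obtain ⟨s', t', hs', ht', hst', h⟩ := h2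
  -- both sides emanate from `l`; the functional of one of them is nonzero at the end of the other
  have e1 := congrArg (cross (stripPos p l) (stripPos p k)) h
  rw [cross_affine _ _ _ _ hst, cross_affine _ _ _ _ hst'] at e1
  simp only [cross_left, cross_right, mul_zero, add_zero] at e1
  rcases mul_eq_zero.1 e1.symm with h0 | h0
  · obtain rfl : t = 1 := by linarith
    simp [h0]
  · exfalso
    have hne : stripPos p l ≠ stripPos p k := fun h => absurd (hp.pos_injective h) (by omega)
    have h3 := mem_chord_of_cross_eq_zero (stripPos_mem_sphere p _) (stripPos_mem_sphere p _) hne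
      (Metric.sphere_subset_closedBall (stripPos_mem_sphere p i)) h0
    rcases hp.mem_of_pos_mem_segment h3 with h | h <;> omega

end IsStripPattern

/-! ### Faces of a strip -/

lemma isSimpleArc_segment {p q : ℂ} (h : p ≠ q) : IsSimpleArc (segment ℝ p q) p q := by
  refine ⟨⟨⟨fun t => AffineMap.lineMap p q (t : ℝ), by fun_prop⟩, by simp, by simp⟩, ?_, ?_⟩
  · intro s t hst
    exact Subtype.ext (AffineMap.lineMap_injective ℝ h hst)
  · rw [segment_eq_image_lineMap]
    ext z
    constructor
    · rintro ⟨t, rfl⟩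
      exact ⟨t, t.2, rfl⟩
    · rintro ⟨t, ht, rfl⟩
      exact ⟨⟨t, ht⟩, rfl⟩

/-- Inside an open set that does not meet `S` but whose boundary lies in `S`, the components of the
complement of `S` are those of the open set. -/
lemma connectedComponentIn_compl_eq {S O : Set ℂ} (hO : IsOpen O) (hc : IsPreconnected O)
    (hd : Disjoint O S) (hf : frontier O ⊆ S) {x : ℂ} (hx : x ∈ O) :
    connectedComponentIn Sᶜ x = O := by
  have hsub : O ⊆ Sᶜ := fun z hz h => Set.disjoint_left.1 hd hz h
  refine Set.Subset.antisymm ?_ (hc.subset_connectedComponentIn hx hsub)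
  refine isPreconnected_connectedComponentIn.subset_of_closure_inter_subset hO
    ⟨x, mem_connectedComponentIn (hsub hx), hx⟩ ?_
  rintro z ⟨hz, hz'⟩
  by_contra hzO
  exact connectedComponentIn_subset _ _ hz' (hf ⟨hz, by rwa [hO.interior_eq]⟩)

/-- A point outside a convex set `K` can escape to infinity along a ray that avoids `K`. -/
lemma not_isBounded_component {K S : Set ℂ} (hK : Convex ℝ K) (hne : K.Nonempty) (hS : S ⊆ K)
    {x : ℂ} (hx : x ∉ K) : ¬ Bornology.IsBounded (connectedComponentIn Sᶜ x) := by
  obtain ⟨y, hy⟩ := hne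
  have hxy : x - y ≠ 0 := fun h => hx (by rwa [sub_eq_zero.1 h])
  set g : ℝ → ℂ := fun s => x + s • (x - y) with hg
  have hgc : Continuous g := by fun_prop
  have hray : ∀ s ∈ Set.Ici (0 : ℝ), g s ∉ K := by
    intro s hs hmem
    have hs' : 0 ≤ s := hs
    apply hx
    have h2 : x = (1 / (1 + s)) • g s + (s / (1 + s)) • y := by
      apply Complex.ext
      · simp only [hg, Complex.add_re, Complex.smul_re, smul_eq_mul, Complex.sub_re]
        field_simp
        ring
      · simp only [hg, Complex.add_im, Complex.smul_im, smul_eq_mul, Complex.sub_im]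
        field_simp
        ring
    rw [h2]
    exact hK hmem hy (by positivity) (by positivity) (by field_simp)
  have hsub : g '' Set.Ici 0 ⊆ connectedComponentIn Sᶜ x := by
    refine (isPreconnected_Ici.image g hgc.continuousOn).subset_connectedComponentIn
      ⟨0, by simp, by simp [hg]⟩ ?_
    rintro _ ⟨s, hs, rfl⟩ h
    exact hray s hs (hS h)
  intro hb
  obtain ⟨M, hM⟩ := (hb.subset hsub).exists_norm_le
  have hpos : 0 < ‖x - y‖ := norm_pos_iff.2 hxy
  have hM0 : 0 ≤ M := le_trans (norm_nonneg _) (hM _ ⟨0, by simp, rfl⟩)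
  have h1 := hM _ ⟨(M + ‖x‖ + 1) / ‖x - y‖, by simp; positivity, rfl⟩
  have h2 : ‖((M + ‖x‖ + 1) / ‖x - y‖) • (x - y)‖ = M + ‖x‖ + 1 := by
    rw [norm_smul, Real.norm_of_nonneg (by positivity)]
    field_simp
  have h3 := norm_sub_le (g ((M + ‖x‖ + 1) / ‖x - y‖)) x
  have h4 : g ((M + ‖x‖ + 1) / ‖x - y‖) - x = ((M + ‖x‖ + 1) / ‖x - y‖) • (x - y) := by simp [hg]
  rw [h4, h2] at h3
  linarith

/-- The interior of the triangle `{p (m + 1), m, m + 1}` of a strip. -/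
noncomputable def stripFace (p : ℕ → ℕ) (m : ℕ) : Set ℂ :=
  openTriangle (stripPos p (p (m + 1))) (stripPos p m) (stripPos p (m + 1))

/-- The triangle `{p (m + 1), m, m + 1}` of a strip. -/
noncomputable def stripTriangle (p : ℕ → ℕ) (m : ℕ) : Set ℂ :=
  closedTriangle (stripPos p (p (m + 1))) (stripPos p m) (stripPos p (m + 1))

lemma stripSide_affine₃ (p : ℕ → ℕ) (m : ℕ) (A B C : ℂ) {a b c : ℝ} (h : a + b + c = 1) :
    stripSide p m (a • A + b • B + c • C) =
      a * stripSide p m A + b * stripSide p m B + c * stripSide p m C := by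
  obtain rfl : c = 1 - a - b := by linarith
  simp only [stripSide, cross, Complex.add_re, Complex.add_im, Complex.smul_re, Complex.smul_im,
    smul_eq_mul]
  ring

namespace IsStripPattern

variable {p : ℕ → ℕ}

lemma cross_ne_zero (hp : IsStripPattern p) {m : ℕ} (hm : 1 ≤ m) :
    cross (stripPos p (p (m + 1))) (stripPos p m) (stripPos p (m + 1)) ≠ 0 := by
  have h := hp.stripSide_pos_of_lt hm (Nat.lt_succ_self m)
  intro h0
  have h1 : cross (stripPos p m) (stripPos p (p (m + 1))) (stripPos p (m + 1)) = 0 := by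
    rw [← neg_eq_zero, ← h0]; simp only [cross]; ring
  simp [stripSide, h1] at h

lemma exists_barycentric_of_mem_triangle (hp : IsStripPattern p) {m : ℕ} (hm : 1 ≤ m) {z : ℂ}
    (hz : z ∈ stripTriangle p m) : ∃ a b c : ℝ, 0 ≤ a ∧ 0 ≤ b ∧ 0 ≤ c ∧ a + b + c = 1 ∧
      z = a • stripPos p (p (m + 1)) + b • stripPos p m + c • stripPos p (m + 1) :=
  ⟨_, _, _, hz.2.1, hz.2.2, hz.1, barycentric_sum (hp.cross_ne_zero hm) z,
    eq_barycentric (hp.cross_ne_zero hm) z⟩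

lemma exists_barycentric_of_mem_face (hp : IsStripPattern p) {m : ℕ} (hm : 1 ≤ m) {z : ℂ}
    (hz : z ∈ stripFace p m) : ∃ a b c : ℝ, 0 < a ∧ 0 < b ∧ 0 < c ∧ a + b + c = 1 ∧
      z = a • stripPos p (p (m + 1)) + b • stripPos p m + c • stripPos p (m + 1) :=
  ⟨_, _, _, hz.2.1, hz.2.2, hz.1, barycentric_sum (hp.cross_ne_zero hm) z,
    eq_barycentric (hp.cross_ne_zero hm) z⟩

lemma p_succ_lt (hp : IsStripPattern p) {m : ℕ} (hm : 1 ≤ m) : p (m + 1) < m := by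
  have := hp.add_two_le (k := m + 1) (by omega)
  omega

lemma stripSide_triangle_nonpos (hp : IsStripPattern p) {m a : ℕ} (hm : 1 ≤ m) (ha : m < a) {z : ℂ}
    (hz : z ∈ stripTriangle p m) : stripSide p a z ≤ 0 := by
  obtain ⟨u, v, w, hu, hv, hw, h1, rfl⟩ := hp.exists_barycentric_of_mem_triangle hm hz
  rw [stripSide_affine₃ p a _ _ _ h1]
  have := hp.p_succ_lt hm
  have h2 := hp.stripSide_nonpos_of_le (m := a) (j := p (m + 1)) (by omega) (by omega)
  have h3 := hp.stripSide_nonpos_of_le (m := a) (j := m) (by omega) (by omega)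
  have h4 := hp.stripSide_nonpos_of_le (m := a) (j := m + 1) (by omega) (by omega)
  nlinarith [mul_nonneg hu (neg_nonneg.2 h2), mul_nonneg hv (neg_nonneg.2 h3),
    mul_nonneg hw (neg_nonneg.2 h4)]

lemma stripSide_nonneg_of_edge (hp : IsStripPattern p) {a i j : ℕ} (ha : 1 ≤ a) (hj : a < j)
    (h : StripEdge p i j) : 0 ≤ stripSide p a (stripPos p i) := by
  rcases hp.le_or_eq_of_edge ha hj h with h | rfl
  · rcases h.eq_or_lt with rfl | h
    · simp
    · exact (hp.stripSide_pos_of_lt ha h).le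
  · simp

lemma stripSide_triangle_nonneg (hp : IsStripPattern p) {m a : ℕ} (ha : 1 ≤ a) (ham : a ≤ m)
    {z : ℂ} (hz : z ∈ stripTriangle p m) : 0 ≤ stripSide p a z := by
  obtain ⟨u, v, w, hu, hv, hw, h1, rfl⟩ := hp.exists_barycentric_of_mem_triangle (by omega) hz
  rw [stripSide_affine₃ p a _ _ _ h1]
  have h2 := hp.stripSide_nonneg_of_edge (a := a) (i := p (m + 1)) (j := m + 1) ha (by omega)
    (Or.inr ⟨by omega, rfl⟩)
  have h3 := hp.stripSide_nonneg_of_edge (a := a) (i := m) (j := m + 1) ha (by omega) (Or.inl rfl)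
  have h4 := (hp.stripSide_pos_of_lt (m := a) (j := m + 1) ha (by omega)).le
  positivity

lemma stripSide_face_pos (hp : IsStripPattern p) {m : ℕ} (hm : 1 ≤ m) {z : ℂ}
    (hz : z ∈ stripFace p m) : 0 < stripSide p m z := by
  obtain ⟨u, v, w, hu, hv, hw, h1, rfl⟩ := hp.exists_barycentric_of_mem_face hm hz
  rw [stripSide_affine₃ p m _ _ _ h1]
  have := hp.stripSide_pos_of_lt hm (Nat.lt_succ_self m)
  simpa using mul_pos hw this

lemma stripSide_face_neg (hp : IsStripPattern p) {m : ℕ} (hm : 1 ≤ m) {z : ℂ}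
    (hz : z ∈ stripFace p m) : stripSide p (m + 1) z < 0 := by
  obtain ⟨u, v, w, hu, hv, hw, h1, rfl⟩ := hp.exists_barycentric_of_mem_face hm hz
  rw [stripSide_affine₃ p (m + 1) _ _ _ h1]
  have hlt := hp.p_succ_lt hm
  have h2 := hp.stripSide_nonpos_of_le (m := m + 1) (j := p (m + 1)) (by omega) (by omega)
  have h3 := hp.stripSide_nonpos_of_le (m := m + 1) (j := m) (by omega) (by omega)
  rw [stripSide_self, mul_zero, add_zero]
  rcases h2.lt_or_eq with h4 | h4
  · nlinarith [mul_pos hu (neg_pos.2 h4), mul_nonneg hv.le (neg_nonneg.2 h3)]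
  rcases h3.lt_or_eq with h5 | h5
  · nlinarith [mul_pos hv (neg_pos.2 h5), mul_nonneg hu.le (neg_nonneg.2 h2)]
  exfalso
  have := hp.eq_of_stripSide_eq_zero (by omega) h4
  have := hp.eq_of_stripSide_eq_zero (by omega) h5
  omega

lemma disjoint_face_segment (hp : IsStripPattern p) {m i j : ℕ} (hm : 1 ≤ m)
    (h : StripEdge p i j) : Disjoint (stripFace p m) (stripSegment p i j) := by
  rw [Set.disjoint_left]
  intro z hz hz'
  have hij := hp.lt_of_edge h
  rcases lt_trichotomy j (m + 1) with hj | rfl | hj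
  · exact absurd (hp.stripSide_face_pos hm hz)
      (not_lt.2 (hp.stripSide_nonpos_of_mem hm (by omega) (by omega) hz'))
  · rcases h with h | ⟨-, rfl⟩
    · obtain rfl : i = m := by omega
      have := side_subset_frontier_mid (hp.cross_ne_zero hm) hz'
      rw [frontier_openTriangle (hp.cross_ne_zero hm)] at this
      exact this.2 hz
    · have := side_subset_frontier_right (hp.cross_ne_zero hm) hz'
      rw [frontier_openTriangle (hp.cross_ne_zero hm)] at this
      exact this.2 hz
  · have h1 := hp.stripSide_face_neg hm hz
    obtain ⟨s, t, hs, ht, hst, rfl⟩ := hz'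
    rw [stripSide_affine p (m + 1) _ _ hst] at h1
    have h2 := hp.stripSide_nonneg_of_edge (by omega) hj h
    have h3 := hp.stripSide_pos_of_lt (by omega) hj
    nlinarith [mul_nonneg hs h2, mul_nonneg ht h3.le]

lemma stripTriangle_subset_closedBall (hp : IsStripPattern p) {m : ℕ} (hm : 1 ≤ m) :
    stripTriangle p m ⊆ Metric.closedBall 0 1 := by
  intro z hz
  obtain ⟨u, v, w, hu, hv, hw, h1, rfl⟩ := hp.exists_barycentric_of_mem_triangle hm hz
  have hk : ∀ k, ‖stripPos p k‖ = 1 := fun k => by simpa using stripPos_mem_sphere p k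
  rw [mem_closedBall_zero_iff]
  refine (norm_add₃_le).trans ?_
  rw [norm_smul, norm_smul, norm_smul, hk, hk, hk, Real.norm_of_nonneg hu, Real.norm_of_nonneg hv,
    Real.norm_of_nonneg hw]
  linarith

/-- The triangles of a strip fill the convex hull of its vertices. -/
lemma convexHull_subset (hp : IsStripPattern p) {n : ℕ} (hn : 1 ≤ n) :
    convexHull ℝ (stripPos p '' Set.Iic (n + 1)) ⊆ ⋃ m ∈ Set.Icc 1 n, stripTriangle p m := by
  have hins : ∀ k, stripPos p '' Set.Iic (k + 1) =
      insert (stripPos p (k + 1)) (stripPos p '' Set.Iic k) := by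
    intro k
    rw [← Set.image_insert_eq]
    congr 1
    ext j
    simp only [Set.mem_Iic, Set.mem_insert_iff]
    omega
  have hball : ∀ k, convexHull ℝ (stripPos p '' Set.Iic k) ⊆ Metric.closedBall 0 1 := fun k =>
    convexHull_min (by
      rintro _ ⟨j, -, rfl⟩
      exact Metric.sphere_subset_closedBall (stripPos_mem_sphere p j)) (convex_closedBall _ _)
  induction n, hn using Nat.le_induction with
  | base =>
    refine fun z hz => Set.mem_biUnion (x := 1) (by simp) (convexHull_min ?_
      (convex_closedTriangle _ _ _) hz)
    have h1 := hp.cross_ne_zero (le_refl 1)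
    rintro _ ⟨j, hj, rfl⟩
    simp only [Set.mem_Iic] at hj
    interval_cases j
    · have := mem_closedTriangle_left h1
      rwa [hp.two] at this ⊢
    · exact mem_closedTriangle_mid h1
    · exact mem_closedTriangle_right h1
  | succ n hn ih =>
    intro z hz
    rw [hins, convexHull_insert (Set.nonempty_Iic.image _), mem_convexJoin] at hz
    obtain ⟨P, rfl, y, hy, hz⟩ := hz
    set P := stripPos p (n + 1 + 1) with hPdef
    have hm : 1 ≤ n + 1 := by omega
    have hP : 0 < stripSide p (n + 1) P := hp.stripSide_pos_of_lt hm (Nat.lt_succ_self _)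
    have hside : ∀ w ∈ convexHull ℝ (stripPos p '' Set.Iic (n + 1)), stripSide p (n + 1) w ≤ 0 := by
      refine fun w hw => convexHull_min (t := {w | stripSide p (n + 1) w ≤ 0}) ?_ ?_ hw
      · rintro _ ⟨j, hj, rfl⟩
        exact hp.stripSide_nonpos_of_le hm hj
      · intro u hu v hv s t hs ht hst
        simp only [Set.mem_ofPred_eq] at hu hv ⊢
        rw [stripSide_affine p _ _ _ hst]
        nlinarith [mul_nonneg hs (neg_nonneg.2 hu), mul_nonneg ht (neg_nonneg.2 hv)]
    have hY := hside y hy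
    -- `c` is the point at which the segment from the new vertex `P` to `y` crosses the side
    set l := stripSide p (n + 1) P with hl
    set k := stripSide p (n + 1) y with hk
    have hlk : 0 < l - k := by linarith
    have hsum : -k / (l - k) + l / (l - k) = 1 := by field_simp; ring
    set c := (-k / (l - k)) • P + (l / (l - k)) • y with hc
    have hc0 : stripSide p (n + 1) c = 0 := by
      rw [hc, stripSide_affine p _ _ _ hsum, ← hl, ← hk]; field_simp; ring
    have hPball : P ∈ Metric.closedBall (0 : ℂ) 1 :=
      Metric.sphere_subset_closedBall (stripPos_mem_sphere p _)
    have hcball : c ∈ Metric.closedBall (0 : ℂ) 1 :=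
      convex_closedBall (0 : ℂ) 1 hPball (hball _ hy) (div_nonneg (by linarith) hlk.le)
        (div_nonneg hP.le hlk.le) hsum
    have hcs := hp.mem_side_of_stripSide_eq_zero hm hcball hc0
    have hchull : c ∈ convexHull ℝ (stripPos p '' Set.Iic (n + 1)) :=
      (convex_convexHull ℝ _).segment_subset (subset_convexHull ℝ _
        (Set.mem_image_of_mem _ (by simp)))
        (subset_convexHull ℝ _ (Set.mem_image_of_mem _ (by
          have := hp.p_succ_lt hm; simp only [Set.mem_Iic]; omega))) hcs
    obtain ⟨s, t, hs, ht, hst, rfl⟩ := hz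
    have hzs : stripSide p (n + 1) (s • P + t • y) = s * l + t * k := by
      rw [stripSide_affine p _ _ _ hst]
    rcases le_or_gt (s * l + t * k) 0 with h0 | h0
    · -- the point lies between `c` and `y`
      have hmem : s • P + t • y ∈ convexHull ℝ (stripPos p '' Set.Iic (n + 1)) := by
        rcases hY.lt_or_eq with hk0 | hk0
        · have hk1 : k ≠ 0 := hk0.ne
          have he : s • P + t • y = (s * (l - k) / (-k)) • c + ((-(s * l + t * k)) / (-k)) • y := by
            obtain rfl : t = 1 - s := by linarith
            rw [hc]
            apply Complex.ext
            · simp only [Complex.add_re, Complex.smul_re, smul_eq_mul]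
              field_simp
              ring
            · simp only [Complex.add_im, Complex.smul_im, smul_eq_mul]
              field_simp
              ring
          rw [he]
          refine convex_convexHull ℝ _ hchull hy ?_ ?_ ?_
          · exact div_nonneg (mul_nonneg hs hlk.le) (by linarith)
          · exact div_nonneg (by linarith) (by linarith)
          · obtain rfl : t = 1 - s := by linarith
            field_simp
            ring
        · have hs0 : s = 0 := by
            rw [hk0, mul_zero, add_zero] at h0
            rcases hs.eq_or_lt with h | h
            · exact h.symm
            · nlinarith [mul_pos h hP]
          obtain rfl : t = 1 := by linarith
          simpa [hs0] using hy
      have := ih hmem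
      simp only [Set.mem_iUnion] at this ⊢
      obtain ⟨m, hm, h⟩ := this
      exact ⟨m, ⟨hm.1, by have := hm.2; omega⟩, h⟩
    · -- the point lies between the new vertex and `c`
      have he : s • P + t • y = ((s * l + t * k) / l) • P + (t * (l - k) / l) • c := by
        obtain rfl : s = 1 - t := by linarith
        rw [hc]
        apply Complex.ext
        · simp only [Complex.add_re, Complex.smul_re, smul_eq_mul]
          field_simp
          ring
        · simp only [Complex.add_im, Complex.smul_im, smul_eq_mul]
          field_simp
          ring
      refine Set.mem_biUnion (x := n + 1) ⟨by omega, le_refl _⟩ ?_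
      have hne := hp.cross_ne_zero hm
      have hct : c ∈ stripTriangle p (n + 1) :=
        (convex_closedTriangle _ _ _).segment_subset (mem_closedTriangle_mid hne)
          (mem_closedTriangle_left hne) hcs
      rw [he]
      refine convex_closedTriangle _ _ _ (mem_closedTriangle_right hne) hct ?_ ?_ ?_
      · exact div_nonneg h0.le hP.le
      · exact div_nonneg (mul_nonneg ht hlk.le) hP.le
      · obtain rfl : s = 1 - t := by linarith
        field_simp
        ring

end IsStripPattern

/-- The sides of a strip as subsets of the plane. -/
noncomputable def stripCurve (p : ℕ → ℕ) (n : ℕ) : Sym2 (Fin n) → Set ℂ :=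
  Sym2.lift ⟨fun u v => stripSegment p u v, fun _ _ => segment_symm ℝ _ _⟩

@[simp] lemma stripCurve_mk (p : ℕ → ℕ) (n : ℕ) (u v : Fin n) :
    stripCurve p n s(u, v) = stripSegment p u v := rfl

lemma exists_edge_of_mem_edgeSet {p : ℕ → ℕ} {n : ℕ} {e : Sym2 (Fin n)}
    (he : e ∈ (stripGraph p n).edgeSet) : ∃ u v : Fin n, e = s(u, v) ∧ StripEdge p u v := by
  induction e with
  | _ u v =>
    rcases he.2 with h | h
    · exact ⟨u, v, rfl, h⟩
    · exact ⟨v, u, Sym2.eq_swap, h⟩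

namespace IsStripPattern

variable {p : ℕ → ℕ}

lemma adj_of_edge (hp : IsStripPattern p) {n : ℕ} {u v : Fin n} (h : StripEdge p u v) :
    (stripGraph p n).Adj u v :=
  ⟨fun huv => absurd (hp.lt_of_edge h) (by rw [huv]; exact lt_irrefl _), Or.inl h⟩

/-- The drawing of a strip with its vertices on the unit circle. -/
noncomputable def drawing (hp : IsStripPattern p) (n : ℕ) : PlanarDrawing (stripGraph p n) where
  pos v := stripPos p v
  pos_injective u v h := Fin.ext (hp.pos_injective h)
  curve := stripCurve p n
  curve_isSimpleArc u v h :=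
    isSimpleArc_segment fun h' => h.1 (Fin.ext (hp.pos_injective h'))
  pos_notMem_curve e he w hw h := by
    obtain ⟨u, v, rfl, -⟩ := exists_edge_of_mem_edgeSet he
    rcases hp.mem_of_pos_mem_segment h with h | h
    · exact hw (by simp [Fin.ext h])
    · exact hw (by simp [Fin.ext h])
  curve_inter_curve e he f hf hef z hz := by
    obtain ⟨i, j, rfl, hij⟩ := exists_edge_of_mem_edgeSet he
    obtain ⟨k, l, rfl, hkl⟩ := exists_edge_of_mem_edgeSet hf
    obtain ⟨h1, h2⟩ := hz
    rw [stripCurve_mk] at h1 h2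
    rcases lt_trichotomy (j : ℕ) l with h | h | h
    · obtain ⟨rfl, h3⟩ := hp.exists_common_end_of_lt hij hkl h h1 h2
      exact ⟨k, ⟨by rcases h3 with h | h <;> simp [Fin.ext h], by simp⟩, rfl⟩
    · obtain rfl := Fin.ext h
      have hik : (i : ℕ) ≠ k := fun h => hef (by rw [Fin.ext h])
      have := hp.exists_common_end_of_eq hij hkl hik h1 h2
      exact ⟨j, ⟨by simp, by simp⟩, this.symm⟩
    · obtain ⟨rfl, h3⟩ := hp.exists_common_end_of_lt hkl hij h h2 h1
      exact ⟨i, ⟨by simp, by rcases h3 with h | h <;> simp [Fin.ext h]⟩, rfl⟩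

lemma drawing_isOuterplane (hp : IsStripPattern p) (n : ℕ) : (hp.drawing n).IsOuterplane :=
  ⟨fun _ _ _ => rfl, fun v => stripPos_mem_sphere p v⟩

lemma segment_subset_support (hp : IsStripPattern p) {n i j : ℕ} (h : StripEdge p i j)
    (hj : j < n) : stripSegment p i j ⊆ (hp.drawing n).support := by
  have hi := hp.lt_of_edge h
  refine fun z hz => Or.inr (Set.mem_biUnion (x := s((⟨i, by omega⟩ : Fin n), ⟨j, hj⟩)) ?_ hz)
  exact hp.adj_of_edge (n := n) (u := ⟨i, by omega⟩) (v := ⟨j, hj⟩) h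

lemma exists_segment_of_mem_support (hp : IsStripPattern p) {n : ℕ} (hn : 2 ≤ n) {z : ℂ}
    (hz : z ∈ (hp.drawing n).support) :
    ∃ i j, StripEdge p i j ∧ j < n ∧ z ∈ stripSegment p i j := by
  rcases hz with ⟨v, rfl⟩ | hz
  · rcases Nat.eq_zero_or_pos (v : ℕ) with h | h
    · exact ⟨v, v + 1, Or.inl rfl, by omega, left_mem_segment ℝ _ _⟩
    · exact ⟨v - 1, v, Or.inl (by omega), v.2, right_mem_segment ℝ _ _⟩
  · simp only [PlanarDrawing.union, Set.mem_iUnion] at hz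
    obtain ⟨e, he, hz⟩ := hz
    obtain ⟨u, v, rfl, h⟩ := exists_edge_of_mem_edgeSet he
    exact ⟨u, v, h, v.2, hz⟩

lemma disjoint_face_support (hp : IsStripPattern p) {n m : ℕ} (hn : 2 ≤ n) (hm : 1 ≤ m) :
    Disjoint (stripFace p m) (hp.drawing n).support := by
  rw [Set.disjoint_left]
  intro z hz hz'
  obtain ⟨i, j, h, -, h'⟩ := hp.exists_segment_of_mem_support hn hz'
  exact Set.disjoint_left.1 (hp.disjoint_face_segment hm h) hz h'

/-- A point of a triangle lies in its interior or on the drawing. -/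
lemma mem_face_or_mem_support (hp : IsStripPattern p) {n m : ℕ} (hm : 1 ≤ m) (hmn : m + 1 < n)
    {z : ℂ} (hz : z ∈ stripTriangle p m) : z ∈ stripFace p m ∨ z ∈ (hp.drawing n).support := by
  rcases mem_openTriangle_or_side (hp.cross_ne_zero hm) hz with h | h | h | h
  · exact Or.inl h
  · exact Or.inr (hp.segment_subset_support (hp.edge_side hm) (by omega) h)
  · exact Or.inr (hp.segment_subset_support (i := m) (j := m + 1) (Or.inl rfl) hmn h)
  · exact Or.inr (hp.segment_subset_support (i := p (m + 1)) (j := m + 1)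
      (Or.inr ⟨by omega, rfl⟩) hmn h)

lemma component_eq_face (hp : IsStripPattern p) {n m : ℕ} (hm : 1 ≤ m) (hmn : m + 1 < n) {x : ℂ}
    (hx : x ∈ stripFace p m) :
    connectedComponentIn (hp.drawing n).supportᶜ x = stripFace p m := by
  refine connectedComponentIn_compl_eq (isOpen_openTriangle _ _ _)
    (convex_openTriangle _ _ _).isPreconnected (hp.disjoint_face_support (by omega) hm) ?_ hx
  intro z hz
  rw [frontier_openTriangle (hp.cross_ne_zero hm)] at hz
  exact (hp.mem_face_or_mem_support hm hmn hz.1).resolve_left hz.2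

lemma isInternalFace_iff (hp : IsStripPattern p) {n : ℕ} (hn : 3 ≤ n) (F : Set ℂ) :
    (hp.drawing n).IsInternalFace F ↔ ∃ m, 1 ≤ m ∧ m + 1 < n ∧ F = stripFace p m := by
  constructor
  · rintro ⟨⟨x, hx, rfl⟩, hb⟩
    by_cases hK : x ∈ convexHull ℝ (stripPos p '' Set.Iic (n - 2 + 1))
    · have := hp.convexHull_subset (by omega) hK
      simp only [Set.mem_iUnion] at this
      obtain ⟨m, ⟨hm1, hm2⟩, hxm⟩ := this
      have hxf := (hp.mem_face_or_mem_support (n := n) hm1 (by omega) hxm).resolve_right hx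
      exact ⟨m, hm1, by omega, hp.component_eq_face hm1 (by omega) hxf⟩
    · refine absurd hb (not_isBounded_component (convex_convexHull ℝ _)
        ((Set.nonempty_Iic.image _).convexHull) ?_ hK)
      intro z hz
      obtain ⟨i, j, hij, hj, hz⟩ := hp.exists_segment_of_mem_support (by omega) hz
      have := hp.lt_of_edge hij
      exact (convex_convexHull ℝ _).segment_subset
        (subset_convexHull ℝ _ (Set.mem_image_of_mem _ (by simp only [Set.mem_Iic]; omega)))
        (subset_convexHull ℝ _ (Set.mem_image_of_mem _ (by simp only [Set.mem_Iic]; omega))) hz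
  · rintro ⟨m, hm, hmn, rfl⟩
    obtain ⟨x, hx⟩ := openTriangle_nonempty (hp.cross_ne_zero hm)
    refine ⟨⟨x, fun h => Set.disjoint_left.1 (hp.disjoint_face_support (by omega) hm) hx h,
      (hp.component_eq_face hm hmn hx).symm⟩, ?_⟩
    exact (Metric.isBounded_closedBall (x := (0 : ℂ)) (r := 1)).subset
      ((openTriangle_subset _ _ _).trans (hp.stripTriangle_subset_closedBall hm))

lemma stripFace_injective (hp : IsStripPattern p) {m m' : ℕ} (hm : 1 ≤ m) (h : m < m') :
    stripFace p m ≠ stripFace p m' := by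
  intro heq
  obtain ⟨x, hx⟩ := openTriangle_nonempty (hp.cross_ne_zero hm)
  have h1 : x ∈ stripFace p m' := heq ▸ hx
  have h2 := hp.stripSide_face_neg hm hx
  have h3 := hp.stripSide_triangle_nonneg (a := m + 1) (by omega) h (openTriangle_subset _ _ _ h1)
  linarith

lemma side_subset_both_frontiers (hp : IsStripPattern p) {m : ℕ} (hm : 1 ≤ m) :
    stripSegment p (p (m + 2)) (m + 1) ⊆ frontier (stripFace p m) ∧
      stripSegment p (p (m + 2)) (m + 1) ⊆ frontier (stripFace p (m + 1)) := by
  refine ⟨?_, side_subset_frontier_left (hp.cross_ne_zero (by omega))⟩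
  rcases hp.succ (m + 1) (by omega) with h | h
  · rw [h]
    exact side_subset_frontier_right (hp.cross_ne_zero hm)
  · rw [h]
    exact side_subset_frontier_mid (hp.cross_ne_zero hm)

/-- Triangles that are not consecutive have no side in common: such a side would lie on both sides
of the strip that separate them. -/
lemma not_common_side (hp : IsStripPattern p) {m m' i j : ℕ} (hm : 1 ≤ m) (h : m + 2 ≤ m')
    (hij : i ≠ j) (h1 : stripSegment p i j ⊆ frontier (stripFace p m))
    (h2 : stripSegment p i j ⊆ frontier (stripFace p m')) : False := by
  have key : ∀ a, m < a → a ≤ m' → ∀ w, w = i ∨ w = j → w = a ∨ w = p (a + 1) := by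
    intro a ha ha' w hw
    have hmem : stripPos p w ∈ stripSegment p i j := by
      rcases hw with rfl | rfl
      · exact left_mem_segment ℝ _ _
      · exact right_mem_segment ℝ _ _
    have g1 := h1 hmem
    have g2 := h2 hmem
    rw [stripFace, frontier_openTriangle (hp.cross_ne_zero (by omega))] at g1 g2
    exact hp.eq_of_stripSide_eq_zero (by omega)
      (le_antisymm (hp.stripSide_triangle_nonpos hm ha g1.1)
        (hp.stripSide_triangle_nonneg (by omega) ha' g2.1))
  have a1 := key (m + 1) (by omega) (by omega) i (Or.inl rfl)
  have a2 := key (m + 1) (by omega) (by omega) j (Or.inr rfl)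
  have b1 := key (m + 2) (by omega) (by omega) i (Or.inl rfl)
  have b2 := key (m + 2) (by omega) (by omega) j (Or.inr rfl)
  have := hp.p_succ_lt (m := m + 1) (by omega)
  have := hp.p_succ_lt (m := m + 2) (by omega)
  omega

lemma exists_common_side_iff (hp : IsStripPattern p) {n m m' : ℕ} (hm : 1 ≤ m) (hmm : m < m')
    (hn : m' + 1 < n) : (∃ e ∈ (stripGraph p n).edgeSet,
      stripCurve p n e ⊆ frontier (stripFace p m) ∧ stripCurve p n e ⊆ frontier (stripFace p m')) ↔
      m + 1 = m' := by
  constructor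
  · rintro ⟨e, he, h1, h2⟩
    obtain ⟨u, v, rfl, huv⟩ := exists_edge_of_mem_edgeSet he
    by_contra hne
    exact hp.not_common_side hm (by omega) (hp.lt_of_edge huv).ne h1 h2
  · rintro rfl
    have hlt : p (m + 2) < m + 1 := hp.p_succ_lt (m := m + 1) (by omega)
    have hs := hp.side_subset_both_frontiers hm
    exact ⟨s((⟨p (m + 2), by omega⟩ : Fin n), ⟨m + 1, by omega⟩),
      hp.adj_of_edge (u := ⟨p (m + 2), by omega⟩) (v := ⟨m + 1, by omega⟩)
        (hp.edge_side (m := m + 1) (by omega)), hs.1, hs.2⟩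

/-- The faces of a strip, in the order of the strip. -/
noncomputable def faceEquiv (hp : IsStripPattern p) {n : ℕ} (hn : 3 ≤ n) :
    Fin (n - 2) ≃ {F : Set ℂ // (hp.drawing n).IsInternalFace F} :=
  Equiv.ofBijective
    (fun i => ⟨stripFace p (i + 1),
      (hp.isInternalFace_iff hn _).2 ⟨i + 1, by omega, by omega, rfl⟩⟩)
    ⟨by
      intro i j h
      have h' : stripFace p (i + 1) = stripFace p (j + 1) := congrArg Subtype.val h
      rcases lt_trichotomy (i : ℕ) j with hij | hij | hij
      · exact absurd h' (hp.stripFace_injective (by omega) (by omega))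
      · exact Fin.ext hij
      · exact absurd h'.symm (hp.stripFace_injective (by omega) (by omega)), by
      rintro ⟨F, hF⟩
      obtain ⟨m, hm, hmn, rfl⟩ := (hp.isInternalFace_iff hn F).1 hF
      exact ⟨⟨m - 1, by omega⟩, Subtype.ext (by simp only; rw [Nat.sub_add_cancel hm])⟩⟩

lemma isOuterpath (hp : IsStripPattern p) {n : ℕ} (hn : 3 ≤ n) :
    IsOuterpath (stripGraph p n) := by
  refine ⟨hp.drawing n, hp.drawing_isOuterplane n, n - 2, ⟨RelIso.symm ⟨hp.faceEquiv hn, ?_⟩⟩⟩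
  intro i j
  rw [SimpleGraph.pathGraph_adj]
  change (hp.faceEquiv hn i ≠ hp.faceEquiv hn j ∧ ∃ e ∈ (stripGraph p n).edgeSet,
    stripCurve p n e ⊆ frontier (stripFace p (i + 1)) ∧
    stripCurve p n e ⊆ frontier (stripFace p (j + 1))) ↔ _
  rw [(hp.faceEquiv hn).injective.ne_iff]
  rcases lt_trichotomy (i : ℕ) j with hij | hij | hij
  · rw [hp.exists_common_side_iff (by omega) (by omega) (by omega)]
    have : i ≠ j := fun h => by simp [h] at hij
    simp only [ne_eq, this, not_false_eq_true, true_and]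
    omega
  · have : i = j := Fin.ext hij
    simp [this]
  · have : i ≠ j := fun h => by simp [h] at hij
    simp only [ne_eq, this, not_false_eq_true, true_and]
    rw [show (∃ e ∈ (stripGraph p n).edgeSet,
      stripCurve p n e ⊆ frontier (stripFace p (i + 1)) ∧
      stripCurve p n e ⊆ frontier (stripFace p (j + 1))) ↔ _ from
      (exists_congr fun e => and_congr_right fun _ => and_comm).trans
      (hp.exists_common_side_iff (n := n) (m := j + 1)
        (m' := i + 1) (by omega) (by omega) (by omega))]
    omega

end IsStripPattern

/-! ### The number of edges of an outerplanar graph -/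

/-- Chords between points of a line, no two of which interleave, are few: each chord is the longest
one to the right of its left end or the longest one to the left of its right end, and the longest
chord of all is both. -/
lemma card_add_three_le_of_noncrossing {V : Type*} [Fintype V] [DecidableEq V] {a : V → ℝ}
    (ha : Function.Injective a) {E : Finset (V × V)} (hE : ∀ e ∈ E, a e.1 < a e.2)
    (hne : E.Nonempty)
    (hnc : ∀ e ∈ E, ∀ f ∈ E, ¬ (a e.1 < a f.1 ∧ a f.1 < a e.2 ∧ a e.2 < a f.2)) :
    E.card + 3 ≤ 2 * Fintype.card V := by
  classical
  set R := E.filter fun e => ∀ f ∈ E, f.1 = e.1 → a f.2 ≤ a e.2 with hR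
  set L := E.filter fun e => ∀ f ∈ E, f.2 = e.2 → a e.1 ≤ a f.1 with hL
  have hV : (Finset.univ : Finset V).Nonempty := ⟨hne.choose.1, Finset.mem_univ _⟩
  have hcov : E ⊆ R ∪ L := by
    intro e he
    by_contra h
    simp only [hR, hL, Finset.mem_union, Finset.mem_filter, he, true_and, not_or] at h
    push Not at h
    obtain ⟨⟨f, hf, hf1, hf2⟩, g, hg, hg1, hg2⟩ := h
    exact hnc g hg f hf ⟨by rwa [hf1], by rw [hf1, hg1]; exact hE e he, by rwa [hg1]⟩
  have hRc : R.card ≤ Fintype.card V - 1 := by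
    obtain ⟨v, -, hv⟩ := Finset.exists_max_image Finset.univ a hV
    rw [← Finset.card_univ, ← Finset.card_erase_of_mem (Finset.mem_univ v)]
    refine Finset.card_le_card_of_injOn Prod.fst ?_ ?_
    · intro e he
      have he' := (Finset.mem_filter.1 he).1
      refine Finset.mem_coe.2 (Finset.mem_erase.2 ⟨fun h => ?_, Finset.mem_univ _⟩)
      have h1 := hE e he'
      rw [h] at h1
      exact absurd (hv e.2 (Finset.mem_univ _)) (not_le.2 h1)
    · intro e he f hf hef
      obtain ⟨he1, he2⟩ := Finset.mem_filter.1 he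
      obtain ⟨hf1, hf2⟩ := Finset.mem_filter.1 hf
      exact Prod.ext hef (ha (le_antisymm (hf2 e he1 hef) (he2 f hf1 hef.symm)))
  have hLc : L.card ≤ Fintype.card V - 1 := by
    obtain ⟨v, -, hv⟩ := Finset.exists_min_image Finset.univ a hV
    rw [← Finset.card_univ, ← Finset.card_erase_of_mem (Finset.mem_univ v)]
    refine Finset.card_le_card_of_injOn Prod.snd ?_ ?_
    · intro e he
      have he' := (Finset.mem_filter.1 he).1
      refine Finset.mem_coe.2 (Finset.mem_erase.2 ⟨fun h => ?_, Finset.mem_univ _⟩)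
      have h1 := hE e he'
      rw [h] at h1
      exact absurd (hv e.1 (Finset.mem_univ _)) (not_le.2 h1)
    · intro e he f hf hef
      obtain ⟨he1, he2⟩ := Finset.mem_filter.1 he
      obtain ⟨hf1, hf2⟩ := Finset.mem_filter.1 hf
      exact Prod.ext (ha (le_antisymm (he2 f hf1 hef.symm) (hf2 e he1 hef))) hef
  have hboth : 1 ≤ (R ∩ L).card := by
    obtain ⟨e, he, hmax⟩ := Finset.exists_max_image E (fun e => a e.2 - a e.1) hne
    refine Finset.card_pos.2 ⟨e, Finset.mem_inter.2
      ⟨Finset.mem_filter.2 ⟨he, ?_⟩, Finset.mem_filter.2 ⟨he, ?_⟩⟩⟩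
    · intro f hf h
      have := hmax f hf
      rw [h] at this
      linarith
    · intro f hf h
      have := hmax f hf
      rw [h] at this
      linarith
  have h1 := Finset.card_le_card hcov
  have h2 := Finset.card_union_add_card_inter R L
  have h3 : 1 ≤ Fintype.card V := Fintype.card_pos_iff.2 ⟨hne.choose.1⟩
  omega

/-- Interleaving chords of the unit circle cross. -/
lemma exists_mem_chords {α β γ δ : ℝ} (h1 : α < β) (h2 : β < γ) (h3 : γ < δ)
    (h4 : δ < α + 2 * Real.pi) : ∃ z : ℂ,
      z ∈ segment ℝ (Complex.exp (α * Complex.I)) (Complex.exp (γ * Complex.I)) ∧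
      z ∈ segment ℝ (Complex.exp (β * Complex.I)) (Complex.exp (δ * Complex.I)) := by
  have hs : ∀ θ : ℝ, Complex.exp (θ * Complex.I) ∈ Metric.sphere (0 : ℂ) 1 := fun θ => by
    simp [Complex.norm_exp_ofReal_mul_I]
  have g1 := cross_exp_pos h1 h2 (by linarith)
  have g2 := cross_exp_pos (h1.trans h2) h3 h4
  set A := Complex.exp (α * Complex.I)
  set B := Complex.exp (β * Complex.I)
  set C := Complex.exp (γ * Complex.I)
  set D := Complex.exp (δ * Complex.I)
  set u := cross A B C with hu
  set v := cross A C D with hv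
  have e1 : cross A C B = -u := by simp only [hu, cross]; ring
  have hAC : A ≠ C := by
    intro h
    rw [hu, h] at g1
    simp [cross] at g1
  have hsum : v / (u + v) + u / (u + v) = 1 := by field_simp; ring
  have hz : (v / (u + v)) • B + (u / (u + v)) • D ∈ segment ℝ B D :=
    ⟨_, _, by positivity, by positivity, hsum, rfl⟩
  refine ⟨_, mem_chord_of_cross_eq_zero (hs α) (hs γ) hAC ?_ ?_, hz⟩
  · exact (convex_closedBall (0 : ℂ) 1).segment_subset (Metric.sphere_subset_closedBall (hs β))
      (Metric.sphere_subset_closedBall (hs δ)) hz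
  · rw [cross_affine _ _ _ _ hsum, e1, ← hv]
    field_simp
    ring

lemma encard_edgeSet_le_of_isOuterplanar {n : ℕ} (hn : 2 ≤ n) {H : SimpleGraph (Fin n)}
    (h : IsOuterplanar H) : H.edgeSet.encard ≤ ((2 * n - 3 : ℕ) : ℕ∞) := by
  classical
  obtain ⟨D, hD, hS⟩ := h
  set a : Fin n → ℝ := fun v => Complex.arg (D.pos v) with ha
  have hpos : ∀ v, D.pos v = Complex.exp (a v * Complex.I) := by
    intro v
    have h1 := Complex.norm_mul_exp_arg_mul_I (D.pos v)
    have h2 : ‖D.pos v‖ = 1 := by simpa using hS v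
    rw [h2] at h1
    simpa using h1.symm
  have hinj : Function.Injective a := by
    intro u v huv
    apply D.pos_injective
    rw [hpos, hpos, huv]
  set E : Finset (Fin n × Fin n) :=
    Finset.univ.filter fun e => H.Adj e.1 e.2 ∧ a e.1 < a e.2 with hE
  have hcard : H.edgeSet.encard ≤ E.card := by
    rw [← Set.encard_coe_eq_coe_finsetCard]
    refine le_trans (Set.encard_le_encard ?_)
      (Set.encard_image_le (fun e : Fin n × Fin n => s(e.1, e.2)) _)
    intro e he
    induction e with
    | _ u v =>
      have hadj : H.Adj u v := he
      rcases lt_or_gt_of_ne (hinj.ne hadj.ne) with h | h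
      · exact ⟨(u, v), by simp [hE, hadj, h], rfl⟩
      · exact ⟨(v, u), by simp [hE, hadj.symm, h], Sym2.eq_swap⟩
  refine hcard.trans (Nat.cast_le.2 ?_)
  rcases E.eq_empty_or_nonempty with h0 | h0
  · simp [h0]
  have := card_add_three_le_of_noncrossing hinj (E := E) (by simp [hE]) h0 ?_
  · simp only [Fintype.card_fin] at this
    omega
  rintro ⟨u, w⟩ he ⟨v, x⟩ hf ⟨h1, h2, h3⟩
  simp only [hE, Finset.mem_filter, Finset.mem_univ, true_and] at he hf h1 h2 h3
  have g1 := Complex.neg_pi_lt_arg (D.pos u)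
  have g2 := Complex.arg_le_pi (D.pos x)
  obtain ⟨z, hz1, hz2⟩ := exists_mem_chords h1 h2 h3
    (show a x < a u + 2 * Real.pi by simp only [ha]; linarith)
  rw [← hpos, ← hpos] at hz1 hz2
  rw [← hD _ _ he.1] at hz1
  rw [← hD _ _ hf.1] at hz2
  have huv : u ≠ v := fun h => by simp [h] at h1
  have hux : u ≠ x := fun h => by
    have := he.2; have := hf.2; rw [h] at h1; linarith
  have hwv : w ≠ v := fun h => by simp [h] at h2
  have hwx : w ≠ x := fun h => by simp [h] at h3
  obtain ⟨y, ⟨hy1, hy2⟩, -⟩ := D.curve_inter_curve s(u, w) he.1 s(v, x) hf.1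
    (by simp [huv, hux]) ⟨hz1, hz2⟩
  rw [Sym2.mem_iff] at hy1 hy2
  rcases hy1 with rfl | rfl <;> rcases hy2 with h | h <;> contradiction

lemma IsStripPattern.le_encard_edgeSet {p : ℕ → ℕ} (hp : IsStripPattern p) {n : ℕ} (hn : 2 ≤ n) :
    ((2 * n - 3 : ℕ) : ℕ∞) ≤ (stripGraph p n).edgeSet.encard := by
  have hp2 : ∀ k : ℕ, p (k + 2) ≤ k := fun k => by
    have := hp.add_two_le (k := k + 2) (by omega); omega
  set f : Fin (n - 1) → Sym2 (Fin n) := fun k => s(⟨k, by omega⟩, ⟨k + 1, by omega⟩) with hf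
  set g : Fin (n - 2) → Sym2 (Fin n) :=
    fun k => s(⟨p (k + 2), by have := hp2 k; omega⟩, ⟨k + 2, by omega⟩) with hg
  have hfi : Function.Injective f := by
    intro i j h
    simp only [hf, Sym2.eq_iff, Fin.mk.injEq] at h
    exact Fin.ext (by omega)
  have hgi : Function.Injective g := by
    intro i j h
    simp only [hg, Sym2.eq_iff, Fin.mk.injEq] at h
    have := hp2 i
    have := hp2 j
    exact Fin.ext (by omega)
  have hdis : Disjoint (Set.range f) (Set.range g) := by
    rw [Set.disjoint_left]
    rintro _ ⟨i, rfl⟩ ⟨j, h⟩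
    simp only [hf, hg, Sym2.eq_iff, Fin.mk.injEq] at h
    have := hp2 j
    omega
  have hsub : Set.range f ∪ Set.range g ⊆ (stripGraph p n).edgeSet := by
    rintro _ (⟨i, rfl⟩ | ⟨i, rfl⟩)
    · exact hp.adj_of_edge (u := ⟨i, by omega⟩) (v := ⟨i + 1, by omega⟩) (Or.inl rfl)
    · exact hp.adj_of_edge (u := ⟨p (i + 2), by have := hp2 i; omega⟩) (v := ⟨i + 2, by omega⟩)
        (Or.inr ⟨by simp, rfl⟩)
  refine le_trans (le_of_eq ?_) (Set.encard_le_encard hsub)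
  rw [Set.encard_union_eq hdis, ← Set.image_univ, ← Set.image_univ, hfi.encard_image,
    hgi.encard_image, Set.encard_univ, Set.encard_univ]
  simp only [ENat.card_eq_coe_fintype_card, Fintype.card_fin]
  norm_cast
  omega

/-- The graph of a strip of triangles is a maximal outerpath. -/
theorem IsStripPattern.isMaximalOuterpath {p : ℕ → ℕ} (hp : IsStripPattern p) {n : ℕ}
    (hn : 3 ≤ n) : IsMaximalOuterpath (stripGraph p n) :=
  ⟨⟨⟨hp.drawing n, hp.drawing_isOuterplane n⟩, fun _ hH =>
    (encard_edgeSet_le_of_isOuterplanar (by omega) hH).trans (hp.le_encard_edgeSet (by omega))⟩,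
    hp.isOuterpath hn⟩

/-! ### Drawings with `x`-monotone edges -/

/-- The part of the graph of `f` above the set `s`. -/
def graphOver (f : ℝ → ℝ) (s : Set ℝ) : Set ℂ := {z | z.re ∈ s ∧ z.im = f z.re}

lemma isSimpleArc_graphOver {f : ℝ → ℝ} (hf : Continuous f) {a b : ℝ} (hab : a ≠ b) {p q : ℂ}
    (hp : p.re = a ∧ p.im = f a) (hq : q.re = b ∧ q.im = f b) :
    IsSimpleArc (graphOver f (Set.uIcc a b)) p q := by
  have hl : Continuous fun t : unitInterval => AffineMap.lineMap a b (t : ℝ) := by fun_prop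
  have hpe : p = ⟨a, f a⟩ := Complex.ext hp.1 hp.2
  have hqe : q = ⟨b, f b⟩ := Complex.ext hq.1 hq.2
  subst hpe hqe
  refine ⟨⟨⟨fun t => (⟨AffineMap.lineMap a b (t : ℝ), f (AffineMap.lineMap a b (t : ℝ))⟩ : ℂ), ?_⟩,
    by simp, by simp⟩, ?_, ?_⟩
  · exact Complex.equivRealProdCLM.symm.continuous.comp (hl.prodMk (hf.comp hl))
  · intro s t hst
    exact Subtype.ext (AffineMap.lineMap_injective ℝ hab (congrArg Complex.re hst))
  · ext z
    constructor
    · rintro ⟨t, rfl⟩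
      refine ⟨?_, rfl⟩
      rw [← segment_eq_uIcc, segment_eq_image_lineMap]
      exact ⟨t, t.2, rfl⟩
    · rintro ⟨h1, h2⟩
      rw [← segment_eq_uIcc, segment_eq_image_lineMap] at h1
      obtain ⟨t, ht, h⟩ := h1
      exact ⟨⟨t, ht⟩, Complex.ext h (by rw [h2, ← h]; rfl)⟩

lemma graphOver_affine {f : ℝ → ℝ} {m c : ℝ} (hf : ∀ t, f t = m * t + c) {p q : ℂ}
    (hp : p.im = f p.re) (hq : q.im = f q.re) :
    graphOver f (Set.uIcc p.re q.re) = segment ℝ p q := by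
  rw [hf] at hp hq
  ext z
  constructor
  · rintro ⟨h1, h2⟩
    rw [← segment_eq_uIcc] at h1
    obtain ⟨s, t, hs, ht, hst, h⟩ := h1
    refine ⟨s, t, hs, ht, hst, Complex.ext (by simpa using h) ?_⟩
    rw [h2, hf, ← h]
    simp only [Complex.add_im, Complex.smul_im, smul_eq_mul, hp, hq]
    linear_combination c * hst
  · rintro ⟨s, t, hs, ht, hst, rfl⟩
    refine ⟨?_, ?_⟩
    · rw [← segment_eq_uIcc]
      exact ⟨s, t, hs, ht, hst, by simp⟩
    · rw [hf]
      simp only [Complex.add_im, Complex.add_re, Complex.smul_im, Complex.smul_re, smul_eq_mul, hp,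
        hq]
      linear_combination c * hst

/-- A drawing of a strip in which every edge is part of one of finitely many arcs, each of which is
the graph of a function: the vertex `k` is placed at `(x k, y k)`, and the edge `{i, j}` with
`i < j` is the part of the graph of `f (arcOf i j)` between its ends. -/
structure MonotoneLayout (p : ℕ → ℕ) (n : ℕ) (ι : Type*) where
  /-- the abscissae of the vertices -/
  x : ℕ → ℝ
  /-- the ordinates of the vertices -/
  y : ℕ → ℝ
  /-- the functions whose graphs contain the arcs -/
  f : ι → ℝ → ℝ
  /-- the arc that contains a given edge -/
  arcOf : ℕ → ℕ → ι
  isStripPattern : IsStripPattern p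
  x_injOn : ∀ i < n, ∀ j < n, x i = x j → i = j
  continuous_f : ∀ a, Continuous (f a)
  mem_graph : ∀ i j, StripEdge p i j → j < n →
    y i = f (arcOf i j) (x i) ∧ y j = f (arcOf i j) (x j)
  not_between : ∀ i j w, StripEdge p i j → j < n → w < n → x w ∈ Set.uIcc (x i) (x j) →
    y w = f (arcOf i j) (x w) → w = i ∨ w = j
  meet : ∀ i j k l, StripEdge p i j → j < n → StripEdge p k l → l < n → arcOf i j ≠ arcOf k l →
    ∀ t ∈ Set.uIcc (x i) (x j), t ∈ Set.uIcc (x k) (x l) → f (arcOf i j) t = f (arcOf k l) t →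
    ∃ w < n, x w = t ∧ y w = f (arcOf i j) t

namespace MonotoneLayout

variable {p : ℕ → ℕ} {n : ℕ} {ι : Type*} (L : MonotoneLayout p n ι)

/-- The position of a vertex. -/
def pos (k : ℕ) : ℂ := ⟨L.x k, L.y k⟩

/-- The arc that contains a given edge. -/
def arc (e : Sym2 (Fin n)) : ι := L.arcOf (e.inf : Fin n) (e.sup : Fin n)

/-- The curve that represents an edge. -/
def curve (e : Sym2 (Fin n)) : Set ℂ :=
  graphOver (L.f (L.arc e)) (Set.uIcc (L.x (e.inf : Fin n)) (L.x (e.sup : Fin n)))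

lemma arc_mk {u v : Fin n} (h : StripEdge p u v) : L.arc s(u, v) = L.arcOf u v := by
  have : u ≤ v := (L.isStripPattern.lt_of_edge h).le
  simp [arc, this]

lemma curve_mk {u v : Fin n} (h : StripEdge p u v) : L.curve s(u, v) =
    graphOver (L.f (L.arcOf u v)) (Set.uIcc (L.x u) (L.x v)) := by
  have : u ≤ v := (L.isStripPattern.lt_of_edge h).le
  rw [curve, L.arc_mk h]
  simp [this]

lemma x_ne_of_edge {i j : ℕ} (h : StripEdge p i j) (hj : j < n) : L.x i ≠ L.x j := fun h' => by
  have h1 := L.isStripPattern.lt_of_edge h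
  have := L.x_injOn i (by omega) j hj h'
  omega

lemma isSimpleArc_curve {u v : Fin n} (h : StripEdge p u v) :
    IsSimpleArc (L.curve s(u, v)) (L.pos u) (L.pos v) := by
  rw [L.curve_mk h]
  exact isSimpleArc_graphOver (L.continuous_f _) (L.x_ne_of_edge h v.2)
    ⟨rfl, (L.mem_graph _ _ h v.2).1⟩ ⟨rfl, (L.mem_graph _ _ h v.2).2⟩

/-- Two edges on the same arc overlap in a common end only, because otherwise an end of one of them
would lie inside the other. -/
lemma exists_common_end {i j k l : ℕ} (hij : StripEdge p i j) (hj : j < n)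
    (hkl : StripEdge p k l) (hl : l < n) (hne : ¬ (i = k ∧ j = l))
    (ha : L.arcOf i j = L.arcOf k l) {t : ℝ} (h1 : t ∈ Set.uIcc (L.x i) (L.x j))
    (h2 : t ∈ Set.uIcc (L.x k) (L.x l)) : ∃ w, (w = i ∨ w = j) ∧ (w = k ∨ w = l) ∧ L.x w = t := by
  have hi := L.isStripPattern.lt_of_edge hij
  have hk := L.isStripPattern.lt_of_edge hkl
  have mij := L.mem_graph i j hij hj
  have mkl := L.mem_graph k l hkl hl
  have nij := fun w hw h => L.not_between i j w hij hj hw h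
  have nkl := fun w hw h => L.not_between k l w hkl hl hw h
  rw [ha] at nij mij
  have hix := L.x_ne_of_edge hij hj
  have hkx := L.x_ne_of_edge hkl hl
  have b1 := fun h => nij k (by omega) h mkl.1
  have b2 := fun h => nij l (by omega) h mkl.2
  have b3 := fun h => nkl i (by omega) h mij.1
  have b4 := fun h => nkl j (by omega) h mij.2
  rw [Set.mem_uIcc] at h1 h2 b1 b2 b3 b4
  -- an end of one of the edges lies in the other one on each side of `t`
  have left : ∃ w, (w = i ∨ w = j) ∧ (w = k ∨ w = l) ∧ L.x w ≤ t := by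
    rcases h1 with h1 | h1 <;> rcases h2 with h2 | h2
    · rcases le_total (L.x i) (L.x k) with h | h
      · exact ⟨k, b1 (by grind), by simp, h2.1⟩
      · exact ⟨i, by simp, b3 (by grind), h1.1⟩
    · rcases le_total (L.x i) (L.x l) with h | h
      · exact ⟨l, b2 (by grind), by simp, h2.1⟩
      · exact ⟨i, by simp, b3 (by grind), h1.1⟩
    · rcases le_total (L.x j) (L.x k) with h | h
      · exact ⟨k, b1 (by grind), by simp, h2.1⟩
      · exact ⟨j, by simp, b4 (by grind), h1.1⟩
    · rcases le_total (L.x j) (L.x l) with h | h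
      · exact ⟨l, b2 (by grind), by simp, h2.1⟩
      · exact ⟨j, by simp, b4 (by grind), h1.1⟩
  have right : ∃ w, (w = i ∨ w = j) ∧ (w = k ∨ w = l) ∧ t ≤ L.x w := by
    rcases h1 with h1 | h1 <;> rcases h2 with h2 | h2
    · rcases le_total (L.x j) (L.x l) with h | h
      · exact ⟨j, by simp, b4 (by grind), h1.2⟩
      · exact ⟨l, b2 (by grind), by simp, h2.2⟩
    · rcases le_total (L.x j) (L.x k) with h | h
      · exact ⟨j, by simp, b4 (by grind), h1.2⟩
      · exact ⟨k, b1 (by grind), by simp, h2.2⟩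
    · rcases le_total (L.x i) (L.x l) with h | h
      · exact ⟨i, by simp, b3 (by grind), h1.2⟩
      · exact ⟨l, b2 (by grind), by simp, h2.2⟩
    · rcases le_total (L.x i) (L.x k) with h | h
      · exact ⟨i, by simp, b3 (by grind), h1.2⟩
      · exact ⟨k, b1 (by grind), by simp, h2.2⟩
  obtain ⟨w, hw1, hw2, hw3⟩ := left
  obtain ⟨w', hw1', hw2', hw3'⟩ := right
  have : w = w' := by omega
  subst this
  exact ⟨w, hw1, hw2, le_antisymm hw3 hw3'⟩

/-- The drawing given by a layout. -/
def drawing : PlanarDrawing (stripGraph p n) where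
  pos v := L.pos v
  pos_injective u v h := Fin.ext (L.x_injOn u u.2 v v.2 (congrArg Complex.re h))
  curve := L.curve
  curve_isSimpleArc u v h := by
    rcases h.2 with h | h
    · exact L.isSimpleArc_curve h
    · obtain ⟨γ, h1, h2⟩ := L.isSimpleArc_curve h
      rw [Sym2.eq_swap]
      exact ⟨γ.symm, h1.comp unitInterval.symm_bijective.injective, by rw [Path.symm_range, h2]⟩
  pos_notMem_curve e he w hw h := by
    obtain ⟨u, v, rfl, huv⟩ := exists_edge_of_mem_edgeSet he
    rw [L.curve_mk huv] at h
    rcases L.not_between u v w huv v.2 w.2 h.1 h.2 with h | h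
    · exact hw (by simp [Fin.ext h])
    · exact hw (by simp [Fin.ext h])
  curve_inter_curve e he e' he' hne z hz := by
    obtain ⟨i, j, rfl, hij⟩ := exists_edge_of_mem_edgeSet he
    obtain ⟨k, l, rfl, hkl⟩ := exists_edge_of_mem_edgeSet he'
    rw [L.curve_mk hij, L.curve_mk hkl] at hz
    obtain ⟨⟨h1, h2⟩, h3, h4⟩ := hz
    by_cases ha : L.arcOf i j = L.arcOf k l
    · obtain ⟨w, hw1, hw2, hw⟩ := L.exists_common_end hij j.2 hkl l.2
        (fun h => hne (by rw [Fin.ext h.1, Fin.ext h.2])) ha h1 h3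
      have hwn : w < n := by rcases hw1 with rfl | rfl <;> exact Fin.is_lt _
      have hm := L.mem_graph i j hij j.2
      refine ⟨⟨w, hwn⟩, ⟨?_, ?_⟩, Complex.ext hw ?_⟩
      · rcases hw1 with rfl | rfl <;> simp
      · rcases hw2 with rfl | rfl <;> simp
      · rw [h2, ← hw]
        rcases hw1 with rfl | rfl
        · exact hm.1
        · exact hm.2
    · obtain ⟨w, hwn, hw1, hw2⟩ := L.meet i j k l hij j.2 hkl l.2 ha z.re h1 h3
        (h2.symm.trans h4)
      have hz : L.pos w = z := Complex.ext hw1 (hw2.trans h2.symm)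
      refine ⟨⟨w, hwn⟩, ⟨?_, ?_⟩, hz⟩
      · rcases L.not_between i j w hij j.2 hwn (by rwa [hw1])
          (by rw [hw1]; exact hw2) with h | h <;>
          simp [Fin.ext_iff, h]
      · rcases L.not_between k l w hkl l.2 hwn (by rwa [hw1]) (by rw [hw1, hw2, ← h4, h2])
          with h | h <;> simp [Fin.ext_iff, h]

/-- The edges on an arc. -/
def arcEdges (a : ι) : Set (Sym2 (Fin n)) := {e | e ∈ (stripGraph p n).edgeSet ∧ L.arc e = a}

/-- If the edges on an arc cover the interval `s` then they form the graph above `s`. -/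
lemma union_arcEdges (a : ι) {s : Set ℝ}
    (h1 : ∀ i j, StripEdge p i j → j < n → L.arcOf i j = a → Set.uIcc (L.x i) (L.x j) ⊆ s)
    (h2 : ∀ t ∈ s, ∃ i j, StripEdge p i j ∧ j < n ∧ L.arcOf i j = a ∧
      t ∈ Set.uIcc (L.x i) (L.x j)) :
    L.drawing.union (L.arcEdges a) = graphOver (L.f a) s := by
  ext z
  simp only [PlanarDrawing.union, Set.mem_iUnion]
  constructor
  · rintro ⟨e, ⟨he, rfl⟩, hz⟩
    obtain ⟨u, v, rfl, huv⟩ := exists_edge_of_mem_edgeSet he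
    have hz' : z ∈ L.curve s(u, v) := hz
    rw [L.curve_mk huv] at hz'
    rw [L.arc_mk huv] at h1 ⊢
    exact ⟨h1 u v huv v.2 rfl hz'.1, hz'.2⟩
  · rintro ⟨hz1, hz2⟩
    obtain ⟨i, j, hij, hj, rfl, ht⟩ := h2 _ hz1
    have hi := L.isStripPattern.lt_of_edge hij
    have hij' : StripEdge p (⟨i, by omega⟩ : Fin n) (⟨j, hj⟩ : Fin n) := hij
    refine ⟨s(⟨i, by omega⟩, ⟨j, hj⟩), ⟨L.isStripPattern.adj_of_edge hij', L.arc_mk hij'⟩, ?_⟩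
    change z ∈ L.curve _
    rw [L.curve_mk hij']
    exact ⟨ht, hz2⟩

lemma isEdgePartition {N : ℕ} (c : ι → ℕ)
    (h : ∀ i j, StripEdge p i j → j < n → c (L.arcOf i j) < N) :
    IsEdgePartition (stripGraph p n)
      (fun i : Fin N => {e | e ∈ (stripGraph p n).edgeSet ∧ c (L.arc e) = i}) := by
  refine ⟨?_, fun i j hij => ?_⟩
  · ext e
    rw [Set.mem_iUnion]
    refine ⟨fun ⟨i, hi⟩ => hi.1, fun he => ?_⟩
    obtain ⟨u, v, rfl, huv⟩ := exists_edge_of_mem_edgeSet he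
    exact ⟨⟨_, h u v huv v.2⟩, he, congrArg c (L.arc_mk huv)⟩
  · refine Set.disjoint_left.2 ?_
    rintro e ⟨-, h⟩ ⟨-, h'⟩
    exact hij (Fin.ext (h.symm.trans h'))

lemma isStraightLine (h : ∀ a, ∃ m c : ℝ, ∀ t, L.f a t = m * t + c) :
    L.drawing.IsStraightLine := by
  have key : ∀ u v : Fin n, StripEdge p u v →
      L.drawing.curve s(u, v) = segment ℝ (L.drawing.pos u) (L.drawing.pos v) := by
    intro u v huv
    obtain ⟨m, c, hmc⟩ := h (L.arcOf u v)
    exact (L.curve_mk huv).trans (graphOver_affine (p := L.pos u) (q := L.pos v) hmc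
      (L.mem_graph _ _ huv v.2).1 (L.mem_graph _ _ huv v.2).2)
  intro u v huv
  rcases huv.2 with h | h
  · exact key u v h
  · rw [Sym2.eq_swap, segment_symm]
    exact key v u h

end MonotoneLayout

/-! ### Counting the segments of a straight-line drawing -/

lemma IsLineSegment.exists_param {A : Set ℂ} (hA : IsLineSegment A) {p q : ℂ} (hp : p ∈ A)
    (hq : q ∈ A) (hpq : p ≠ q) : ∃ a b : ℝ, a ≤ 0 ∧ 1 ≤ b ∧
      A = (fun t : ℝ => p + t • (q - p)) '' Set.Icc a b := by
  obtain ⟨u, v, -, rfl⟩ := hA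
  have main : ∀ u v : ℂ, ∀ s t : ℝ, 0 ≤ s → s ≤ 1 → 0 ≤ t → t ≤ 1 → s < t →
      p = (1 - s) • u + s • v → q = (1 - t) • u + t • v → ∃ a b : ℝ, a ≤ 0 ∧ 1 ≤ b ∧
      segment ℝ u v = (fun t : ℝ => p + t • (q - p)) '' Set.Icc a b := by
    intro u v s t hs0 hs1 ht0 ht1 hst hp hq
    have hts : 0 < t - s := by linarith
    refine ⟨-s / (t - s), (1 - s) / (t - s), ?_, ?_, ?_⟩
    · exact div_nonpos_of_nonpos_of_nonneg (by linarith) hts.le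
    · rw [le_div_iff₀ hts]; linarith
    · ext z
      constructor
      · intro hz
        obtain ⟨r, hr0, hr1, rfl⟩ := exists_affine_of_mem_segment hz
        refine ⟨(r - s) / (t - s), ⟨?_, ?_⟩, ?_⟩
        · gcongr; linarith
        · gcongr
        · simp only [hp, hq]
          apply Complex.ext
          · simp only [Complex.add_re, Complex.smul_re, smul_eq_mul, Complex.sub_re]
            field_simp
            ring
          · simp only [Complex.add_im, Complex.smul_im, smul_eq_mul, Complex.sub_im]
            field_simp
            ring
      · rintro ⟨r, ⟨hr0, hr1⟩, rfl⟩
        rw [div_le_iff₀ hts] at hr0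
        rw [le_div_iff₀ hts] at hr1
        refine mem_segment_of_affine (t := s + r * (t - s)) (by linarith) (by linarith) ?_
        simp only [hp, hq]
        apply Complex.ext
        · simp only [Complex.add_re, Complex.smul_re, smul_eq_mul, Complex.sub_re]
          ring
        · simp only [Complex.add_im, Complex.smul_im, smul_eq_mul, Complex.sub_im]
          ring
  obtain ⟨s, hs0, hs1, hs⟩ := exists_affine_of_mem_segment hp
  obtain ⟨t, ht0, ht1, ht⟩ := exists_affine_of_mem_segment hq
  rcases lt_trichotomy s t with h | h | h
  · exact main u v s t hs0 hs1 ht0 ht1 h hs ht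
  · exact absurd (by rw [hs, ht, h]) hpq
  · rw [segment_symm]
    exact main v u (1 - s) (1 - t) (by linarith) (by linarith) (by linarith) (by linarith)
      (by linarith) (by rw [hs]; simp [add_comm]) (by rw [ht]; simp [add_comm])

/-- Line segments that have two points in common form a line segment. -/
lemma IsLineSegment.union {A B : Set ℂ} (hA : IsLineSegment A) (hB : IsLineSegment B) {p q : ℂ}
    (hpA : p ∈ A) (hqA : q ∈ A) (hpB : p ∈ B) (hqB : q ∈ B) (hpq : p ≠ q) :
    IsLineSegment (A ∪ B) := by
  obtain ⟨a, b, ha, hb, rfl⟩ := hA.exists_param hpA hqA hpq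
  obtain ⟨c, d, hc, hd, rfl⟩ := hB.exists_param hpB hqB hpq
  rw [← Set.image_union, Set.Icc_union_Icc' (by linarith) (by linarith)]
  have hlt : min a c < max b d := by
    have := min_le_left a c
    have := le_max_left b d
    linarith
  have hpq' : q - p ≠ 0 := sub_ne_zero.2 hpq.symm
  refine ⟨p + (min a c) • (q - p), p + (max b d) • (q - p), ?_, ?_⟩
  · intro h
    have h1 := smul_left_injective ℝ hpq' (add_left_cancel h)
    exact hlt.ne h1
  · have : (fun t : ℝ => p + t • (q - p)) = AffineMap.lineMap (k := ℝ) p q := by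
      ext t
      simp [AffineMap.lineMap_apply, add_comm]
    rw [this, ← segment_eq_Icc hlt.le, image_segment, ← this]

lemma PlanarDrawing.union_union {V : Type*} {G : SimpleGraph V} (D : PlanarDrawing G)
    (F F' : Set (Sym2 V)) : D.union (F ∪ F') = D.union F ∪ D.union F' := by
  simp only [PlanarDrawing.union, Set.biUnion_union]

/-- Sets of edges that form line segments and have an edge in common form a line segment. -/
lemma PlanarDrawing.isLineSegment_union {V : Type*} {G : SimpleGraph V} (D : PlanarDrawing G)
    (hD : D.IsStraightLine) {F F' : Set (Sym2 V)} (hF : IsLineSegment (D.union F))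
    (hF' : IsLineSegment (D.union F')) {e : Sym2 V} (he : e ∈ G.edgeSet) (heF : e ∈ F)
    (heF' : e ∈ F') : IsLineSegment (D.union (F ∪ F')) := by
  induction e with
  | _ u v =>
    have hadj : G.Adj u v := he
    have h1 : D.pos u ∈ D.curve s(u, v) := by rw [hD u v hadj]; exact left_mem_segment ℝ _ _
    have h2 : D.pos v ∈ D.curve s(u, v) := by rw [hD u v hadj]; exact right_mem_segment ℝ _ _
    rw [D.union_union]
    exact hF.union hF' (Set.mem_biUnion heF h1) (Set.mem_biUnion heF h2) (Set.mem_biUnion heF' h1)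
      (Set.mem_biUnion heF' h2) (D.pos_injective.ne hadj.ne)

/-- If the edges are covered by `N` sets that form line segments then there are at most `N`
segments, because a segment is determined by any of its edges. -/
lemma PlanarDrawing.segmentNumber_le {V : Type*} {G : SimpleGraph V} (D : PlanarDrawing G)
    (hD : D.IsStraightLine) {N : ℕ} (E : Fin N → Set (Sym2 V)) (hE : (⋃ i, E i) = G.edgeSet)
    (hline : ∀ i, IsLineSegment (D.union (E i))) : D.segmentNumber ≤ N := by
  have hsub : ∀ i, E i ⊆ G.edgeSet := fun i => hE ▸ Set.subset_iUnion E i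
  have key : ∀ F : {F // D.IsSegment F}, ∃ i, ∃ e ∈ E i, e ∈ F.1 := by
    rintro ⟨F, hF⟩
    obtain ⟨a, b, -, hab⟩ := hF.prop.2
    have ha : a ∈ D.union F := hab ▸ left_mem_segment ℝ a b
    simp only [PlanarDrawing.union, Set.mem_iUnion] at ha
    obtain ⟨e, he, -⟩ := ha
    have := hF.prop.1 he
    rw [← hE, Set.mem_iUnion] at this
    obtain ⟨i, hi⟩ := this
    exact ⟨i, e, hi, he⟩
  choose g e he heF using key
  have hcont : ∀ F, E (g F) ⊆ F.1 := by
    intro F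
    have h1 := D.isLineSegment_union hD F.2.prop.2 (hline (g F)) (hsub _ (he F)) (heF F) (he F)
    have h2 := F.2.eq_of_subset ⟨Set.union_subset F.2.prop.1 (hsub _), h1⟩ Set.subset_union_left
    rw [h2]
    exact Set.subset_union_right
  have hinj : Function.Injective g := by
    intro F F' h
    have heF' : e F ∈ F'.1 := hcont F' (h ▸ he F)
    have h1 := D.isLineSegment_union hD F.2.prop.2 F'.2.prop.2 (hsub _ (he F)) (heF F) heF'
    have h2 : F.1 ∪ F'.1 ⊆ G.edgeSet := Set.union_subset F.2.prop.1 F'.2.prop.1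
    have h3 := F.2.eq_of_subset ⟨h2, h1⟩ Set.subset_union_left
    have h4 := F'.2.eq_of_subset ⟨h2, h1⟩ Set.subset_union_right
    exact Subtype.ext (h3.trans h4.symm)
  have h := ENat.card_le_card_of_injective hinj
  rw [ENat.card_eq_coe_fintype_card (α := Fin N), Fintype.card_fin] at h
  exact h

/-! ### Fans and segments -/

lemma isStripPattern_fan : IsStripPattern fun _ => 0 := ⟨rfl, fun _ _ => Or.inl rfl⟩

/-- The abscissae of the vertices of a fan with `2 * k + 2` vertices: the hub `0`, the vertices
`1, …, k` on the left side, the apex `k + 1` and the vertices `k + 2, …, 2 * k + 1` on the right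
side. The vertices `j` and `k + 1 + j` are collinear with the hub. -/
noncomputable def fanX (k j : ℕ) : ℝ :=
  if j = 0 then 0 else if j ≤ k then 1 - 2 * ((k : ℝ) + 1 - j) else if j = k + 1 then 3
  else 2 - 1 / (2 * (k : ℝ) + 2 - j)

/-- The ordinates of the vertices of a fan. -/
noncomputable def fanY (k j : ℕ) : ℝ :=
  if j = 0 then 0 else if j ≤ k + 1 then 1 else -(1 / (2 * (k : ℝ) + 2 - j))

/-- The lines that carry a fan: line `0` joins the hub to the apex, line `a` with `1 ≤ a ≤ k` passes
through `a`, the hub and `k + 1 + a`, and the lines `k + 1` and `k + 2` are the left and the right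
side. -/
noncomputable def fanLine (k a : ℕ) (t : ℝ) : ℝ :=
  if a = 0 then t / 3 else if a ≤ k then -t / (2 * ((k : ℝ) + 1 - a) - 1)
  else if a = k + 1 then 1 else t - 2

/-- The line that carries an edge of a fan. -/
def fanArc (k i j : ℕ) : ℕ :=
  if i = 0 then if j ≤ k then j else j - (k + 1) else if j ≤ k + 1 then k + 1 else k + 2

section

variable {k j : ℕ}

lemma fanX_left (h0 : 1 ≤ j) (h1 : j ≤ k) : fanX k j = 1 - 2 * ((k : ℝ) + 1 - j) := by
  rw [fanX, if_neg (by omega), if_pos h1]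

lemma fanX_apex : fanX k (k + 1) = 3 := by
  rw [fanX, if_neg (by omega), if_neg (by omega), if_pos rfl]

lemma fanX_right (h1 : k + 2 ≤ j) : fanX k j = 2 - 1 / (2 * (k : ℝ) + 2 - j) := by
  rw [fanX, if_neg (by omega), if_neg (by omega), if_neg (by omega)]

lemma fanY_left (h0 : 1 ≤ j) (h1 : j ≤ k + 1) : fanY k j = 1 := by
  rw [fanY, if_neg (by omega), if_pos h1]

lemma fanY_right (h1 : k + 2 ≤ j) : fanY k j = -(1 / (2 * (k : ℝ) + 2 - j)) := by
  rw [fanY, if_neg (by omega), if_neg (by omega)]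

lemma fanLine_apex (t : ℝ) : fanLine k 0 t = t / 3 := by rw [fanLine, if_pos rfl]

lemma fanLine_pass {a : ℕ} (h0 : 1 ≤ a) (h1 : a ≤ k) (t : ℝ) :
    fanLine k a t = -t / (2 * ((k : ℝ) + 1 - a) - 1) := by
  rw [fanLine, if_neg (by omega), if_pos h1]

lemma fanLine_left (t : ℝ) : fanLine k (k + 1) t = 1 := by
  rw [fanLine, if_neg (by omega), if_neg (by omega), if_pos rfl]

lemma fanLine_right (t : ℝ) : fanLine k (k + 2) t = t - 2 := by
  rw [fanLine, if_neg (by omega), if_neg (by omega), if_neg (by omega)]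

lemma fanX_left_bounds (h0 : 1 ≤ j) (h1 : j ≤ k) : fanX k j ≤ -1 := by
  have : (j : ℝ) ≤ k := by exact_mod_cast h1
  rw [fanX_left h0 h1]; linarith

lemma fan_right_cast (h1 : k + 2 ≤ j) (h2 : j < 2 * k + 2) :
    1 ≤ 2 * (k : ℝ) + 2 - j ∧ 2 * (k : ℝ) + 2 - j ≤ k := by
  have h3 : (k : ℝ) + 2 ≤ j := by exact_mod_cast h1
  have h4 : (j : ℝ) + 1 ≤ 2 * k + 2 := by exact_mod_cast h2
  constructor <;> linarith

lemma fanX_right_bounds (h1 : k + 2 ≤ j) (h2 : j < 2 * k + 2) : 1 ≤ fanX k j ∧ fanX k j < 2 := by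
  have h3 := fan_right_cast h1 h2
  have h4 : 1 / (2 * (k : ℝ) + 2 - j) ≤ 1 := by rw [div_le_one (by linarith)]; exact h3.1
  have h5 : 0 < 1 / (2 * (k : ℝ) + 2 - j) := by apply one_div_pos.2; linarith
  rw [fanX_right h1]
  constructor <;> linarith

lemma fanY_right_neg (h1 : k + 2 ≤ j) (h2 : j < 2 * k + 2) : fanY k j < 0 := by
  have h3 := fan_right_cast h1 h2
  have h5 : 0 < 1 / (2 * (k : ℝ) + 2 - j) := by apply one_div_pos.2; linarith
  rw [fanY_right h1]; linarith

lemma fanX_hub : fanX k 0 = 0 := by rw [fanX, if_pos rfl]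

lemma fanY_hub : fanY k 0 = 0 := by rw [fanY, if_pos rfl]

lemma fan_pass_pos {a : ℕ} (h1 : a ≤ k) : 0 < 2 * ((k : ℝ) + 1 - a) - 1 := by
  have : (a : ℝ) ≤ k := by exact_mod_cast h1
  linarith

end

lemma fanX_injOn {k : ℕ} : ∀ i < 2 * k + 2, ∀ j < 2 * k + 2, fanX k i = fanX k j → i = j := by
  have kind : ∀ i : ℕ, i = 0 ∨ (1 ≤ i ∧ i ≤ k) ∨ i = k + 1 ∨ k + 2 ≤ i := by omega
  intro i hi j hj h
  rcases kind i with rfl | ⟨a1, a2⟩ | rfl | a1 <;> rcases kind j with rfl | ⟨b1, b2⟩ | rfl | b1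
  · rfl
  · have := fanX_left_bounds b1 b2; rw [fanX_hub] at h; linarith
  · rw [fanX_hub, fanX_apex] at h; norm_num at h
  · have := fanX_right_bounds b1 hj; rw [fanX_hub] at h; linarith
  · have := fanX_left_bounds a1 a2; rw [fanX_hub] at h; linarith
  · rw [fanX_left a1 a2, fanX_left b1 b2] at h
    exact_mod_cast (by linarith : (i : ℝ) = j)
  · have := fanX_left_bounds a1 a2; rw [fanX_apex] at h; linarith
  · have := fanX_left_bounds a1 a2; have := fanX_right_bounds b1 hj; linarith
  · rw [fanX_hub, fanX_apex] at h; norm_num at h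
  · have := fanX_left_bounds b1 b2; rw [fanX_apex] at h; linarith
  · rfl
  · have := fanX_right_bounds b1 hj; rw [fanX_apex] at h; linarith
  · have := fanX_right_bounds a1 hi; rw [fanX_hub] at h; linarith
  · have := fanX_left_bounds b1 b2; have := fanX_right_bounds a1 hi; linarith
  · have := fanX_right_bounds a1 hi; rw [fanX_apex] at h; linarith
  · have h1 := fan_right_cast a1 hi
    have h2 := fan_right_cast b1 hj
    rw [fanX_right a1, fanX_right b1, sub_right_inj, one_div, one_div, inv_inj] at h
    exact_mod_cast (by linarith : (i : ℝ) = j)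

lemma fan_edge_cases {k i j : ℕ} (hj : j < 2 * k + 2) (h : StripEdge (fun _ => 0) i j) :
    (i = 0 ∧ 1 ≤ j ∧ j ≤ k ∧ fanArc k i j = j) ∨ (i = 0 ∧ j = k + 1 ∧ fanArc k i j = 0) ∨
    (i = 0 ∧ k + 2 ≤ j ∧ fanArc k i j = j - (k + 1)) ∨
    (1 ≤ i ∧ i ≤ k ∧ j = i + 1 ∧ fanArc k i j = k + 1) ∨
    (k + 1 ≤ i ∧ j = i + 1 ∧ fanArc k i j = k + 2) := by
  have h' : i + 1 = j ∨ (2 ≤ j ∧ i = 0) := h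
  unfold fanArc
  rcases h' with rfl | ⟨h1, rfl⟩
  · rcases Nat.eq_zero_or_pos i with rfl | hi
    · rcases Nat.eq_zero_or_pos k with rfl | hk
      · simp
      · left; simp; omega
    · split_ifs <;> omega
  · split_ifs <;> omega

lemma fan_mem_graph {k : ℕ} (i j : ℕ) (h : StripEdge (fun _ => 0) i j) (hj : j < 2 * k + 2) :
    fanY k i = fanLine k (fanArc k i j) (fanX k i) ∧
      fanY k j = fanLine k (fanArc k i j) (fanX k j) := by
  rcases fan_edge_cases hj h with ⟨rfl, h1, h2, h3⟩ | ⟨rfl, rfl, h3⟩ | ⟨rfl, h1, h3⟩ |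
      ⟨h1, h2, rfl, h3⟩ | ⟨h1, rfl, h3⟩ <;> rw [h3]
  · rw [fanLine_pass h1 h2, fanLine_pass h1 h2, fanX_hub, fanY_hub, fanX_left h1 h2,
      fanY_left h1 (by omega)]
    have := fan_pass_pos h2
    refine ⟨by simp, ?_⟩
    rw [eq_div_iff this.ne']; ring
  · rw [fanLine_apex, fanLine_apex, fanX_hub, fanY_hub, fanX_apex, fanY_left (by omega) le_rfl]
    norm_num
  · have h4 := fan_right_cast h1 hj
    rw [fanLine_pass (by omega) (by omega), fanLine_pass (by omega) (by omega), fanX_hub, fanY_hub,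
      fanX_right h1, fanY_right h1, Nat.cast_sub (by omega)]
    refine ⟨by simp, ?_⟩
    push_cast
    rw [show 2 * ((k : ℝ) + 1 - (j - (k + 1))) - 1 = 2 * (2 * k + 2 - j) - 1 by ring]
    obtain ⟨d, hd⟩ : ∃ d : ℝ, 2 * (k : ℝ) + 2 - j = d := ⟨_, rfl⟩
    rw [hd] at h4 ⊢
    have h5 : 2 * d - 1 ≠ 0 := by linarith
    have h6 : d ≠ 0 := by linarith
    rw [eq_div_iff h5]
    field_simp
  · rw [fanLine_left, fanLine_left, fanY_left h1 (by omega), fanY_left (by omega) (by omega)]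
    exact ⟨rfl, rfl⟩
  · rw [fanLine_right, fanLine_right, fanX_right (j := i + 1) (by omega),
      fanY_right (j := i + 1) (by omega)]
    refine ⟨?_, by ring⟩
    rcases h1.eq_or_lt with rfl | h1
    · rw [fanY_left (by omega) le_rfl, fanX_apex]; norm_num
    · rw [fanX_right h1, fanY_right h1]; ring

lemma fan_meet_of_lt {k a b : ℕ} (hab : a < b) (hb : b < k + 3) {t : ℝ}
    (h : fanLine k a t = fanLine k b t) :
    ∃ w < 2 * k + 2, fanX k w = t ∧ fanY k w = fanLine k a t := by
  rcases (by omega : b ≤ k ∨ b = k + 1 ∨ b = k + 2) with hb' | rfl | rfl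
  · -- two lines through the hub
    have hB := fan_pass_pos hb'
    have ht : t = 0 := by
      rw [fanLine_pass (by omega) hb'] at h
      rcases Nat.eq_zero_or_pos a with rfl | ha
      · rw [fanLine_apex, div_eq_div_iff (by norm_num) hB.ne'] at h
        have : t * (2 * ((k : ℝ) + 1 - b) - 1 + 3) = 0 := by linarith
        rcases mul_eq_zero.1 this with h' | h' <;> linarith
      · have hA := fan_pass_pos (k := k) (a := a) (by omega)
        have hlt : (a : ℝ) < b := by exact_mod_cast hab
        rw [fanLine_pass ha (by omega), div_eq_div_iff hA.ne' hB.ne'] at h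
        have : t * ((b : ℝ) - a) = 0 := by linarith
        rcases mul_eq_zero.1 this with h' | h' <;> linarith
    subst ht
    refine ⟨0, by omega, fanX_hub, ?_⟩
    rw [fanY_hub]
    rcases Nat.eq_zero_or_pos a with rfl | ha
    · rw [fanLine_apex]; simp
    · rw [fanLine_pass ha (by omega)]; simp
  · rw [fanLine_left] at h
    rcases Nat.eq_zero_or_pos a with rfl | ha
    · refine ⟨k + 1, by omega, ?_, by rw [h, fanY_left (by omega) le_rfl]⟩
      rw [fanLine_apex] at h
      rw [fanX_apex]; linarith
    · refine ⟨a, by omega, ?_, by rw [h, fanY_left ha (by omega)]⟩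
      have hA := fan_pass_pos (k := k) (a := a) (by omega)
      rw [fanLine_pass ha (by omega), div_eq_one_iff_eq hA.ne'] at h
      rw [fanX_left ha (by omega)]; linarith
  · rw [fanLine_right] at h
    rcases (by omega : a = 0 ∨ (1 ≤ a ∧ a ≤ k) ∨ a = k + 1) with rfl | ⟨ha, ha'⟩ | rfl
    · rw [fanLine_apex] at h ⊢
      obtain rfl : t = 3 := by linarith
      exact ⟨k + 1, by omega, fanX_apex, by rw [fanY_left (by omega) le_rfl]; norm_num⟩
    · have hA := fan_pass_pos (k := k) (a := a) (by omega)
      have hA' : (0 : ℝ) < k + 1 - a := by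
        have : (a : ℝ) ≤ k := by exact_mod_cast ha'
        linarith
      rw [fanLine_pass ha ha'] at h ⊢
      rw [h]
      rw [div_eq_iff hA.ne'] at h
      have ht : t = 2 - 1 / ((k : ℝ) + 1 - a) := by
        field_simp
        linarith
      have hc : 2 * (k : ℝ) + 2 - ((k + 1 + a : ℕ) : ℝ) = k + 1 - a := by push_cast; ring
      refine ⟨k + 1 + a, by omega, ?_, ?_⟩
      · rw [fanX_right (by omega), hc, ht]
      · rw [fanY_right (by omega), hc, ht]; ring
    · rw [fanLine_left] at h ⊢
      obtain rfl : t = 3 := by linarith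
      exact ⟨k + 1, by omega, fanX_apex, by rw [fanY_left (by omega) le_rfl]⟩

lemma fan_not_between {k : ℕ} (i j w : ℕ) (h : StripEdge (fun _ => 0) i j) (hj : j < 2 * k + 2)
    (hw : w < 2 * k + 2) (hx : fanX k w ∈ Set.uIcc (fanX k i) (fanX k j))
    (hy : fanY k w = fanLine k (fanArc k i j) (fanX k w)) : w = i ∨ w = j := by
  have kind : w = 0 ∨ (1 ≤ w ∧ w ≤ k) ∨ w = k + 1 ∨ k + 2 ≤ w := by omega
  rw [Set.mem_uIcc] at hx
  rcases fan_edge_cases hj h with ⟨rfl, h1, h2, h3⟩ | ⟨rfl, rfl, h3⟩ | ⟨rfl, h1, h3⟩ |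
      ⟨h1, h2, rfl, h3⟩ | ⟨h1, rfl, h3⟩ <;> rw [h3] at hy
  · have hA := fan_pass_pos h2
    have hJ := fanX_left_bounds h1 h2
    rw [fanX_hub] at hx
    rw [fanLine_pass h1 h2] at hy
    rcases kind with rfl | ⟨w1, w2⟩ | rfl | w1
    · exact Or.inl rfl
    · rw [fanX_left w1 w2, fanY_left w1 (by omega), eq_div_iff hA.ne'] at hy
      exact Or.inr (by exact_mod_cast (by linarith : (w : ℝ) = j))
    · rw [fanX_apex] at hx
      rcases hx with hx | hx <;> linarith
    · have := fanX_right_bounds w1 hw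
      rcases hx with hx | hx <;> linarith
  · rw [fanX_hub, fanX_apex] at hx
    rw [fanLine_apex] at hy
    rcases kind with rfl | ⟨w1, w2⟩ | rfl | w1
    · exact Or.inl rfl
    · have := fanX_left_bounds w1 w2
      rcases hx with hx | hx <;> linarith
    · exact Or.inr rfl
    · have := fanX_right_bounds w1 hw
      have := fanY_right_neg w1 hw
      linarith
  · have hJ := fanX_right_bounds h1 hj
    have hA := fan_pass_pos (k := k) (a := j - (k + 1)) (by omega)
    rw [fanX_hub] at hx
    rw [fanLine_pass (by omega) (by omega)] at hy
    rcases kind with rfl | ⟨w1, w2⟩ | rfl | w1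
    · exact Or.inl rfl
    · have := fanX_left_bounds w1 w2
      rcases hx with hx | hx <;> linarith
    · rw [fanX_apex] at hx
      rcases hx with hx | hx <;> linarith
    · rw [fanX_right w1, fanY_right w1, eq_div_iff hA.ne', Nat.cast_sub (by omega)] at hy
      have h4 := fan_right_cast w1 hw
      push_cast at hy
      obtain ⟨d, hd⟩ : ∃ d : ℝ, 2 * (k : ℝ) + 2 - w = d := ⟨_, rfl⟩
      rw [hd] at hy h4
      have h5 : d ≠ 0 := by linarith
      field_simp at hy
      exact Or.inr (by exact_mod_cast (by linarith : (w : ℝ) = j))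
  · rw [fanLine_left] at hy
    have w1 : 1 ≤ w ∧ w ≤ k + 1 := by
      rcases kind with rfl | ⟨w1, w2⟩ | rfl | w1
      · rw [fanY_hub] at hy; norm_num at hy
      · omega
      · omega
      · have := fanY_right_neg w1 hw; linarith
    have hc : fanX k i = 1 - 2 * ((k : ℝ) + 1 - i) := fanX_left h1 h2
    rcases w1.2.eq_or_lt with rfl | w2
    · rcases h2.eq_or_lt with rfl | h2
      · exact Or.inr rfl
      · rw [fanX_apex] at hx
        have := fanX_left_bounds h1 h2.le
        have := fanX_left_bounds (k := k) (j := i + 1) (by omega) (by omega)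
        rcases hx with hx | hx <;> linarith
    · have hwx := fanX_left w1.1 (by omega : w ≤ k)
      have hiw : i ≤ w := by
        by_contra hlt
        have hlt' : (w : ℝ) + 1 ≤ i := by exact_mod_cast (by omega : w + 1 ≤ i)
        rcases h2.eq_or_lt with rfl | h2
        · rw [fanX_apex] at hx
          rcases hx with hx | hx <;> linarith
        · have := fanX_left (k := k) (j := i + 1) (by omega) (by omega)
          push_cast at this
          rcases hx with hx | hx <;> linarith
      have hwi : w ≤ i + 1 := by
        by_contra hlt
        have hlt' : (i : ℝ) + 2 ≤ w := by exact_mod_cast (by omega : i + 2 ≤ w)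
        have := fanX_left (k := k) (j := i + 1) (by omega) (by omega)
        push_cast at this
        rcases hx with hx | hx <;> linarith
      omega
  · rw [fanLine_right] at hy
    have w1 : k + 1 ≤ w := by
      rcases kind with rfl | ⟨w1, w2⟩ | rfl | w1
      · rw [fanY_hub, fanX_hub] at hy; norm_num at hy
      · rw [fanY_left w1 (by omega)] at hy
        have := fanX_left_bounds w1 w2
        linarith
      · omega
      · omega
    have hj' := fanX_right (k := k) (j := i + 1) (by omega)
    have hjc := fan_right_cast (k := k) (j := i + 1) (by omega) hj
    push_cast at hj' hjc
    rcases w1.eq_or_lt with rfl | w2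
    · rcases h1.eq_or_lt with rfl | h1
      · exact Or.inl rfl
      · rw [fanX_apex] at hx
        have := fanX_right_bounds h1 (by omega)
        have := fanX_right_bounds (k := k) (j := i + 1) (by omega) hj
        rcases hx with hx | hx <;> linarith
    · have hwx := fanX_right (k := k) (j := w) w2
      have hwc := fan_right_cast w2 hw
      have hwb := fanX_right_bounds w2 hw
      have hmono : ∀ u v : ℝ, 0 < u → u < v → 1 / v < 1 / u :=
        fun u v hu huv => one_div_lt_one_div_of_lt hu huv
      have hwi : w ≤ i + 1 := by
        by_contra hlt
        have hlt' : (i : ℝ) + 2 ≤ w := by exact_mod_cast (by omega : i + 2 ≤ w)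
        have h5 := hmono (2 * (k : ℝ) + 2 - w) (2 * (k : ℝ) + 2 - (i + 1)) (by linarith)
          (by linarith)
        rcases h1.eq_or_lt with rfl | h1
        · rw [fanX_apex] at hx
          rcases hx with hx | hx <;> linarith
        · have hic := fan_right_cast (k := k) (j := i) (by omega) (by omega)
          have hi' := fanX_right (k := k) (j := i) (by omega)
          have h6 := hmono (2 * (k : ℝ) + 2 - w) (2 * (k : ℝ) + 2 - i) (by linarith)
            (by linarith)
          rcases hx with hx | hx <;> linarith
      have hiw : i ≤ w := by
        by_contra hlt
        have hlt' : (w : ℝ) + 1 ≤ i := by exact_mod_cast (by omega : w + 1 ≤ i)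
        have hic := fan_right_cast (k := k) (j := i) (by omega) (by omega)
        have hi' := fanX_right (k := k) (j := i) (by omega)
        have h5 := hmono (2 * (k : ℝ) + 2 - i) (2 * (k : ℝ) + 2 - w) (by linarith)
          (by linarith)
        have h6 := hmono (2 * (k : ℝ) + 2 - (i + 1)) (2 * (k : ℝ) + 2 - i) (by linarith)
          (by linarith)
        rcases hx with hx | hx <;> linarith
      omega

lemma fanArc_lt {k i j : ℕ} (hj : j < 2 * k + 2) (h : StripEdge (fun _ => 0) i j) :
    fanArc k i j < k + 3 := by
  have := fan_edge_cases hj h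
  omega

/-- The straight-line drawing of a fan on `k + 3` lines. -/
noncomputable def fanLayout (k : ℕ) : MonotoneLayout (fun _ => 0) (2 * k + 2) ℕ where
  x := fanX k
  y := fanY k
  f := fanLine k
  arcOf := fanArc k
  isStripPattern := isStripPattern_fan
  x_injOn := fanX_injOn
  continuous_f a := by
    unfold fanLine
    split_ifs <;> fun_prop
  mem_graph := fan_mem_graph
  not_between := fan_not_between
  meet i j i' j' h hj h' hj' hne t _ _ ht := by
    rcases lt_or_gt_of_ne hne with hlt | hlt
    · exact fan_meet_of_lt hlt (fanArc_lt hj' h') ht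
    · rw [ht]
      exact fan_meet_of_lt hlt (fanArc_lt hj h) ht.symm

lemma fanLine_affine (k a : ℕ) : ∃ m c : ℝ, ∀ t, fanLine k a t = m * t + c := by
  unfold fanLine
  split_ifs
  · exact ⟨1 / 3, 0, fun t => by ring⟩
  · exact ⟨-1 / (2 * ((k : ℝ) + 1 - a) - 1), 0, fun t => by ring⟩
  · exact ⟨0, 1, fun t => by ring⟩
  · exact ⟨1, -2, fun t => by ring⟩

/-- A walk on the real line passes through all points between its ends. -/
lemma exists_mem_uIcc_succ (x : ℕ → ℝ) {a b : ℕ} (hab : a < b) {t : ℝ}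
    (ht : t ∈ Set.uIcc (x a) (x b)) : ∃ i, a ≤ i ∧ i < b ∧ t ∈ Set.uIcc (x i) (x (i + 1)) := by
  induction b, hab using Nat.le_induction with
  | base => exact ⟨a, le_rfl, by omega, ht⟩
  | succ b hab ih =>
    rcases Set.uIcc_subset_uIcc_union_uIcc (b := x b) ht with h | h
    · obtain ⟨i, h1, h2, h3⟩ := ih h
      exact ⟨i, h1, by omega, h3⟩
    · exact ⟨b, by omega, by omega, h⟩

lemma isLineSegment_graphOver {f : ℝ → ℝ} {m c : ℝ} (hf : ∀ t, f t = m * t + c) {a b : ℝ}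
    (hab : a < b) : IsLineSegment (graphOver f (Set.Icc a b)) := by
  refine ⟨⟨a, f a⟩, ⟨b, f b⟩, fun h => hab.ne (congrArg Complex.re h), ?_⟩
  rw [← Set.uIcc_of_le hab.le]
  exact graphOver_affine (p := ⟨a, f a⟩) (q := ⟨b, f b⟩) hf rfl rfl

lemma isLineSegment_fan {k a : ℕ} (hk : 1 ≤ k) (ha : a < k + 3) :
    IsLineSegment ((fanLayout k).drawing.union ((fanLayout k).arcEdges a)) := by
  obtain ⟨m, c, hf⟩ := fanLine_affine k a
  have hedge : ∀ i j, StripEdge (fun _ => 0) i j → j < 2 * k + 2 → fanArc k i j = a → _ :=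
    fun i j h hj _ => fan_edge_cases hj h
  rcases (by omega : a = 0 ∨ (1 ≤ a ∧ a ≤ k) ∨ a = k + 1 ∨ a = k + 2) with
    rfl | ⟨h1, h2⟩ | rfl | rfl
  · rw [(fanLayout k).union_arcEdges 0 (s := Set.Icc 0 3)]
    · exact isLineSegment_graphOver hf (by norm_num)
    · intro i j h hj ha
      rcases hedge i j h hj ha with h' | h' | h' | h' | h' <;>
        first
        | (exfalso; change fanArc k i j = 0 at ha; omega)
        | skip
      obtain ⟨rfl, rfl, -⟩ := h'
      change Set.uIcc (fanX k 0) (fanX k (k + 1)) ⊆ _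
      rw [fanX_hub, fanX_apex, Set.uIcc_of_le (by norm_num)]
    · intro t ht
      refine ⟨0, k + 1, Or.inr ⟨by omega, rfl⟩, by omega, ?_, ?_⟩
      · change fanArc k 0 (k + 1) = 0
        unfold fanArc
        split_ifs <;> omega
      · change t ∈ Set.uIcc (fanX k 0) (fanX k (k + 1))
        rwa [fanX_hub, fanX_apex, Set.uIcc_of_le (by norm_num)]
  · have hL := fanX_left_bounds h1 h2
    have hR := fanX_right_bounds (k := k) (j := k + 1 + a) (by omega) (by omega)
    rw [(fanLayout k).union_arcEdges a (s := Set.Icc (fanX k a) (fanX k (k + 1 + a)))]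
    · exact isLineSegment_graphOver hf (by linarith)
    · intro i j h hj ha
      change fanArc k i j = a at ha
      change Set.uIcc (fanX k i) (fanX k j) ⊆ _
      rcases hedge i j h hj ha with h' | h' | h' | h' | h' <;>
        first
        | (exfalso; omega)
        | skip
      · obtain ⟨rfl, -, -, h'⟩ := h'
        obtain rfl : j = a := by omega
        rw [fanX_hub]
        exact Set.uIcc_subset_Icc ⟨by linarith, by linarith⟩ ⟨le_rfl, by linarith⟩
      · obtain ⟨rfl, -, h'⟩ := h'
        obtain rfl : j = k + 1 + a := by omega
        rw [fanX_hub]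
        exact Set.uIcc_subset_Icc ⟨by linarith, by linarith⟩ ⟨by linarith, le_rfl⟩
    · intro t ht
      rcases le_total t 0 with h0 | h0
      · refine ⟨0, a, ?_, by omega, ?_, ?_⟩
        · rcases h1.eq_or_lt with rfl | h1
          · exact Or.inl rfl
          · exact Or.inr ⟨h1, rfl⟩
        · change fanArc k 0 a = a
          unfold fanArc
          split_ifs <;> omega
        · change t ∈ Set.uIcc (fanX k 0) (fanX k a)
          rw [fanX_hub]
          exact Set.mem_uIcc_of_ge ht.1 h0
      · refine ⟨0, k + 1 + a, Or.inr ⟨by omega, rfl⟩, by omega, ?_, ?_⟩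
        · change fanArc k 0 (k + 1 + a) = a
          unfold fanArc
          split_ifs <;> omega
        · change t ∈ Set.uIcc (fanX k 0) (fanX k (k + 1 + a))
          rw [fanX_hub]
          exact Set.mem_uIcc_of_le h0 ht.2
  · have hmem : ∀ i, 1 ≤ i → i ≤ k + 1 → fanX k i ∈ Set.Icc (fanX k 1) 3 := by
      intro i hi1 hi2
      rcases hi2.eq_or_lt with rfl | hi2
      · have := fanX_left_bounds (k := k) le_rfl hk
        rw [fanX_apex]
        exact ⟨by linarith, le_rfl⟩
      · have h3 : (1 : ℝ) ≤ i := by exact_mod_cast hi1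
        have := fanX_left_bounds hi1 (by omega : i ≤ k)
        refine ⟨?_, by linarith⟩
        rw [fanX_left hi1 (by omega), fanX_left le_rfl hk]
        push_cast
        linarith
    rw [(fanLayout k).union_arcEdges (k + 1) (s := Set.Icc (fanX k 1) 3)]
    · have := fanX_left_bounds (k := k) le_rfl hk
      exact isLineSegment_graphOver hf (by linarith)
    · intro i j h hj ha
      change fanArc k i j = k + 1 at ha
      change Set.uIcc (fanX k i) (fanX k j) ⊆ _
      have := hedge i j h hj ha
      exact Set.uIcc_subset_Icc (hmem _ (by omega) (by omega)) (hmem _ (by omega) (by omega))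
    · intro t ht
      rw [← fanX_apex (k := k)] at ht
      obtain ⟨i, hi1, hi2, hi⟩ := exists_mem_uIcc_succ (fanX k) (by omega : 1 < k + 1)
        (Set.Icc_subset_uIcc ht)
      refine ⟨i, i + 1, Or.inl rfl, by omega, ?_, hi⟩
      change fanArc k i (i + 1) = k + 1
      unfold fanArc
      split_ifs <;> omega
  · have hmem : ∀ i, k + 1 ≤ i → i < 2 * k + 2 → fanX k i ∈ Set.Icc (fanX k (2 * k + 1)) 3 := by
      intro i hi1 hi2
      have h1 := fanX_right_bounds (k := k) (j := 2 * k + 1) (by omega) (by omega)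
      rcases hi1.eq_or_lt with rfl | hi1
      · rw [fanX_apex]
        exact ⟨by linarith, le_rfl⟩
      · have h3 : (i : ℝ) + 1 ≤ 2 * k + 2 := by exact_mod_cast hi2
        have := fanX_right_bounds hi1 hi2
        have hc := fan_right_cast hi1 hi2
        refine ⟨?_, by linarith⟩
        have : 1 / (2 * (k : ℝ) + 2 - i) ≤ 1 := by rw [div_le_one (by linarith)]; linarith
        rw [fanX_right hi1, fanX_right (by omega)]
        push_cast
        norm_num at this ⊢
        linarith
    have h1 := fanX_right_bounds (k := k) (j := 2 * k + 1) (by omega) (by omega)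
    rw [(fanLayout k).union_arcEdges (k + 2) (s := Set.Icc (fanX k (2 * k + 1)) 3)]
    · exact isLineSegment_graphOver hf (by linarith)
    · intro i j h hj ha
      change fanArc k i j = k + 2 at ha
      change Set.uIcc (fanX k i) (fanX k j) ⊆ _
      have := hedge i j h hj ha
      exact Set.uIcc_subset_Icc (hmem _ (by omega) (by omega)) (hmem _ (by omega) (by omega))
    · intro t ht
      rw [← fanX_apex (k := k)] at ht
      obtain ⟨i, hi1, hi2, hi⟩ := exists_mem_uIcc_succ (fanX k) (by omega : k + 1 < 2 * k + 1)
        (Set.Icc_subset_uIcc' ht)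
      refine ⟨i, i + 1, Or.inl rfl, by omega, ?_, hi⟩
      change fanArc k i (i + 1) = k + 2
      unfold fanArc
      split_ifs <;> omega

lemma seg_fan_le {k : ℕ} (hk : 1 ≤ k) :
    seg (stripGraph (fun _ => 0) (2 * k + 2)) ≤ ((k + 3 : ℕ) : ℕ∞) := by
  refine le_trans (b := (fanLayout k).drawing.segmentNumber)
    (sInf_le ⟨_, (fanLayout k).isStraightLine (fanLine_affine k), rfl⟩) ?_
  refine PlanarDrawing.segmentNumber_le _ ((fanLayout k).isStraightLine (fanLine_affine k))
    (fun i : Fin (k + 3) => (fanLayout k).arcEdges i) ?_ fun i => isLineSegment_fan hk i.2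
  exact ((fanLayout k).isEdgePartition id fun i j h hj => fanArc_lt hj h).1

/-! ### Circular arcs -/

/-- The part of the upper or lower half of a circle above an interval is a circular arc. -/
lemma isCircularArc_graphOver {f : ℝ → ℝ} {m d R σ a b : ℝ} (hR : 0 < R) (hσ : σ = 1 ∨ σ = -1)
    (hf : ∀ t, f t = σ * (√(R ^ 2 - (t - m) ^ 2) - d)) (hab : a < b) (ha : m - R ≤ a)
    (hb : b ≤ m + R) : IsCircularArc (graphOver f (Set.Icc a b)) := by
  have hRne := hR.ne'
  have hlo : -1 ≤ (a - m) / R := by rw [le_div_iff₀ hR]; linarith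
  have hhi : (b - m) / R ≤ 1 := by rw [div_le_iff₀ hR]; linarith
  have hlt : (a - m) / R < (b - m) / R := by gcongr
  have hacc : Real.arccos ((b - m) / R) < Real.arccos ((a - m) / R) :=
    Real.arccos_lt_arccos hlo hlt hhi
  have h0 := Real.arccos_nonneg ((b - m) / R)
  have hpi := Real.arccos_le_pi ((a - m) / R)
  have key : ∀ z : ℂ, z ∈ graphOver f (Set.Icc a b) ↔ ∃ θ,
      Real.arccos ((b - m) / R) ≤ θ ∧ θ ≤ Real.arccos ((a - m) / R) ∧
        circleMap ⟨m, -σ * d⟩ R (σ * θ) = z := by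
    intro z
    have hcos : ∀ θ, Real.cos (σ * θ) = Real.cos θ := by
      intro θ
      rcases hσ with rfl | rfl
      · rw [one_mul]
      · rw [neg_one_mul, Real.cos_neg]
    have hsin : ∀ θ, Real.sin (σ * θ) = σ * Real.sin θ := by
      intro θ
      rcases hσ with rfl | rfl
      · rw [one_mul, one_mul]
      · rw [neg_one_mul, neg_one_mul, Real.sin_neg]
    have hre : ∀ θ, (circleMap ⟨m, -σ * d⟩ R (σ * θ)).re = m + R * Real.cos θ := by
      intro θ
      rw [← hcos]
      simp only [circleMap, Complex.add_re, Complex.re_ofReal_mul, Complex.exp_ofReal_mul_I_re]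
    have him : ∀ θ, (circleMap ⟨m, -σ * d⟩ R (σ * θ)).im = σ * (R * Real.sin θ - d) := by
      intro θ
      rw [mul_sub, mul_left_comm, ← hsin]
      simp only [circleMap, Complex.add_im, Complex.im_ofReal_mul, Complex.exp_ofReal_mul_I_im]
      ring
    have hsqrt : ∀ θ, 0 ≤ θ → θ ≤ Real.pi → √(R ^ 2 - (R * Real.cos θ) ^ 2) = R * Real.sin θ := by
      intro θ h1 h2
      rw [← Real.sqrt_sq (mul_nonneg hR.le (Real.sin_nonneg_of_nonneg_of_le_pi h1 h2))]
      congr 1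
      linear_combination -R ^ 2 * Real.sin_sq_add_cos_sq θ
    constructor
    · rintro ⟨⟨h1, h2⟩, h3⟩
      have h4 : (a - m) / R ≤ (z.re - m) / R := by gcongr
      have h5 : (z.re - m) / R ≤ (b - m) / R := by gcongr
      have hc : R * Real.cos (Real.arccos ((z.re - m) / R)) = z.re - m := by
        rw [Real.cos_arccos (by linarith) (by linarith)]
        field_simp
      refine ⟨Real.arccos ((z.re - m) / R), Real.arccos_le_arccos h5, Real.arccos_le_arccos h4,
        Complex.ext ?_ ?_⟩
      · rw [hre, hc]; ring
      · have := hsqrt _ (Real.arccos_nonneg ((z.re - m) / R)) (Real.arccos_le_pi _)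
        rw [hc] at this
        rw [him, h3, hf, this]
    · rintro ⟨θ, h1, h2, rfl⟩
      have hc1 : Real.cos θ ≤ (b - m) / R := by
        rw [← Real.cos_arccos (by linarith) hhi]
        exact Real.cos_le_cos_of_nonneg_of_le_pi h0 (by linarith) h1
      have hc2 : (a - m) / R ≤ Real.cos θ := by
        rw [← Real.cos_arccos hlo (by linarith)]
        exact Real.cos_le_cos_of_nonneg_of_le_pi (by linarith) hpi h2
      rw [le_div_iff₀ hR] at hc1
      rw [div_le_iff₀ hR] at hc2
      refine ⟨?_, ?_⟩
      · rw [hre]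
        constructor <;> linarith
      · rw [him, hre, hf, add_sub_cancel_left, hsqrt θ (by linarith) (by linarith)]
  right
  rcases hσ with rfl | rfl
  · refine ⟨⟨m, -1 * d⟩, R, _, _, hR, hacc, by linarith, Set.ext fun z => ?_⟩
    rw [key]
    simp only [one_mul, Set.mem_image, Set.mem_Icc, and_assoc]
  · refine ⟨⟨m, - -1 * d⟩, R, _, _, hR, neg_lt_neg hacc, by linarith, Set.ext fun z => ?_⟩
    rw [key]
    constructor
    · rintro ⟨θ, h1, h2, rfl⟩
      exact ⟨-1 * θ, ⟨by linarith, by linarith⟩, rfl⟩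
    · rintro ⟨θ, ⟨h1, h2⟩, rfl⟩
      exact ⟨-θ, by linarith, by linarith, by rw [neg_one_mul (-θ), neg_neg θ]⟩

/-! ### Strips on circular arcs -/

/-- Every third vertex is the centre of a fan of three triangles. -/
def arcStrip (k : ℕ) : ℕ := 3 * ((k - 2) / 3)

lemma isStripPattern_arcStrip : IsStripPattern arcStrip := by
  refine ⟨rfl, fun k hk => ?_⟩
  unfold arcStrip
  omega

/-- Four times the abscissa of a vertex. The ordinate of a vertex depends on its abscissa only. -/
def arcPlace (r k : ℕ) : ℕ :=
  if k % 3 = 0 then 4 * (k / 3 + 1)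
  else if k % 3 = 1 then
    if k = 1 then 0 else if k + 2 = 3 * r then 4 * r + 1 else 4 * (k / 3 + 1) - 1
  else if k + 1 = 3 * r then 4 * r + 4 else if k = 2 then 3 else 4 * (k / 3 + 1) + 1

/-- The ordinate of the vertex with abscissa `m / 4`. -/
noncomputable def placeHeight (m : ℕ) : ℝ :=
  if m % 4 = 0 then 0 else (-1) ^ ((m + 1) / 4 + 1) * (√3 / 4)

/-- The functions whose graphs carry the drawing: for `a < r` an arc of a circle of radius `√7 / 2`,
alternately opening downwards and upwards, and the horizontal axis for `a = r`. -/
noncomputable def circleFun (r a : ℕ) (t : ℝ) : ℝ :=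
  if a < r then (-1) ^ a * (√((√7 / 2) ^ 2 - (t - (a + 1)) ^ 2) - √3 / 2) else 0

/-- The arc that contains a given edge. -/
def circleArc (r u v : ℕ) : ℕ :=
  if v % 3 = 0 then if u + 1 = v then v / 3 - 1 else r
  else if v % 3 = 1 then
    if u + 1 = v then if v = 1 then r else if v + 2 = 3 * r then r - 2 else v / 3 + 1 else v / 3
  else if u + 1 = v then v / 3 else if v + 1 = 3 * r then r else if v = 2 then 1 else v / 3 - 1

section

variable {r q : ℕ}

lemma arcPlace_hub : arcPlace r (3 * q) = 4 * q + 4 := by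
  unfold arcPlace; split_ifs <;> omega

lemma arcPlace_left_first : arcPlace r 1 = 0 := rfl

lemma arcPlace_left (hq : 1 ≤ q) (h : q + 1 ≠ r) : arcPlace r (3 * q + 1) = 4 * q + 3 := by
  unfold arcPlace; split_ifs <;> omega

lemma arcPlace_left_last (hq : 1 ≤ q) (h : q + 1 = r) : arcPlace r (3 * q + 1) = 4 * q + 5 := by
  unfold arcPlace; split_ifs <;> omega

lemma arcPlace_right_first (h : r ≠ 1) : arcPlace r 2 = 3 := by
  unfold arcPlace; split_ifs <;> first | omega | contradiction

lemma arcPlace_right (hq : 1 ≤ q) (h : q + 1 ≠ r) : arcPlace r (3 * q + 2) = 4 * q + 5 := by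
  unfold arcPlace; split_ifs <;> omega

lemma arcPlace_right_last (h : q + 1 = r) : arcPlace r (3 * q + 2) = 4 * q + 8 := by
  unfold arcPlace; split_ifs <;> omega

lemma arcPlace_cases (r k : ℕ) : ∃ q, (k = 3 * q ∧ arcPlace r k = 4 * q + 4) ∨
    (k = 1 ∧ arcPlace r k = 0) ∨
    (k = 3 * q + 1 ∧ 1 ≤ q ∧ q + 1 ≠ r ∧ arcPlace r k = 4 * q + 3) ∨
    (k = 3 * q + 1 ∧ 1 ≤ q ∧ q + 1 = r ∧ arcPlace r k = 4 * q + 5) ∨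
    (k = 2 ∧ r ≠ 1 ∧ arcPlace r k = 3) ∨
    (k = 3 * q + 2 ∧ 1 ≤ q ∧ q + 1 ≠ r ∧ arcPlace r k = 4 * q + 5) ∨
    (k = 3 * q + 2 ∧ q + 1 = r ∧ arcPlace r k = 4 * q + 8) := by
  obtain ⟨q, rfl | rfl | rfl⟩ : ∃ q, k = 3 * q ∨ k = 3 * q + 1 ∨ k = 3 * q + 2 :=
    ⟨k / 3, by omega⟩ <;> refine ⟨q, ?_⟩
  · exact Or.inl ⟨rfl, arcPlace_hub⟩
  · rcases Nat.eq_zero_or_pos q with rfl | hq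
    · exact Or.inr (Or.inl ⟨rfl, rfl⟩)
    · by_cases h : q + 1 = r
      · have := arcPlace_left_last hq h
        omega
      · have := arcPlace_left hq h
        omega
  · by_cases h : q + 1 = r
    · have := arcPlace_right_last h
      omega
    · rcases Nat.eq_zero_or_pos q with rfl | hq
      · have := arcPlace_right_first (r := r) (by omega)
        exact Or.inr (Or.inr (Or.inr (Or.inr (Or.inl ⟨rfl, by omega, this⟩))))
      · have := arcPlace_right hq h
        omega

end

lemma arcPlace_injOn {r : ℕ} : ∀ i < 3 * r, ∀ j < 3 * r, arcPlace r i = arcPlace r j → i = j := by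
  intro i hi j hj h
  obtain ⟨a, ha⟩ := arcPlace_cases r i
  obtain ⟨b, hb⟩ := arcPlace_cases r j
  rcases ha with ha | ha | ha | ha | ha | ha | ha <;> omega

lemma arcPlace_range {r k : ℕ} (hk : k < 3 * r) : arcPlace r k % 4 ≠ 2 ∧
    (r = 1 → arcPlace r k % 4 = 0) ∧
    (2 ≤ r → arcPlace r k ≠ 5 ∧ arcPlace r k + 1 ≠ 4 * r) := by
  obtain ⟨a, ha⟩ := arcPlace_cases r k
  rcases ha with ha | ha | ha | ha | ha | ha | ha <;> omega

lemma exists_arcPlace {r m : ℕ} (hr : 1 ≤ r) (h : (m % 4 = 0 ∧ m ≤ 4 * r + 4) ∨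
    (m % 4 = 3 ∧ m + 1 < 4 * r) ∨ (m % 4 = 1 ∧ 5 < m ∧ m ≤ 4 * r + 1)) :
    ∃ w < 3 * r, arcPlace r w = m := by
  obtain ⟨q, hq⟩ : ∃ q, q = m / 4 := ⟨_, rfl⟩
  rcases h with ⟨h1, h2⟩ | ⟨h1, h2⟩ | ⟨h1, h2, h3⟩
  · rcases (by omega : m = 0 ∨ q = r + 1 ∨ (1 ≤ q ∧ q ≤ r)) with rfl | h3 | ⟨h3, h4⟩
    · exact ⟨1, by omega, rfl⟩
    · exact ⟨3 * (r - 1) + 2, by omega, (arcPlace_right_last (by omega)).trans (by omega)⟩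
    · exact ⟨3 * (q - 1), by omega, arcPlace_hub.trans (by omega)⟩
  · rcases Nat.eq_zero_or_pos q with h3 | h3
    · exact ⟨2, by omega, (arcPlace_right_first (by omega)).trans (by omega)⟩
    · exact ⟨3 * q + 1, by omega, (arcPlace_left h3 (by omega)).trans (by omega)⟩
  · rcases (by omega : q = r ∨ q < r) with h4 | h4
    · exact ⟨3 * (q - 1) + 1, by omega,
        (arcPlace_left_last (by omega) (by omega)).trans (by omega)⟩
    · exact ⟨3 * (q - 1) + 2, by omega, (arcPlace_right (by omega) (by omega)).trans (by omega)⟩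

/-- The places `l` and `m` with `l < m` are joined by an edge on the arc `a`. -/
inductive ArcLink (r a l m : ℕ) : Prop
  | axis (h : a = r ∧ l % 4 = 0 ∧ m = l + 4)
  | enter (h : a < r ∧ l + 1 = 4 * a ∧ m = 4 * a)
  | rise (h : a < r ∧ l = 4 * a ∧ m = 4 * a + 3)
  | middle (h : a < r ∧ l = 4 * a + 3 ∧ m = 4 * a + 5)
  | fall (h : a < r ∧ l = 4 * a + 5 ∧ m = 4 * a + 8)
  | leave (h : a + 1 < r ∧ l = 4 * a + 8 ∧ m = 4 * a + 9)
  | first (h : 2 ≤ r ∧ a = 0 ∧ l = 3 ∧ m = 8)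
  | last (h : 2 ≤ r ∧ a + 1 = r ∧ l = 4 * a ∧ m = 4 * a + 5)
  | only (h : r = 1 ∧ a = 0 ∧ l = 0 ∧ m = 8)

lemma arcLink_of_edge {r i j : ℕ} (h : StripEdge arcStrip i j) (hj : j < 3 * r) :
    ArcLink r (circleArc r i j) (arcPlace r i) (arcPlace r j) ∨
      ArcLink r (circleArc r i j) (arcPlace r j) (arcPlace r i) := by
  have h' : i + 1 = j ∨ 2 ≤ j ∧ i = 3 * ((j - 2) / 3) := h
  obtain ⟨q, hq⟩ : ∃ q, q = j / 3 := ⟨_, rfl⟩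
  rcases (by omega : (j = 3 * (q - 1 + 1) ∧ i = 3 * (q - 1) + 2) ∨
      (j = 3 * (q - 1 + 1) ∧ i = 3 * (q - 1)) ∨ (j = 3 * q + 1 ∧ i = 3 * q) ∨
      (j = 3 * (q - 1 + 1) + 1 ∧ i = 3 * (q - 1)) ∨ (j = 3 * q + 2 ∧ i = 3 * q + 1) ∨
      (j = 3 * q + 2 ∧ i = 3 * q)) with ⟨rfl, rfl⟩ | ⟨rfl, rfl⟩ | ⟨rfl, rfl⟩ | ⟨rfl, rfl⟩ |
      ⟨rfl, rfl⟩ | ⟨rfl, rfl⟩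
  · have hc : circleArc r (3 * (q - 1) + 2) (3 * (q - 1 + 1)) = q - 1 := by
      unfold circleArc; split_ifs <;> omega
    rw [hc, arcPlace_hub]
    rcases Nat.eq_zero_or_pos (q - 1) with h1 | h1
    · rw [h1, arcPlace_right_first (by omega)]
      exact Or.inl (.first (by omega))
    · rw [arcPlace_right h1 (by omega)]
      exact Or.inl (.fall (by omega))
  · have hc : circleArc r (3 * (q - 1)) (3 * (q - 1 + 1)) = r := by
      unfold circleArc; split_ifs <;> omega
    rw [hc, arcPlace_hub, arcPlace_hub]
    exact Or.inl (.axis (by omega))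
  · have hc : circleArc r (3 * q) (3 * q + 1) =
        if q = 0 then r else if q + 1 = r then r - 2 else q + 1 := by
      unfold circleArc; split_ifs <;> omega
    rw [hc, arcPlace_hub]
    split_ifs with h1 h2
    · rw [h1, arcPlace_left_first]
      exact Or.inr (.axis (by omega))
    · rw [arcPlace_left_last (by omega) h2]
      exact Or.inl (.leave (by omega))
    · rw [arcPlace_left (by omega) h2]
      exact Or.inr (.enter (by omega))
  · have hc : circleArc r (3 * (q - 1)) (3 * (q - 1 + 1) + 1) = q - 1 + 1 := by
      unfold circleArc; split_ifs <;> omega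
    rw [hc, arcPlace_hub]
    by_cases h2 : q - 1 + 1 + 1 = r
    · rw [arcPlace_left_last (by omega) h2]
      exact Or.inl (.last (by omega))
    · rw [arcPlace_left (by omega) h2]
      exact Or.inl (.rise (by omega))
  · have hc : circleArc r (3 * q + 1) (3 * q + 2) = q := by
      unfold circleArc; split_ifs <;> omega
    rw [hc]
    by_cases h2 : q + 1 = r
    · rw [arcPlace_right_last h2]
      rcases Nat.eq_zero_or_pos q with rfl | h1
      · rw [arcPlace_left_first]
        exact Or.inl (.only (by omega))
      · rw [arcPlace_left_last h1 h2]
        exact Or.inl (.fall (by omega))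
    · rcases Nat.eq_zero_or_pos q with rfl | h1
      · rw [arcPlace_left_first, arcPlace_right_first (by omega)]
        exact Or.inl (.rise (by omega))
      · rw [arcPlace_left h1 h2, arcPlace_right h1 h2]
        exact Or.inl (.middle (by omega))
  · have hc : circleArc r (3 * q) (3 * q + 2) =
        if q + 1 = r then r else if q = 0 then 1 else q - 1 := by
      unfold circleArc; split_ifs <;> omega
    rw [hc, arcPlace_hub]
    split_ifs with h1 h2
    · rw [arcPlace_right_last h1]
      exact Or.inl (.axis (by omega))
    · rw [h2, arcPlace_right_first (by omega)]
      exact Or.inr (.enter (by omega))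
    · rw [arcPlace_right (by omega) h1]
      exact Or.inl (.leave (by omega))

/-! ### The drawing on circular arcs -/

/-- The place `m` lies on the arc `a`. -/
def OnArc (r a m : ℕ) : Prop :=
  (a = r ∧ m % 4 = 0) ∨ (a < r ∧ (m + 1 = 4 * a ∨ m = 4 * a ∨ m = 4 * a + 3 ∨ m = 4 * a + 5 ∨
    m = 4 * a + 8 ∨ m = 4 * a + 9))

lemma ArcLink.onArc {r a l m : ℕ} (h : ArcLink r a l m) : OnArc r a l ∧ OnArc r a m := by
  unfold OnArc
  cases h <;> omega

lemma arcPlace_le {r k : ℕ} (hk : k < 3 * r) : arcPlace r k ≤ 4 * r + 4 := by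
  obtain ⟨q, hq⟩ := arcPlace_cases r k
  rcases hq with hq | hq | hq | hq | hq | hq | hq <;> omega

section

variable {r a m : ℕ}

lemma circleFun_axis (t : ℝ) : circleFun r r t = 0 := by
  rw [circleFun, if_neg (by omega)]

lemma circleFun_of_lt (ha : a < r) (t : ℝ) :
    circleFun r a t = (-1) ^ a * (√(7 / 4 - (t - (a + 1)) ^ 2) - √3 / 2) := by
  rw [circleFun, if_pos ha, div_pow, Real.sq_sqrt (by norm_num)]
  norm_num

lemma circleFun_eq (ha : a < r) {t u v : ℝ} (ht : t = a + 1 + u) (hv : 0 ≤ v)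
    (huv : u ^ 2 + v ^ 2 = 7 / 4) : circleFun r a t = (-1) ^ a * (v - √3 / 2) := by
  rw [circleFun_of_lt ha, ht, show (7 : ℝ) / 4 - (a + 1 + u - (a + 1)) ^ 2 = v ^ 2 by
    rw [← huv]; ring, Real.sqrt_sq hv]

lemma placeHeight_of_dvd (h : m % 4 = 0) : placeHeight m = 0 := by
  rw [placeHeight, if_pos h]

lemma placeHeight_eq {i : ℕ} (h : m + 1 = 4 * i ∨ m = 4 * i + 1) :
    placeHeight m = (-1) ^ (i + 1) * (√3 / 4) := by
  rw [placeHeight, if_neg (by omega), show (m + 1) / 4 = i by omega]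

lemma sq_sqrt_three : √3 ^ 2 = (3 : ℝ) := Real.sq_sqrt (by norm_num)

lemma OnArc.placeHeight_eq (h : OnArc r a m) : placeHeight m = circleFun r a (m / 4) := by
  have h3 := sq_sqrt_three
  have h0 : 0 ≤ √3 := Real.sqrt_nonneg 3
  rcases h with ⟨rfl, h⟩ | ⟨ha, h⟩
  · rw [circleFun_axis, placeHeight_of_dvd h]
  · rcases h with h | rfl | rfl | rfl | rfl | rfl
    · have hm : (m : ℝ) + 1 = 4 * a := by exact_mod_cast h
      rw [OuterpathDrawing.placeHeight_eq (i := a) (Or.inl h),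
        circleFun_eq ha (u := -5 / 4) (v := √3 / 4) (by linarith) (by positivity) (by nlinarith)]
      ring
    · rw [placeHeight_of_dvd (by omega), circleFun_eq ha (u := -1) (v := √3 / 2)
        (by push_cast; ring) (by positivity) (by nlinarith)]
      ring
    · rw [OuterpathDrawing.placeHeight_eq (i := a + 1) (Or.inl (by ring)),
        circleFun_eq ha (u := -1 / 4) (v := 3 * √3 / 4) (by push_cast; ring) (by positivity)
          (by nlinarith)]
      ring
    · rw [OuterpathDrawing.placeHeight_eq (i := a + 1) (Or.inr (by ring)),
        circleFun_eq ha (u := 1 / 4) (v := 3 * √3 / 4) (by push_cast; ring) (by positivity)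
          (by nlinarith)]
      ring
    · rw [placeHeight_of_dvd (by omega), circleFun_eq ha (u := 1) (v := √3 / 2)
        (by push_cast; ring) (by positivity) (by nlinarith)]
      ring
    · rw [OuterpathDrawing.placeHeight_eq (i := a + 2) (Or.inr (by ring)),
        circleFun_eq ha (u := 5 / 4) (v := √3 / 4) (by push_cast; ring) (by positivity)
          (by nlinarith)]
      ring

lemma neg_one_pow_mul_cancel {u v : ℝ} (h : (-1 : ℝ) ^ a * u = (-1) ^ a * v) : u = v :=
  mul_left_cancel₀ (pow_ne_zero _ (by norm_num)) h

/-- Among the places below an arc, only those listed in `OnArc` lie on it. -/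
lemma onArc_of_placeHeight_eq (h2 : m % 4 ≠ 2) (hlo : 4 * a ≤ m + 1) (hhi : m ≤ 4 * a + 9)
    (ha : a < r) (h : placeHeight m = circleFun r a (m / 4)) : OnArc r a m := by
  have h3 := sq_sqrt_three
  have h0 : 0 < √3 := by positivity
  rcases (by omega : (m + 1 = 4 * a ∨ m = 4 * a ∨ m = 4 * a + 3 ∨ m = 4 * a + 5 ∨
    m = 4 * a + 8 ∨ m = 4 * a + 9) ∨ m = 4 * a + 1 ∨ m = 4 * a + 4 ∨ m = 4 * a + 7) with
    h' | rfl | rfl | rfl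
  · exact Or.inr ⟨ha, h'⟩
  · have h19 : √3 < √19 := Real.sqrt_lt_sqrt (by norm_num) (by norm_num)
    have h19' : √19 ^ 2 = (19 : ℝ) := Real.sq_sqrt (by norm_num)
    rw [placeHeight_eq (i := a) (Or.inr (by ring)), circleFun_eq ha (u := -3 / 4) (v := √19 / 4)
      (by push_cast; ring) (by positivity) (by nlinarith), pow_succ, mul_assoc] at h
    have := neg_one_pow_mul_cancel h
    nlinarith
  · have h7 : √3 < √7 := Real.sqrt_lt_sqrt (by norm_num) (by norm_num)
    have h7' : √7 ^ 2 = (7 : ℝ) := Real.sq_sqrt (by norm_num)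
    rw [placeHeight_of_dvd (by omega), circleFun_eq ha (u := 0) (v := √7 / 2)
      (by push_cast; ring) (by positivity) (by nlinarith), ← mul_zero ((-1) ^ a)] at h
    have := neg_one_pow_mul_cancel h
    linarith
  · have h19 : √3 < √19 := Real.sqrt_lt_sqrt (by norm_num) (by norm_num)
    have h19' : √19 ^ 2 = (19 : ℝ) := Real.sq_sqrt (by norm_num)
    rw [placeHeight_eq (i := a + 2) (Or.inl (by ring)), circleFun_eq ha (u := 3 / 4) (v := √19 / 4)
      (by push_cast; ring) (by positivity) (by nlinarith), pow_succ, pow_add, mul_assoc,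
      mul_assoc] at h
    have := neg_one_pow_mul_cancel h
    nlinarith

/-- Two arcs meet at places only. -/
lemma exists_place_of_meet {b : ℕ} (hab : a < b) (hb : b ≤ r) {t : ℝ} (ha1 : (a : ℝ) - 1 / 4 ≤ t)
    (ha2 : t ≤ a + 9 / 4) (hb1 : b < r → (b : ℝ) - 1 / 4 ≤ t)
    (hb2 : b < r → t ≤ b + 9 / 4) (h : circleFun r a t = circleFun r b t) :
    ∃ m : ℕ, t = m / 4 ∧ OnArc r a m ∧ ((m % 4 = 0 ∧ m ≤ 4 * r + 4) ∨
      (m % 4 = 3 ∧ m + 1 < 4 * r) ∨ (m % 4 = 1 ∧ 5 < m ∧ m ≤ 4 * r + 1)) := by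
  have har : a < r := by omega
  have h3 := sq_sqrt_three
  have h0 : 0 < √3 := by positivity
  have hA : √(7 / 4 - (t - (a + 1)) ^ 2) ^ 2 = 7 / 4 - (t - (a + 1)) ^ 2 :=
    Real.sq_sqrt (by nlinarith)
  rcases hb.eq_or_lt with rfl | hbr
  · rw [circleFun_axis, circleFun_of_lt har] at h
    have h1 := neg_one_pow_mul_cancel (h.trans (mul_zero _).symm)
    have h2 : √(7 / 4 - (t - (a + 1)) ^ 2) = √3 / 2 := by linarith
    rw [h2] at hA
    have h4 : (t - a) * (t - (a + 2)) = 0 := by linarith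
    rcases mul_eq_zero.1 h4 with h5 | h5
    · exact ⟨4 * a, by push_cast; linarith, Or.inr ⟨har, by omega⟩, by omega⟩
    · exact ⟨4 * a + 8, by push_cast; linarith, Or.inr ⟨har, by omega⟩, by omega⟩
  · have hb1 := hb1 hbr
    have hb2 := hb2 hbr
    have hb3 : b = a + 1 ∨ b = a + 2 := by
      have : (b : ℝ) < a + 3 := by linarith
      have : b < a + 3 := by exact_mod_cast this
      omega
    have hB : √(7 / 4 - (t - (b + 1)) ^ 2) ^ 2 = 7 / 4 - (t - (b + 1)) ^ 2 :=
      Real.sq_sqrt (by nlinarith)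
    rcases hb3 with rfl | rfl
    · rw [circleFun_of_lt har, circleFun_of_lt hbr, pow_succ (-1 : ℝ) a, mul_assoc] at h
      have h1 := neg_one_pow_mul_cancel h
      push_cast at h1 hB
      generalize √(7 / 4 - (t - (a + 1)) ^ 2) = A at *
      generalize √(7 / 4 - (t - (a + 1 + 1)) ^ 2) = B at *
      have h2 : B = √3 - A := by linarith
      rw [h2] at hB
      have h4 : √3 * A = 2 - (t - (a + 1)) := by linarith
      have h5 : 3 * A ^ 2 = (2 - (t - (a + 1))) ^ 2 := by rw [← h4, mul_pow, h3]
      have h6 : (t - (a + 3 / 4)) * (t - (a + 9 / 4)) = 0 := by linarith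
      rcases mul_eq_zero.1 h6 with h7 | h7
      · exact ⟨4 * a + 3, by push_cast; linarith, Or.inr ⟨har, by omega⟩, by omega⟩
      · exact ⟨4 * a + 9, by push_cast; linarith, Or.inr ⟨har, by omega⟩, by omega⟩
    · rw [circleFun_of_lt har, circleFun_of_lt hbr, pow_add (-1 : ℝ) a, mul_assoc] at h
      have h1 := neg_one_pow_mul_cancel h
      push_cast at h1 hB
      have h2 : √(7 / 4 - (t - (a + 1)) ^ 2) = √(7 / 4 - (t - (a + 2 + 1)) ^ 2) := by linarith
      rw [h2, hB] at hA
      exact ⟨4 * a + 8, by push_cast; linarith, Or.inr ⟨har, by omega⟩, by omega⟩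

end

lemma ArcLink.bounds {r a l m : ℕ} (h : ArcLink r a l m) (ha : a < r) :
    4 * a ≤ l + 1 ∧ l < m ∧ m ≤ 4 * a + 9 := by
  cases h <;> omega

lemma arcLink_of_edge_uIcc {r i j : ℕ} (h : StripEdge arcStrip i j) (hj : j < 3 * r) :
    ∃ l m, ArcLink r (circleArc r i j) l m ∧
      (l = arcPlace r i ∧ m = arcPlace r j ∨ l = arcPlace r j ∧ m = arcPlace r i) ∧
      Set.uIcc ((arcPlace r i : ℝ) / 4) (arcPlace r j / 4) = Set.Icc ((l : ℝ) / 4) (m / 4) := by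
  have hlt : ∀ {a l m}, ArcLink r a l m → ((l : ℝ) / 4) ≤ m / 4 := by
    intro a l m h
    have : l ≤ m := by cases h <;> omega
    gcongr
  rcases arcLink_of_edge h hj with h | h
  · exact ⟨_, _, h, Or.inl ⟨rfl, rfl⟩, Set.uIcc_of_le (hlt h)⟩
  · exact ⟨_, _, h, Or.inr ⟨rfl, rfl⟩, Set.uIcc_of_ge (hlt h)⟩

lemma circleArc_le {r i j : ℕ} (h : StripEdge arcStrip i j) (hj : j < 3 * r) :
    circleArc r i j ≤ r := by
  obtain ⟨l, m, h, -⟩ := arcLink_of_edge_uIcc h hj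
  cases h <;> omega

/-- The drawing of a strip with `3 * r` vertices on `r` circular arcs and a line segment. -/
noncomputable def circleLayout (r : ℕ) : MonotoneLayout arcStrip (3 * r) ℕ where
  x k := arcPlace r k / 4
  y k := placeHeight (arcPlace r k)
  f := circleFun r
  arcOf := circleArc r
  isStripPattern := isStripPattern_arcStrip
  x_injOn i hi j hj h := arcPlace_injOn i hi j hj (by
    rw [div_left_inj' (by norm_num)] at h
    exact_mod_cast h)
  continuous_f a := by
    unfold circleFun
    split_ifs <;> fun_prop
  mem_graph i j h hj := by
    have hon : OnArc r (circleArc r i j) (arcPlace r i) ∧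
        OnArc r (circleArc r i j) (arcPlace r j) := by
      rcases arcLink_of_edge h hj with h | h
      · exact h.onArc
      · exact h.onArc.symm
    exact ⟨hon.1.placeHeight_eq, hon.2.placeHeight_eq⟩
  not_between i j w h hj hw hx hy := by
    obtain ⟨l, m, hlm, hij, hI⟩ := arcLink_of_edge_uIcc h hj
    have hle := circleArc_le h hj
    rw [hI] at hx
    have h1 : l ≤ arcPlace r w := by
      have : (l : ℝ) ≤ arcPlace r w := by linarith [hx.1]
      exact_mod_cast this
    have h2 : arcPlace r w ≤ m := by
      have : (arcPlace r w : ℝ) ≤ m := by linarith [hx.2]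
      exact_mod_cast this
    have hr := arcPlace_range hw
    have hwlm : arcPlace r w = l ∨ arcPlace r w = m := by
      rcases hle.eq_or_lt with ha | ha
      · rw [ha, circleFun_axis, placeHeight] at hy
        have : arcPlace r w % 4 = 0 := by
          by_contra hne
          rw [if_neg hne] at hy
          have h3 : √3 / 4 ≠ 0 := by positivity
          exact mul_ne_zero (pow_ne_zero _ (by norm_num)) h3 hy
        cases hlm <;> omega
      · have hb := hlm.bounds ha
        have hon := onArc_of_placeHeight_eq hr.1 (by omega) (by omega) ha hy
        unfold OnArc at hon
        cases hlm <;> omega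
    rcases hij with ⟨rfl, rfl⟩ | ⟨rfl, rfl⟩
    · exact hwlm.imp
        (arcPlace_injOn w hw i (by have := isStripPattern_arcStrip.lt_of_edge h; omega))
        (arcPlace_injOn w hw j hj)
    · exact hwlm.symm.imp
        (arcPlace_injOn w hw i (by have := isStripPattern_arcStrip.lt_of_edge h; omega))
        (arcPlace_injOn w hw j hj)
  meet := by
    have dom : ∀ i j, StripEdge arcStrip i j → j < 3 * r → circleArc r i j < r →
        ∀ t ∈ Set.uIcc ((arcPlace r i : ℝ) / 4) (arcPlace r j / 4),
          (circleArc r i j : ℝ) - 1 / 4 ≤ t ∧ t ≤ circleArc r i j + 9 / 4 := by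
      intro i j h hj ha t ht
      obtain ⟨l, m, hlm, -, hI⟩ := arcLink_of_edge_uIcc h hj
      rw [hI] at ht
      have hb := hlm.bounds ha
      have h1 : 4 * (circleArc r i j : ℝ) ≤ l + 1 := by exact_mod_cast hb.1
      have h2 : (m : ℝ) ≤ 4 * circleArc r i j + 9 := by exact_mod_cast hb.2.2
      constructor <;> linarith [ht.1, ht.2]
    have main : ∀ i j i' j', StripEdge arcStrip i j → j < 3 * r → StripEdge arcStrip i' j' →
        j' < 3 * r → circleArc r i j < circleArc r i' j' →
        ∀ t ∈ Set.uIcc ((arcPlace r i : ℝ) / 4) (arcPlace r j / 4),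
        t ∈ Set.uIcc ((arcPlace r i' : ℝ) / 4) (arcPlace r j' / 4) →
        circleFun r (circleArc r i j) t = circleFun r (circleArc r i' j') t →
        ∃ w < 3 * r, (arcPlace r w : ℝ) / 4 = t ∧
          placeHeight (arcPlace r w) = circleFun r (circleArc r i j) t := by
      intro i j i' j' h hj h' hj' hlt t ht ht' hf
      have hle := circleArc_le h' hj'
      have d1 := dom i j h hj (by omega) t ht
      have d2 := fun hb => dom i' j' h' hj' hb t ht'
      obtain ⟨m, rfl, hon, hm⟩ := exists_place_of_meet hlt hle d1.1 d1.2 (fun hb => (d2 hb).1)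
        (fun hb => (d2 hb).2) hf
      obtain ⟨w, hw, rfl⟩ := exists_arcPlace (by omega) hm
      exact ⟨w, hw, rfl, hon.placeHeight_eq⟩
    intro i j i' j' h hj h' hj' hne t ht ht' hf
    rcases lt_or_gt_of_ne hne with hlt | hlt
    · exact main i j i' j' h hj h' hj' hlt t ht ht' hf
    · rw [hf]
      exact main i' j' i j h' hj' h hj hlt t ht' ht hf.symm

/-- The edges on the arc `a` cover the interval between the places `l` and `m`. -/
def ArcCover (r a l m : ℕ) : Prop :=
  ∀ t ∈ Set.Icc ((l : ℝ) / 4) (m / 4), ∃ i j, StripEdge arcStrip i j ∧ j < 3 * r ∧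
    circleArc r i j = a ∧ t ∈ Set.uIcc ((arcPlace r i : ℝ) / 4) (arcPlace r j / 4)

lemma ArcCover.trans {r a l m n : ℕ} (h : ArcCover r a l m) (h' : ArcCover r a m n) :
    ArcCover r a l n := fun t ht => by
  rcases le_total t (m / 4) with h1 | h1
  · exact h t ⟨ht.1, h1⟩
  · exact h' t ⟨h1, ht.2⟩

lemma arcCover_of_edge {r a l m i j : ℕ} (h : i + 1 = j ∨ (2 ≤ j ∧ i = 3 * ((j - 2) / 3)))
    (hj : j < 3 * r) (ha : circleArc r i j = a)
    (hlm : arcPlace r i = l ∧ arcPlace r j = m ∨ arcPlace r j = l ∧ arcPlace r i = m) :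
    ArcCover r a l m := fun t ht => by
  refine ⟨i, j, h, hj, ha, ?_⟩
  rcases hlm with ⟨rfl, rfl⟩ | ⟨rfl, rfl⟩
  · exact Set.Icc_subset_uIcc ht
  · exact Set.Icc_subset_uIcc' ht

lemma arcCover_axis {r : ℕ} (hr : 1 ≤ r) : ∀ j ≤ r, ArcCover r r 0 (4 * j + 4) := by
  intro j hj
  induction j with
  | zero =>
    refine arcCover_of_edge (i := 0) (j := 1) (by omega) (by omega) ?_ (Or.inr ⟨rfl, rfl⟩)
    simp [circleArc]
  | succ j ih =>
    refine (ih (by omega)).trans ?_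
    rcases hj.eq_or_lt with rfl | hj
    · refine arcCover_of_edge (i := 3 * j) (j := 3 * j + 2) (by omega) (by omega) ?_
        (Or.inl ⟨arcPlace_hub, (arcPlace_right_last rfl).trans (by ring)⟩)
      unfold circleArc; split_ifs <;> omega
    · refine arcCover_of_edge (i := 3 * j) (j := 3 * (j + 1)) (by omega) (by omega) ?_
        (Or.inl ⟨arcPlace_hub, arcPlace_hub⟩)
      unfold circleArc; split_ifs <;> omega

lemma arcCover_circle {r a : ℕ} (ha : a < r) : ArcCover r a (if a = 0 then 0 else 4 * a - 1)
    (if a + 1 = r then 4 * a + 8 else 4 * a + 9) := by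
  have enter : 1 ≤ a → ArcCover r a (4 * a - 1) (4 * a) := fun h1 => by
    rcases h1.eq_or_lt with rfl | h1
    · refine arcCover_of_edge (i := 0) (j := 2) (by omega) (by omega) ?_
        (Or.inr ⟨arcPlace_right_first (by omega), rfl⟩)
      unfold circleArc; split_ifs <;> first | omega | contradiction
    · refine arcCover_of_edge (i := 3 * (a - 1)) (j := 3 * (a - 1) + 1) (by omega) (by omega) ?_
        (Or.inr ⟨(arcPlace_left (by omega) (by omega)).trans (by omega),
          arcPlace_hub.trans (by omega)⟩)
      unfold circleArc; split_ifs <;> omega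
  have leave : a + 1 < r → ArcCover r a (4 * a + 8) (4 * a + 9) := fun h1 => by
    by_cases h2 : a + 2 = r
    · refine arcCover_of_edge (i := 3 * (a + 1)) (j := 3 * (a + 1) + 1) (by omega) (by omega) ?_
        (Or.inl ⟨arcPlace_hub.trans (by omega),
          (arcPlace_left_last (by omega) (by omega)).trans (by omega)⟩)
      unfold circleArc; split_ifs <;> omega
    · refine arcCover_of_edge (i := 3 * (a + 1)) (j := 3 * (a + 1) + 2) (by omega) (by omega) ?_
        (Or.inl ⟨arcPlace_hub.trans (by omega),
          (arcPlace_right (by omega) (by omega)).trans (by omega)⟩)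
      unfold circleArc; split_ifs <;> omega
  rcases Nat.eq_zero_or_pos a with rfl | h0
  · rw [if_pos rfl]
    split_ifs with h1
    · refine arcCover_of_edge (i := 1) (j := 2) (by omega) (by omega) rfl
        (Or.inl ⟨rfl, arcPlace_right_last (q := 0) h1⟩)
    · have c1 : ArcCover r 0 0 3 := arcCover_of_edge (i := 1) (j := 2) (by omega) (by omega) rfl
        (Or.inl ⟨rfl, arcPlace_right_first (by omega)⟩)
      have c2 : ArcCover r 0 3 8 := arcCover_of_edge (i := 2) (j := 3) (by omega) (by omega) rfl
        (Or.inl ⟨arcPlace_right_first (by omega), arcPlace_hub (q := 1)⟩)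
      exact (c1.trans c2).trans (leave (by omega))
  · rw [if_neg h0.ne']
    refine (enter h0).trans ?_
    split_ifs with h1
    · refine ArcCover.trans (m := 4 * a + 5) ?_ ?_
      · refine arcCover_of_edge (i := 3 * (a - 1)) (j := 3 * a + 1) (by omega) (by omega) ?_
          (Or.inl ⟨arcPlace_hub.trans (by omega), arcPlace_left_last h0 h1⟩)
        unfold circleArc; split_ifs <;> omega
      · refine arcCover_of_edge (i := 3 * a + 1) (j := 3 * a + 2) (by omega) (by omega) ?_
          (Or.inl ⟨arcPlace_left_last h0 h1, arcPlace_right_last h1⟩)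
        unfold circleArc; split_ifs <;> omega
    · refine ((ArcCover.trans (m := 4 * a + 3) ?_ ?_).trans (m := 4 * a + 5) ?_).trans
        (leave (by omega))
      · refine arcCover_of_edge (i := 3 * (a - 1)) (j := 3 * a + 1) (by omega) (by omega) ?_
          (Or.inl ⟨arcPlace_hub.trans (by omega), arcPlace_left h0 h1⟩)
        unfold circleArc; split_ifs <;> omega
      · refine arcCover_of_edge (i := 3 * a + 1) (j := 3 * a + 2) (by omega) (by omega) ?_
          (Or.inl ⟨arcPlace_left h0 h1, arcPlace_right h0 h1⟩)
        unfold circleArc; split_ifs <;> omega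
      · refine arcCover_of_edge (i := 3 * a + 2) (j := 3 * (a + 1)) (by omega) (by omega) ?_
          (Or.inl ⟨arcPlace_right h0 h1, arcPlace_hub.trans (by omega)⟩)
        unfold circleArc; split_ifs <;> omega

lemma isCircularArc_circleLayout {r a : ℕ} (hr : 1 ≤ r) (ha : a ≤ r) :
    IsCircularArc ((circleLayout r).drawing.union ((circleLayout r).arcEdges a)) := by
  rcases ha.eq_or_lt with rfl | ha
  · left
    rw [(circleLayout a).union_arcEdges a
      (s := Set.Icc (((0 : ℕ) : ℝ) / 4) ((4 * a + 4 : ℕ) / 4))]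
    · refine isLineSegment_graphOver (m := 0) (c := 0) (fun t => ?_) ?_
      · rw [zero_mul, zero_add]
        exact circleFun_axis t
      · gcongr
        omega
    · intro i j h hj _
      have := isStripPattern_arcStrip.lt_of_edge h
      have hmem : ∀ k < 3 * a, (arcPlace a k : ℝ) / 4 ∈
          Set.Icc (((0 : ℕ) : ℝ) / 4) ((4 * a + 4 : ℕ) / 4) := by
        intro k hk
        have := arcPlace_le hk
        exact ⟨by gcongr; omega, by gcongr⟩
      exact Set.uIcc_subset_Icc (hmem i (by omega)) (hmem j hj)
    · exact arcCover_axis hr a le_rfl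
  · obtain ⟨l, hl⟩ : ∃ l, l = if a = 0 then 0 else 4 * a - 1 := ⟨_, rfl⟩
    obtain ⟨m, hm⟩ : ∃ m, m = if a + 1 = r then 4 * a + 8 else 4 * a + 9 := ⟨_, rfl⟩
    have hcov := arcCover_circle ha
    rw [← hl, ← hm] at hcov
    have hl' : l < m ∧ 4 * a ≤ l + 1 ∧ m ≤ 4 * a + 9 ∧ (l = 0 ∨ l + 1 = 4 * a) ∧
        (a + 1 < r → m = 4 * a + 9) ∧ 4 * a + 8 ≤ m := by
      split_ifs at hl hm <;> omega
    clear hl hm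
    rw [(circleLayout r).union_arcEdges a (s := Set.Icc ((l : ℝ) / 4) (m / 4))]
    · have h7 : (5 / 2 : ℝ) ≤ √7 := Real.le_sqrt_of_sq_le (by norm_num)
      have h1 : 4 * (a : ℝ) ≤ l + 1 := by exact_mod_cast hl'.2.1
      have h2 : (m : ℝ) ≤ 4 * a + 9 := by exact_mod_cast hl'.2.2.1
      have h3 : (l : ℝ) < m := by exact_mod_cast hl'.1
      refine isCircularArc_graphOver (m := a + 1) (d := √3 / 2) (R := √7 / 2) (σ := (-1) ^ a)
        (by positivity) (neg_one_pow_eq_or ℝ a) (fun t => ?_) (by linarith) (by linarith)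
        (by linarith)
      change circleFun r a t = _
      rw [circleFun, if_pos ha]
    · intro i j h hj hij
      change circleArc r i j = a at hij
      change Set.uIcc ((arcPlace r i : ℝ) / 4) (arcPlace r j / 4) ⊆ _
      obtain ⟨l', m', hlm, -, hI⟩ := arcLink_of_edge_uIcc h hj
      rw [hij] at hlm
      have : l ≤ l' ∧ m' ≤ m := by cases hlm <;> omega
      rw [hI]
      have h1 : (l : ℝ) ≤ l' := by exact_mod_cast this.1
      have h2 : (m' : ℝ) ≤ m := by exact_mod_cast this.2
      exact Set.Icc_subset_Icc (by linarith) (by linarith)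
    · exact hcov

lemma arc_arcStrip_le {r : ℕ} (hr : 1 ≤ r) :
    arc (stripGraph arcStrip (3 * r)) ≤ ((r + 1 : ℕ) : ℕ∞) :=
  sInf_le ⟨(circleLayout r).drawing, r + 1, fun i => (circleLayout r).arcEdges i, rfl,
    (circleLayout r).isEdgePartition id fun _ _ h hj => Nat.lt_succ_of_le (circleArc_le h hj),
    fun i => isCircularArc_circleLayout hr (Nat.le_of_lt_succ i.2)⟩

/-! ### The graph without vertices -/

/-- The complement of the empty drawing is the whole plane, which is unbounded, so that there are no
internal faces, and the weak dual is the path without vertices. -/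
lemma isOuterpath_of_isEmpty {V : Type*} [IsEmpty V] (G : SimpleGraph V) :
    IsMaximalOuterpath G ∧ arc G ≤ 1 := by
  have hG : G.edgeSet = ∅ := by
    rw [SimpleGraph.edgeSet_eq_empty]
    ext u
    exact isEmptyElim u
  let D : PlanarDrawing G :=
    { pos := isEmptyElim
      pos_injective := fun u => isEmptyElim u
      curve := fun _ => ∅
      curve_isSimpleArc := fun u => isEmptyElim u
      pos_notMem_curve := fun _ _ w => isEmptyElim w
      curve_inter_curve := fun _ _ _ _ _ => by simp }
  have hD : D.IsOuterplane := ⟨fun u => isEmptyElim u, fun u => isEmptyElim u⟩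
  have hsupp : D.support = ∅ := by
    rw [PlanarDrawing.support, PlanarDrawing.union, hG, Set.range_eq_empty]
    simp
  have hface : IsEmpty {F : Set ℂ // D.IsInternalFace F} := by
    refine ⟨fun ⟨F, ⟨x, hx, hF⟩, hb⟩ => ?_⟩
    rw [hsupp, Set.compl_empty, connectedComponentIn_univ,
      PreconnectedSpace.connectedComponent_eq_univ] at hF
    rw [hF] at hb
    exact NormedSpace.unbounded_univ ℝ ℂ hb
  refine ⟨⟨⟨⟨D, hD⟩, fun H _ => ?_⟩, D, hD, 0, ⟨?_⟩⟩, ?_⟩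
  · have hH : H.edgeSet = ∅ := by
      rw [SimpleGraph.edgeSet_eq_empty]
      ext u
      exact isEmptyElim u
    rw [hH, Set.encard_empty]
    exact zero_le
  · exact ⟨Equiv.equivOfIsEmpty _ _, fun {F} => isEmptyElim F⟩
  · refine le_trans (b := 0) (sInf_le ⟨D, 0, Fin.elim0, rfl, ⟨?_, fun i => i.elim0⟩,
      fun i => i.elim0⟩) zero_le
    rw [hG, Set.iUnion_of_empty]

/-! ### Intersections of plane curves -/

lemma MeetTransversally.mono {A A' B B' : Set ℂ} {p : ℂ} (h : MeetTransversally A B p)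
    (hA : A' ⊆ A) (hB : B' ⊆ B) : MeetTransversally A' B' p := by
  obtain ⟨φ, h1, h2, h3, h4, h5⟩ := h
  exact ⟨φ, h1, h2, h3, h4, fun x hx => ⟨fun h => (h5 x hx).1 (hA h), fun h => (h5 x hx).2 (hB h)⟩⟩

lemma intersectionNumber_mono {A A' B B' : Set ℂ} (hA : A' ⊆ A) (hB : B' ⊆ B) :
    intersectionNumber A' B' ≤ intersectionNumber A B := by
  refine add_le_add (Set.encard_le_encard (Set.inter_subset_inter hA hB))
    (Set.encard_le_encard ?_)
  rintro p ⟨hp, h⟩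
  exact ⟨Set.inter_subset_inter hA hB hp, fun h' => h (h'.mono hA hB)⟩

/-- A single common point counts at most twice, and two common points count twice in total if the
curves share no tangent there. -/
lemma intersectionNumber_le_two {A B : Set ℂ} {ι : Type*} {S : Finset ι} {g : ι → ℂ}
    (hS : S.card ≤ 2) (hAB : A ∩ B ⊆ g '' S)
    (h : S.card ≤ 1 ∨ ∀ p ∈ A ∩ B, MeetTransversally A B p) : intersectionNumber A B ≤ 2 := by
  have hle : (A ∩ B).encard ≤ S.card :=
    (Set.encard_le_encard hAB).trans ((Set.encard_image_le g S).trans_eq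
      (Set.encard_coe_eq_coe_finsetCard S))
  rcases h with h | h
  · have h1 : (A ∩ B).encard ≤ 1 := hle.trans (by exact_mod_cast h)
    calc intersectionNumber A B ≤ 1 + 1 := add_le_add h1
          ((Set.encard_le_encard fun p hp => hp.1).trans h1)
      _ = 2 := one_add_one_eq_two
  · have h2 : {p ∈ A ∩ B | ¬ MeetTransversally A B p} = ∅ := by
      ext p
      simp only [Set.mem_sep_iff, Set.mem_empty_iff_false, iff_false, not_and, not_not]
      exact h p
    rw [intersectionNumber, h2, Set.encard_empty, add_zero]
    exact hle.trans (by exact_mod_cast hS)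

/-- The linear change of coordinates that takes the line of slope `s` into the horizontal and the
line of slope `s'` into the vertical axis. -/
noncomputable def shear (s s' : ℝ) (h : s ≠ s') : ℂ ≃ₗ[ℝ] ℂ where
  toFun z := ⟨z.im - s' * z.re, z.im - s * z.re⟩
  invFun z := ⟨(z.re - z.im) / (s - s'), z.re + s' * ((z.re - z.im) / (s - s'))⟩
  map_add' z w := by
    apply Complex.ext <;> simp only [Complex.add_re, Complex.add_im] <;> ring
  map_smul' c z := by
    apply Complex.ext <;> simp only [Complex.smul_re, Complex.smul_im, smul_eq_mul,
      RingHom.id_apply] <;> ring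
  left_inv z := by
    have : s - s' ≠ 0 := sub_ne_zero.2 h
    apply Complex.ext <;> simp only [] <;> field_simp <;> ring
  right_inv z := by
    have : s - s' ≠ 0 := sub_ne_zero.2 h
    apply Complex.ext <;> simp only [] <;> field_simp <;> ring

open Filter Topology in
/-- Curves that are locally contained in lines of different slopes do not share a tangent. -/
lemma meetTransversally_of_slope {A B : Set ℂ} {p : ℂ} {s s' : ℝ} (hs : s ≠ s')
    (hA : ∀ᶠ z in 𝓝 p, z ∈ A → z.im - p.im = s * (z.re - p.re))
    (hB : ∀ᶠ z in 𝓝 p, z ∈ B → z.im - p.im = s' * (z.re - p.re)) : MeetTransversally A B p := by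
  obtain ⟨U, hU, hUo, hpU⟩ := eventually_nhds_iff.1 (hA.and hB)
  let e : ℂ ≃L[ℝ] ℂ := (shear s s' hs).toContinuousLinearEquiv
  let Φ : ℂ ≃ₜ ℂ := (Homeomorph.subRight p).trans e.toHomeomorph
  have hΦ : ∀ z, Φ z = ⟨(z - p).im - s' * (z - p).re, (z - p).im - s * (z - p).re⟩ :=
    fun z => rfl
  refine ⟨Φ.toOpenPartialHomeomorph.restrOpen U hUo, ⟨trivial, hpU⟩, ?_, ?_, ?_, ?_⟩
  · change Φ p = 0
    rw [hΦ, sub_self]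
    apply Complex.ext <;> simp
  · have : ContDiff ℝ 1 fun z => e (z - p) := e.contDiff.comp (contDiff_id.sub contDiff_const)
    exact this.contDiffOn
  · have : ContDiff ℝ 1 fun z => e.symm z + p := e.symm.contDiff.add contDiff_const
    exact this.contDiffOn
  · intro z hz
    have h := hU z hz.2
    change (z ∈ A → (Φ z).im = 0) ∧ (z ∈ B → (Φ z).re = 0)
    rw [hΦ]
    simp only [Complex.sub_re, Complex.sub_im]
    exact ⟨fun hzA => by rw [h.1 hzA]; ring, fun hzB => by rw [h.2 hzB]; ring⟩

lemma isClosed_graphOver {f : ℝ → ℝ} (hf : Continuous f) {s : Set ℝ} (hs : IsClosed s) :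
    IsClosed (graphOver f s) :=
  (hs.preimage Complex.continuous_re).inter
    (isClosed_eq Complex.continuous_im (hf.comp Complex.continuous_re))

/-- Two graphs that meet above the ends of an interval only form a simple closed curve. -/
lemma isSimpleClosedCurve_union_graphOver {f g : ℝ → ℝ} (hf : Continuous f) (hg : Continuous g)
    {a b : ℝ} (hab : a < b) (ha : f a = g a) (hb : f b = g b)
    (hne : ∀ t ∈ Set.Icc a b, f t = g t → t = a ∨ t = b) :
    IsSimpleClosedCurve (graphOver f (Set.Icc a b) ∪ graphOver g (Set.Icc a b)) := by
  let x : Circle → ℝ := fun z => (a + b) / 2 + (b - a) / 2 * (z : ℂ).re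
  have hx : Continuous x := by fun_prop
  have hsq : ∀ z : Circle, (z : ℂ).re ^ 2 + (z : ℂ).im ^ 2 = 1 := fun z => by
    have := Circle.normSq_coe z
    rw [Complex.normSq_apply] at this
    linarith
  have hxz : ∀ z : Circle, (x z = a ∨ x z = b) ↔ (z : ℂ).im = 0 := by
    intro z
    have h1 := hsq z
    constructor
    · rintro (h | h)
      · have : (z : ℂ).re = -1 := by
          have : (b - a) * ((z : ℂ).re + 1) = 0 := by linear_combination 2 * h
          rcases mul_eq_zero.1 this with h | h <;> linarith
        rw [this] at h1
        exact pow_eq_zero_iff two_ne_zero |>.1 (by linarith)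
      · have : (z : ℂ).re = 1 := by
          have : (b - a) * ((z : ℂ).re - 1) = 0 := by linear_combination 2 * h
          rcases mul_eq_zero.1 this with h | h <;> linarith
        rw [this] at h1
        exact pow_eq_zero_iff two_ne_zero |>.1 (by linarith)
    · intro h
      rw [h] at h1
      have : ((z : ℂ).re + 1) * ((z : ℂ).re - 1) = 0 := by linarith
      rcases mul_eq_zero.1 this with h | h
      · left
        change (a + b) / 2 + (b - a) / 2 * (z : ℂ).re = a
        rw [show (z : ℂ).re = -1 by linarith]; ring
      · right
        change (a + b) / 2 + (b - a) / 2 * (z : ℂ).re = b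
        rw [show (z : ℂ).re = 1 by linarith]; ring
  have hxI : ∀ z : Circle, x z ∈ Set.Icc a b := by
    intro z
    have h1 := hsq z
    have h2 : -1 ≤ (z : ℂ).re := by nlinarith [sq_nonneg (z : ℂ).im]
    have h3 : (z : ℂ).re ≤ 1 := by nlinarith [sq_nonneg (z : ℂ).im]
    change a ≤ (a + b) / 2 + (b - a) / 2 * (z : ℂ).re ∧
      (a + b) / 2 + (b - a) / 2 * (z : ℂ).re ≤ b
    constructor <;> nlinarith
  let y : Circle → ℝ := fun z => if 0 ≤ (z : ℂ).im then f (x z) else g (x z)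
  have hy : Continuous y := by
    refine Continuous.if_le (hf.comp hx) (hg.comp hx) continuous_const
      (Complex.continuous_im.comp continuous_subtype_val) fun z hz => ?_
    rcases (hxz z).2 hz.symm with h | h
    · rw [h, ha]
    · rw [h, hb]
  refine ⟨fun z => ⟨x z, y z⟩, Complex.equivRealProdCLM.symm.continuous.comp (hx.prodMk hy),
    ?_, ?_⟩
  · intro z w h
    have h1 : x z = x w := congrArg Complex.re h
    have h2 : y z = y w := congrArg Complex.im h
    have hre : (z : ℂ).re = (w : ℂ).re := by
      have : (b - a) * ((z : ℂ).re - (w : ℂ).re) = 0 := by linear_combination 2 * h1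
      rcases mul_eq_zero.1 this with h | h <;> linarith
    have him : (z : ℂ).im = (w : ℂ).im := by
      have hz := hsq z
      have hw := hsq w
      have : ((z : ℂ).im - (w : ℂ).im) * ((z : ℂ).im + (w : ℂ).im) = 0 := by
        rw [hre] at hz; linear_combination hz - hw
      rcases mul_eq_zero.1 this with h3 | h3
      · linarith
      · -- opposite points of the circle lie on different graphs
        have hmeet : f (x z) = g (x z) → (z : ℂ).im = 0 := fun h4 => (hxz z).1 (hne _ (hxI z) h4)
        change (if 0 ≤ (z : ℂ).im then f (x z) else g (x z)) =
          if 0 ≤ (w : ℂ).im then f (x w) else g (x w) at h2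
        rw [← h1] at h2
        split_ifs at h2 with h4 h5 h5
        · linarith
        · have := hmeet h2; linarith
        · have := hmeet h2.symm; linarith
        · linarith
    exact Subtype.ext (Complex.ext hre him)
  · ext z
    constructor
    · rintro ⟨w, rfl⟩
      by_cases hw : 0 ≤ (w : ℂ).im
      · exact Or.inl ⟨hxI w, if_pos hw⟩
      · exact Or.inr ⟨hxI w, if_neg hw⟩
    · intro hz
      have hI : z.re ∈ Set.Icc a b := hz.elim (fun h => h.1) fun h => h.1
      have hba : 0 < b - a := sub_pos.2 hab
      obtain ⟨c, hc⟩ : ∃ c : ℝ, (a + b) / 2 + (b - a) / 2 * c = z.re :=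
        ⟨(z.re - (a + b) / 2) / ((b - a) / 2), by field_simp; ring⟩
      have hc2 : 0 ≤ 1 - c ^ 2 := by
        have h1 : 0 ≤ (b - a) * (c + 1) := by linarith [hI.1]
        have h2 : 0 ≤ (b - a) * (1 - c) := by linarith [hI.2]
        have h3 := nonneg_of_mul_nonneg_right h1 hba
        have h4 := nonneg_of_mul_nonneg_right h2 hba
        nlinarith
      have point : ∀ s : ℝ, s ^ 2 = 1 - c ^ 2 → ∃ w : Circle, (w : ℂ).re = c ∧ (w : ℂ).im = s := by
        intro s hs
        refine ⟨⟨⟨c, s⟩, ?_⟩, rfl, rfl⟩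
        refine mem_sphere_zero_iff_norm.2 ?_
        rw [Complex.norm_def, Complex.normSq_mk, Real.sqrt_eq_one]
        linarith
      have hs := Real.sq_sqrt hc2
      rcases hz with hz | hz
      · obtain ⟨w, hw1, hw2⟩ := point _ hs
        have hxw : x w = z.re := by rw [← hc, ← hw1]
        refine ⟨w, Complex.ext hxw ?_⟩
        change (if 0 ≤ (w : ℂ).im then f (x w) else g (x w)) = z.im
        rw [if_pos (by rw [hw2]; positivity), hxw, hz.2]
      · obtain ⟨w, hw1, hw2⟩ := point (-√(1 - c ^ 2)) (by rw [neg_sq, hs])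
        have hxw : x w = z.re := by rw [← hc, ← hw1]
        refine ⟨w, Complex.ext hxw ?_⟩
        change (if 0 ≤ (w : ℂ).im then f (x w) else g (x w)) = z.im
        split_ifs with h
        · have h0 : (w : ℂ).im = 0 := le_antisymm (by rw [hw2]; simp) h
          rw [hz.2, ← hxw]
          rcases (hxz w).2 h0 with h | h
          · rw [h, ha]
          · rw [h, hb]
        · rw [hxw, hz.2]

/-! ### Piecewise linear functions -/

/-- The piecewise linear function with the values `h c` at the integers `c < N`. -/
noncomputable def interpolate (N : ℕ) (h : ℕ → ℤ) (t : ℝ) : ℝ :=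
  ∑ c ∈ Finset.range N, (h c : ℝ) * max 0 (1 - |t - c|)

lemma continuous_interpolate (N : ℕ) (h : ℕ → ℤ) : Continuous (interpolate N h) := by
  unfold interpolate
  fun_prop

lemma interpolate_eq {N : ℕ} (h : ℕ → ℤ) {c : ℕ} (hc : c + 1 < N) {t : ℝ} (h1 : (c : ℝ) ≤ t)
    (h2 : t ≤ c + 1) : interpolate N h t = h c + (h (c + 1) - h c) * (t - c) := by
  rw [interpolate, Finset.sum_eq_add c (c + 1) (by omega)]
  · rw [abs_of_nonneg (by linarith), max_eq_right (by linarith)]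
    push_cast
    rw [abs_of_nonpos (by linarith), max_eq_right (by linarith)]
    ring
  · intro d _ hd
    rw [max_eq_left, mul_zero]
    rcases (by omega : d + 1 ≤ c ∨ c + 2 ≤ d) with h | h
    · have h3 : (d : ℝ) + 1 ≤ c := by exact_mod_cast h
      rw [abs_of_nonneg (by linarith)]
      linarith
    · have h3 : (c : ℝ) + 2 ≤ d := by exact_mod_cast h
      rw [abs_of_nonpos (by linarith)]
      linarith
  · exact fun h' => absurd (Finset.mem_range.2 (by omega)) h'
  · exact fun h' => absurd (Finset.mem_range.2 (by omega)) h'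

/-! ### A periodic arrangement of wires -/

/-- The distance of a vertex to the centre of the fan that it is added to, by residues modulo
`16`. -/
def wireGap (k : ℕ) : ℕ := [2, 2, 2, 2, 2, 2, 2, 2, 3, 4, 2, 3, 4, 2, 2, 2].getD k 0

/-- A strip of period `16`. The truncated subtraction takes effect only below `2`, where the values
are irrelevant. -/
def wireStrip (k : ℕ) : ℕ := k - wireGap (k % 16)

/-- The shift of the column of a vertex, by residues modulo `16`. -/
def columnShift (k : ℕ) : ℕ := [8, 8, 8, 8, 8, 9, 7, 8, 9, 7, 8, 8, 8, 8, 8, 8].getD k 0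

/-- The column of a vertex; column `c` lies above the interval from `c` to `c + 1`. Vertex `0` takes the column `7`, which would be the column of its
predecessor in a strip that extends in both directions. -/
def column (k : ℕ) : ℕ := if k = 0 then 7 else k + columnShift (k % 16)

/-- Twice the ordinate of the vertex in a column, by residues modulo `16`. -/
def columnHeight (c : ℕ) : ℤ :=
  [1, -2, 2, -1, -3, -1, -4, -1, -3, 0, -3, -1, -3, -4, 1, -4].getD c 0

/-- The first column of each wire of the arrangement. There are six wires in every period, and the
wires `3` and `5` form a closed curve. -/
def wireStart (τ : Fin 6) : ℕ := [0, 6, 9, 13, 18, 13].getD τ 0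

/-- The last column of each wire. -/
def wireEnd (τ : Fin 6) : ℕ := [15, 13, 22, 18, 25, 18].getD τ 0

/-- The ordinates of each wire at the left sides of its columns and at the right side of its last
column. -/
def wireHeights (τ : Fin 6) : List ℤ :=
  [[1, 0, -2, -2, -2, -1, 0, 0, -1, -2, -2, -1, 0, 0, 2, -1, -3],
    [-3, -1, 0, 0, 0, 0, -1, -2, -2],
    [1, -1, -2, -2, -1, 1, 0, -1, -1, -1, -1, 0, 0, -1, -3],
    [-4, 0, 1, 0, 1, 1, 1],
    [2, 0, -1, -2, -2, -2, -2, -1, 1],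
    [-3, -1, -2, -2, -2, 0, 2]].getD τ []

/-- The ordinate of a wire at the left side of a column. -/
def wireHeight (τ : Fin 6) (c : ℕ) : ℤ := (wireHeights τ).getD (c - wireStart τ) 0

/-- The columns in which a wire passes through the vertex. -/
def wirePoints (τ : Fin 6) : Finset ℕ :=
  [{0, 1, 4, 5, 7, 8, 10, 11, 14, 15}, {6, 7, 9, 11, 12, 13}, {9, 10, 12, 14, 17, 19, 21, 22},
    {13, 14, 16, 18}, {18, 19, 20, 22, 24, 25}, {13, 15, 17, 18}].getD τ ∅

/-- The edges that end in a vertex, by the residue of that vertex modulo `16`: the wire that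
contains the edge, the shift of its period, and the columns of the two ends within the period. The
Boolean value tells whether the other end is the predecessor or the centre of the fan. -/
def wireTable (s : Bool) (k : ℕ) : Fin 6 × ℕ × ℕ × ℕ :=
  (bif s then
    [(0, 1, 7, 8), (4, 0, 24, 25), (2, 1, 9, 10), (0, 1, 10, 11), (1, 1, 11, 12), (2, 1, 12, 14),
      (3, 1, 14, 13), (5, 1, 13, 15), (5, 1, 15, 17), (0, 2, 1, 0), (3, 1, 16, 18), (4, 1, 18, 19),
      (4, 1, 19, 20), (0, 2, 4, 5), (2, 1, 21, 22), (1, 2, 6, 7)]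
  else
    [(4, 0, 22, 24), (1, 1, 7, 9), (0, 1, 8, 10), (1, 1, 9, 11), (2, 1, 10, 12), (0, 1, 11, 14),
      (1, 1, 12, 13), (0, 1, 14, 15), (2, 1, 14, 17), (3, 1, 14, 16), (5, 1, 17, 18),
      (2, 1, 17, 19), (0, 2, 1, 4), (2, 1, 19, 21), (4, 1, 20, 22), (0, 2, 5, 7)]).getD k
    (0, 0, 0, 0)

/-- The row of the table for a given edge, with special rows for the two edges at vertex `0`. -/
def wireRow (i j : ℕ) : Fin 6 × ℕ × ℕ × ℕ :=
  if j = 1 then (1, 1, 7, 9) else if i = 0 then (0, 1, 7, 10)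
  else wireTable (decide (i + 1 = j)) (j % 16)

/-- The wire that contains a given edge and the number of its period. -/
def wireOf (i j : ℕ) : Fin 6 × ℕ := ((wireRow i j).1, j / 16 + (wireRow i j).2.1 - 1)

/-- The graph of a wire. -/
noncomputable def wireFun (a : Fin 6 × ℕ) (t : ℝ) : ℝ :=
  interpolate 27 (wireHeight a.1) (t - 16 * a.2)

/-- The curve that contains a wire, by the number of the curve within the period. -/
def wireClass (τ : Fin 6) : ℕ := [0, 1, 2, 3, 4, 3].getD τ 0

/-! ### One period of the arrangement -/

/-- The table is consistent with the columns of the ends of each edge, the edges between the first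
`16 * r + 6` vertices lie on the first `5 * r + 3` curves, and the ends of an edge are consecutive
vertices of its wire. -/
lemma wireTable_spec : ∀ s : Bool, ∀ k < 16,
    16 + k - (bif s then 1 else wireGap k) +
      columnShift ((16 + k - (bif s then 1 else wireGap k)) % 16) =
        16 * (wireTable s k).2.1 + (wireTable s k).2.2.1 ∧
    16 + k + columnShift k = 16 * (wireTable s k).2.1 + (wireTable s k).2.2.2 ∧
    (k < 6 → 5 * (wireTable s k).2.1 + wireClass (wireTable s k).1 < 8) ∧
    5 * (wireTable s k).2.1 + wireClass (wireTable s k).1 < 13 ∧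
    (2 ≤ k → 1 ≤ (wireTable s k).2.1) ∧
    (wireTable s k).2.2.1 ∈ wirePoints (wireTable s k).1 ∧
    (wireTable s k).2.2.2 ∈ wirePoints (wireTable s k).1 ∧
    (∀ d ∈ wirePoints (wireTable s k).1,
      (d ≤ (wireTable s k).2.2.1 ∧ d ≤ (wireTable s k).2.2.2) ∨
      ((wireTable s k).2.2.1 ≤ d ∧ (wireTable s k).2.2.2 ≤ d)) := by
  decide

/-- The last two clauses concern the columns `8` and `16 * r + 13`, which contain no vertex. -/
lemma wirePoints_bounds : ∀ τ : Fin 6, ∀ c ∈ wirePoints τ,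
    wireStart τ ≤ c ∧ c ≤ wireEnd τ ∧ (c % 16 = 8 → (τ = 0 ∧ c = 8) ∨ c = 24) ∧
      (c % 16 = 13 → c = 13 ∧ (τ = 1 ∨ wireClass τ = 3)) := by
  decide

/-- A wire passes through the vertex of a column if and only if its ordinate in the middle of the
column, the mean of the ordinates at the sides, is that of the vertex. -/
lemma mem_wirePoints_iff : ∀ τ : Fin 6, ∀ c < 26, wireStart τ ≤ c → c ≤ wireEnd τ →
    (c ∈ wirePoints τ ↔ wireHeight τ c + wireHeight τ (c + 1) = columnHeight (c % 16)) := by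
  decide

lemma wireEnd_lt : ∀ τ : Fin 6, wireEnd τ < 26 := by
  decide

/-- Two wires `τ` and `τ'` are disjoint in a column or cross in its middle, at a vertex. Here `u`
and `w` are the differences of the ordinates on the sides of the column. -/
def CrossSpec (τ τ' : Fin 6) (c c' : ℕ) (u w : ℤ) : Prop :=
  0 < u * w ∨ (u + w = 0 ∧ u ≠ 0 ∧ c ∈ wirePoints τ ∧ c' ∈ wirePoints τ')

instance (τ τ' : Fin 6) (c c' : ℕ) (u w : ℤ) : Decidable (CrossSpec τ τ' c c' u w) := by
  unfold CrossSpec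
  infer_instance

lemma wire_cross : ∀ τ τ' : Fin 6, τ ≠ τ' → ∀ c < 26, wireStart τ ≤ c → c ≤ wireEnd τ →
    wireStart τ' ≤ c → c ≤ wireEnd τ' → CrossSpec τ τ' c c (wireHeight τ c - wireHeight τ' c)
      (wireHeight τ (c + 1) - wireHeight τ' (c + 1)) := by
  decide

/-- A wire can meet the wires of the next period in its last columns only; those columns are the
columns `c < 10` of the next period. -/
lemma wire_cross_shift : ∀ τ τ' : Fin 6, ∀ c < 10, wireStart τ ≤ c → c ≤ wireEnd τ →
    wireStart τ' ≤ c + 16 → c + 16 ≤ wireEnd τ' →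
    CrossSpec τ τ' c (c + 16) (wireHeight τ c - wireHeight τ' (c + 16))
      (wireHeight τ (c + 1) - wireHeight τ' (c + 17)) := by
  decide

/-! ### Edges and columns -/

lemma wireGap_spec : ∀ k < 16, 2 ≤ wireGap k ∧ wireGap k ≤ 4 ∧
    (wireGap ((k + 1) % 16) = wireGap k + 1 ∨ wireGap ((k + 1) % 16) = 2) := by
  decide

lemma isStripPattern_wireStrip : IsStripPattern wireStrip := by
  refine ⟨rfl, fun k hk => ?_⟩
  have h := (wireGap_spec (k % 16) (Nat.mod_lt _ (by norm_num))).2.2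
  rw [Nat.mod_add_mod] at h
  unfold wireStrip
  omega

lemma columnShift_spec : ∀ k < 16, ((k = 5 ∨ k = 8) ∧ columnShift k = 9) ∨
    ((k = 6 ∨ k = 9) ∧ columnShift k = 7) ∨
    (k ≠ 5 ∧ k ≠ 8 ∧ k ≠ 6 ∧ k ≠ 9 ∧ columnShift k = 8) := by
  decide

lemma column_of_pos {k : ℕ} (hk : k ≠ 0) : column k = k + columnShift (k % 16) := if_neg hk

lemma column_cases (k : ℕ) : (k = 0 ∧ column k = 7) ∨
    (k ≠ 0 ∧ (k % 16 = 5 ∨ k % 16 = 8) ∧ column k = k + 9) ∨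
    (k ≠ 0 ∧ (k % 16 = 6 ∨ k % 16 = 9) ∧ column k = k + 7) ∨
    (k ≠ 0 ∧ k % 16 ≠ 5 ∧ k % 16 ≠ 8 ∧ k % 16 ≠ 6 ∧ k % 16 ≠ 9 ∧ column k = k + 8) := by
  rcases Nat.eq_zero_or_pos k with rfl | hk
  · exact Or.inl ⟨rfl, rfl⟩
  · rw [column_of_pos hk.ne']
    have := columnShift_spec (k % 16) (Nat.mod_lt _ (by norm_num))
    omega

lemma column_injective : Function.Injective column := by
  intro i j h
  rcases column_cases i with hi | hi | hi | hi <;> rcases column_cases j with hj | hj | hj | hj <;>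
    omega

lemma column_bounds {r k : ℕ} (hk : k < 16 * r + 6) :
    7 ≤ column k ∧ column k ≤ 16 * r + 14 ∧ column k ≠ 8 ∧ column k ≠ 16 * r + 13 := by
  rcases column_cases k with hi | hi | hi | hi <;> omega

lemma exists_column {r c : ℕ} (h1 : 7 ≤ c) (h2 : c ≤ 16 * r + 14) (h3 : c ≠ 8)
    (h4 : c ≠ 16 * r + 13) : ∃ k < 16 * r + 6, column k = c := by
  rcases (by omega : c = 7 ∨ (7 < c ∧ (c % 16 = 14 ∨ c % 16 = 1)) ∨
      (7 < c ∧ (c % 16 = 13 ∨ c % 16 = 0)) ∨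
      (7 < c ∧ c % 16 ≠ 14 ∧ c % 16 ≠ 1 ∧ c % 16 ≠ 13 ∧ c % 16 ≠ 0)) with rfl | h | h | h
  · exact ⟨0, by omega, rfl⟩
  · refine ⟨c - 9, by omega, ?_⟩
    rcases column_cases (c - 9) with hi | hi | hi | hi <;> omega
  · refine ⟨c - 7, by omega, ?_⟩
    rcases column_cases (c - 7) with hi | hi | hi | hi <;> omega
  · refine ⟨c - 8, by omega, ?_⟩
    rcases column_cases (c - 8) with hi | hi | hi | hi <;> omega

/-- Edges that do not end in vertex `0` are listed in the table. -/
lemma wireOf_of_table {i j : ℕ} (s : Bool) (hi : i ≠ 0)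
    (h : i + (bif s then 1 else wireGap (j % 16)) = j) :
    StripEdge wireStrip i j ∧ wireRow i j = wireTable s (j % 16) ∧
    1 ≤ j / 16 + (wireRow i j).2.1 ∧
    column i = 16 * (wireOf i j).2 + (wireRow i j).2.2.1 ∧
    column j = 16 * (wireOf i j).2 + (wireRow i j).2.2.2 := by
  have hg := wireGap_spec (j % 16) (Nat.mod_lt _ (by norm_num))
  have hspec := wireTable_spec s (j % 16) (Nat.mod_lt _ (by norm_num))
  have he : 1 ≤ (bif s then 1 else wireGap (j % 16)) ∧
      (bif s then 1 else wireGap (j % 16)) ≤ 4 := by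
    cases s
    · exact ⟨by rw [cond_false]; omega, by rw [cond_false]; omega⟩
    · exact ⟨by rw [cond_true], by rw [cond_true]; omega⟩
  have hrow : wireRow i j = wireTable s (j % 16) := by
    rw [wireRow, if_neg (by omega), if_neg hi]
    congr 1
    cases s
    · rw [cond_false] at h
      exact decide_eq_false (by omega)
    · rw [cond_true] at h
      exact decide_eq_true h
  refine ⟨?_, hrow, ?_⟩
  · cases s
    · rw [cond_false] at h
      exact Or.inr ⟨by omega, by unfold wireStrip; omega⟩
    · exact Or.inl h
  · rw [wireOf, hrow, column_of_pos hi, column_of_pos (by omega)]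
    obtain ⟨h1, h2, -, -, h3, -⟩ := hspec
    generalize (bif s then 1 else wireGap (j % 16)) = e at *
    have hmod : i % 16 = (16 + j % 16 - e) % 16 := by omega
    rw [← hmod] at h1
    have hlow : 1 ≤ j / 16 + (wireTable s (j % 16)).2.1 := by omega
    refine ⟨hlow, ?_, ?_⟩ <;> dsimp only <;> omega

lemma wireStrip_eq_zero {j : ℕ} (h2 : 2 ≤ j) (h : wireStrip j = 0) : j = 2 := by
  have := (wireGap_spec (j % 16) (Nat.mod_lt _ (by norm_num))).2.1
  have hj : j ≤ 4 := by unfold wireStrip at h; omega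
  interval_cases j
  · rfl
  · exact absurd h (by decide)
  · exact absurd h (by decide)

lemma edge_cases {i j : ℕ} (h : StripEdge wireStrip i j) : (i = 0 ∧ j = 1) ∨ (i = 0 ∧ j = 2) ∨
    (i ≠ 0 ∧ ∃ s, i + (bif s then 1 else wireGap (j % 16)) = j) := by
  rcases Nat.eq_zero_or_pos i with rfl | hi
  · rcases h with h | ⟨h2, h⟩
    · exact Or.inl ⟨rfl, h.symm⟩
    · exact Or.inr (Or.inl ⟨rfl, wireStrip_eq_zero h2 h.symm⟩)
  · refine Or.inr (Or.inr ⟨hi.ne', ?_⟩)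
    rcases h with h | ⟨h2, h⟩
    · exact ⟨true, h⟩
    · refine ⟨false, ?_⟩
      have := (wireGap_spec (j % 16) (Nat.mod_lt _ (by norm_num))).2.1
      unfold wireStrip at h
      rw [cond_false]
      omega

/-- An edge joins two consecutive vertices of its wire. The last alternative accounts for the empty
column `8`. -/
lemma wire_of_edge {i j : ℕ} (h : StripEdge wireStrip i j) : ∃ c c',
    column i = 16 * (wireOf i j).2 + c ∧ column j = 16 * (wireOf i j).2 + c' ∧
    c ∈ wirePoints (wireOf i j).1 ∧ c' ∈ wirePoints (wireOf i j).1 ∧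
    ∀ d ∈ wirePoints (wireOf i j).1, (d ≤ c ∧ d ≤ c') ∨ (c ≤ d ∧ c' ≤ d) ∨
      16 * (wireOf i j).2 + d = 8 := by
  rcases edge_cases h with ⟨rfl, rfl⟩ | ⟨rfl, rfl⟩ | ⟨hi, s, hs⟩
  · exact ⟨7, 9, rfl, rfl, by decide, by decide, by decide⟩
  · exact ⟨7, 10, rfl, rfl, by decide, by decide, by decide⟩
  · obtain ⟨-, hrow, -, h1, h2⟩ := wireOf_of_table s hi hs
    refine ⟨_, _, h1, h2, ?_⟩
    have hspec := wireTable_spec s (j % 16) (Nat.mod_lt _ (by norm_num))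
    change _ ∈ wirePoints (wireRow i j).1 ∧ _ ∈ wirePoints (wireRow i j).1 ∧
      ∀ d ∈ wirePoints (wireRow i j).1, _
    rw [hrow]
    obtain ⟨-, -, -, -, -, h3, h4, h5⟩ := hspec
    exact ⟨h3, h4, fun d hd => (h5 d hd).imp_right Or.inl⟩

/-- The strip with `16 * r + 6` vertices uses the first `5 * r + 3` curves only. -/
lemma wireOf_lt {r i j : ℕ} (h : StripEdge wireStrip i j) (hj : j < 16 * r + 6) :
    5 * (wireOf i j).2 + wireClass (wireOf i j).1 < 5 * r + 3 := by
  rcases edge_cases h with ⟨rfl, rfl⟩ | ⟨rfl, rfl⟩ | ⟨hi, s, hs⟩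
  · change 5 * 0 + 1 < _
    omega
  · change 5 * 0 + 0 < _
    omega
  · obtain ⟨-, hrow, h1, -, -⟩ := wireOf_of_table s hi hs
    have hspec := wireTable_spec s (j % 16) (Nat.mod_lt _ (by norm_num))
    obtain ⟨-, -, h3, h4, -⟩ := hspec
    rw [← hrow] at h3 h4
    change 5 * (j / 16 + (wireRow i j).2.1 - 1) + wireClass (wireRow i j).1 < 5 * r + 3
    by_cases hk : j % 16 < 6
    · have := h3 hk
      omega
    · omega

/-! ### The drawing on wires -/

/-- The interval below a wire. -/
def wireDom (a : Fin 6 × ℕ) : Set ℝ :=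
  Set.Icc (16 * a.2 + wireStart a.1 + 1 / 2) (16 * a.2 + wireEnd a.1 + 1 / 2)

lemma continuous_wireFun (a : Fin 6 × ℕ) : Continuous (wireFun a) :=
  (continuous_interpolate _ _).comp (by fun_prop)

lemma wireFun_eq {a : Fin 6 × ℕ} {c n : ℕ} (hc : c < 26) (hn : n = 16 * a.2 + c) {t : ℝ}
    (h1 : (n : ℝ) ≤ t) (h2 : t ≤ n + 1) : wireFun a t =
      wireHeight a.1 c + (wireHeight a.1 (c + 1) - wireHeight a.1 c) * (t - n) := by
  have h : (n : ℝ) = 16 * a.2 + c := by exact_mod_cast hn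
  rw [wireFun, interpolate_eq (c := c) _ (by omega) (by linarith) (by linarith), h]
  ring

lemma wireFun_center {a : Fin 6 × ℕ} {c n : ℕ} (h1 : wireStart a.1 ≤ c) (h2 : c ≤ wireEnd a.1)
    (hn : n = 16 * a.2 + c) :
    wireFun a (n + 1 / 2) = columnHeight (n % 16) / 2 ↔ c ∈ wirePoints a.1 := by
  have hc := wireEnd_lt a.1
  rw [mem_wirePoints_iff a.1 c (by omega) h1 h2,
    wireFun_eq (by omega) hn (by linarith) (by linarith), show n % 16 = c % 16 by omega,
    eq_div_iff (by norm_num)]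
  rw [← Int.cast_inj (α := ℝ)]
  push_cast
  constructor <;> intro h <;> linarith

lemma wireFun_of_mem {a : Fin 6 × ℕ} {c n : ℕ} (hc : c ∈ wirePoints a.1)
    (hn : n = 16 * a.2 + c) : wireFun a (n + 1 / 2) = columnHeight (n % 16) / 2 := by
  have h := wirePoints_bounds a.1 c hc
  exact (wireFun_center h.1 h.2.1 hn).2 hc

/-- The slope of a wire in one of its columns. -/
def wireSlope (τ : Fin 6) (c : ℕ) : ℤ := wireHeight τ (c + 1) - wireHeight τ c

/-- Two wires whose difference is linear on a column, and has opposite values at its sides, meet in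
the middle of the column. -/
lemma CrossSpec.exists_vertex {a b : Fin 6 × ℕ} {c c' n : ℕ} (hc : c < 26) (hc' : c' < 26)
    (hn : n = 16 * a.2 + c) (hn' : n = 16 * b.2 + c')
    (h : CrossSpec a.1 b.1 c c' (wireHeight a.1 c - wireHeight b.1 c')
      (wireHeight a.1 (c + 1) - wireHeight b.1 (c' + 1)))
    {t : ℝ} (h1 : (n : ℝ) ≤ t) (h2 : t ≤ n + 1) (hf : wireFun a t = wireFun b t) :
    t = n + 1 / 2 ∧ c ∈ wirePoints a.1 ∧ c' ∈ wirePoints b.1 ∧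
      wireSlope a.1 c ≠ wireSlope b.1 c' := by
  rw [wireFun_eq hc hn h1 h2, wireFun_eq hc' hn' h1 h2] at hf
  obtain ⟨u, hu⟩ : ∃ u, u = wireHeight a.1 c - wireHeight b.1 c' := ⟨_, rfl⟩
  obtain ⟨w, hw⟩ : ∃ w, w = wireHeight a.1 (c + 1) - wireHeight b.1 (c' + 1) := ⟨_, rfl⟩
  rw [← hu, ← hw] at h
  have hu' : (u : ℝ) = wireHeight a.1 c - wireHeight b.1 c' := by exact_mod_cast hu
  have hw' : (w : ℝ) = wireHeight a.1 (c + 1) - wireHeight b.1 (c' + 1) := by exact_mod_cast hw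
  have key : (u : ℝ) * (1 - (t - n)) + w * (t - n) = 0 := by
    rw [hu', hw']; linarith
  rcases h with h | ⟨h3, h4, h5, h6⟩
  · exfalso
    have h' : (0 : ℝ) < u * w := by exact_mod_cast h
    have h3 : (u * u : ℝ) * (1 - (t - n)) + u * w * (t - n) = 0 := by
      linear_combination (u : ℝ) * key
    have h4 : 0 ≤ (u * u : ℝ) * (1 - (t - n)) :=
      mul_nonneg (mul_self_nonneg _) (by linarith)
    have h5 : 0 ≤ (u * w : ℝ) * (t - n) := mul_nonneg h'.le (by linarith)
    have h6 : t - n = 0 := (mul_eq_zero.1 (by linarith : (u * w : ℝ) * (t - n) = 0)).resolve_left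
      h'.ne'
    rw [h6, sub_zero, mul_one, mul_zero, add_zero] at h3
    rw [mul_self_eq_zero.1 h3, zero_mul] at h'
    exact lt_irrefl _ h'
  · refine ⟨?_, h5, h6, ?_⟩
    · have h3' : (u : ℝ) + w = 0 := by exact_mod_cast h3
      have h4' : (u : ℝ) ≠ 0 := by exact_mod_cast h4
      have : (u : ℝ) * (1 - 2 * (t - n)) = 0 := by linear_combination key - h3' * (t - n)
      have := (mul_eq_zero.1 this).resolve_left h4'
      linarith
    · unfold wireSlope
      omega

/-- Different wires meet at vertices only, and there they cross. -/
lemma wire_meet {a b : Fin 6 × ℕ} (hab : a ≠ b) {t : ℝ} (ha : t ∈ wireDom a) (hb : t ∈ wireDom b)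
    (hf : wireFun a t = wireFun b t) : ∃ n c c' : ℕ, n = 16 * a.2 + c ∧ n = 16 * b.2 + c' ∧
      t = n + 1 / 2 ∧ c ∈ wirePoints a.1 ∧ c' ∈ wirePoints b.1 ∧
      wireSlope a.1 c ≠ wireSlope b.1 c' := by
  have ht0 : 0 ≤ t := le_trans (by positivity) ha.1
  have hlo := Nat.floor_le ht0
  have hhi := Nat.lt_floor_add_one t
  have window : ∀ a : Fin 6 × ℕ, t ∈ wireDom a →
      ∃ c, ⌊t⌋₊ = 16 * a.2 + c ∧ wireStart a.1 ≤ c ∧ c ≤ wireEnd a.1 ∧ c < 26 := by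
    intro a ha
    have h1 : (16 * a.2 + wireStart a.1 : ℝ) < ⌊t⌋₊ + 1 := by linarith [ha.1]
    have h2 : (⌊t⌋₊ : ℝ) < 16 * a.2 + wireEnd a.1 + 1 := by linarith [ha.2]
    have h1' : 16 * a.2 + wireStart a.1 < ⌊t⌋₊ + 1 := by exact_mod_cast h1
    have h2' : ⌊t⌋₊ < 16 * a.2 + wireEnd a.1 + 1 := by exact_mod_cast h2
    have := wireEnd_lt a.1
    exact ⟨⌊t⌋₊ - 16 * a.2, by omega, by omega, by omega, by omega⟩
  obtain ⟨c, hc, h1, h2, h3⟩ := window a ha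
  obtain ⟨c', hc', h1', h2', h3'⟩ := window b hb
  rcases (by omega : c = c' ∨ c' = c + 16 ∨ c = c' + 16) with rfl | rfl | rfl
  · have hne : a.1 ≠ b.1 := fun h => hab (Prod.ext h (by omega))
    obtain ⟨h4, h5, h6, h7⟩ := (wire_cross a.1 b.1 hne c h3 h1 h2 h1' h2').exists_vertex h3 h3' hc
      hc' hlo hhi.le hf
    exact ⟨_, c, c, hc, hc', h4, h5, h6, h7⟩
  · obtain ⟨h4, h5, h6, h7⟩ := (wire_cross_shift a.1 b.1 c (by omega) h1 h2 h1' h2').exists_vertex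
      h3 h3' hc hc' hlo hhi.le hf
    exact ⟨_, c, _, hc, hc', h4, h5, h6, h7⟩
  · obtain ⟨h4, h5, h6, h7⟩ := (wire_cross_shift b.1 a.1 c' (by omega) h1' h2' h1 h2).exists_vertex
      h3' h3 hc' hc hlo hhi.le hf.symm
    exact ⟨_, _, c', hc, hc', h4, h6, h5, h7.symm⟩

lemma uIcc_subset_wireDom {i j : ℕ} (h : StripEdge wireStrip i j) :
    Set.uIcc ((column i : ℝ) + 1 / 2) (column j + 1 / 2) ⊆ wireDom (wireOf i j) := by
  obtain ⟨c, c', h1, h2, h3, h4, -⟩ := wire_of_edge h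
  have key : ∀ k d : ℕ, column k = 16 * (wireOf i j).2 + d → d ∈ wirePoints (wireOf i j).1 →
      (column k : ℝ) + 1 / 2 ∈ wireDom (wireOf i j) := by
    intro k d hk hd
    have hb := wirePoints_bounds _ d hd
    have h1 : (wireStart (wireOf i j).1 : ℝ) ≤ d := by exact_mod_cast hb.1
    have h2 : (d : ℝ) ≤ wireEnd (wireOf i j).1 := by exact_mod_cast hb.2.1
    rw [hk]
    push_cast
    exact ⟨by linarith, by linarith⟩
  exact Set.uIcc_subset_Icc (key i c h1 h3) (key j c' h2 h4)

lemma mem_uIcc_column {i j n : ℕ}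
    (h : (n : ℝ) + 1 / 2 ∈ Set.uIcc ((column i : ℝ) + 1 / 2) (column j + 1 / 2)) :
    (column i ≤ n ∧ n ≤ column j) ∨ (column j ≤ n ∧ n ≤ column i) := by
  rw [Set.mem_uIcc] at h
  refine h.imp (fun h => ?_) fun h => ?_
  · exact ⟨by exact_mod_cast (by linarith [h.1] : (column i : ℝ) ≤ n),
      by exact_mod_cast (by linarith [h.2] : (n : ℝ) ≤ column j)⟩
  · exact ⟨by exact_mod_cast (by linarith [h.1] : (column j : ℝ) ≤ n),
      by exact_mod_cast (by linarith [h.2] : (n : ℝ) ≤ column i)⟩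

/-- The two columns without vertices contain no crossing. -/
lemma exists_column_of_cross {r n c c' : ℕ} {a b : Fin 6 × ℕ} (hab : a ≠ b)
    (hc : n = 16 * a.2 + c) (hc' : n = 16 * b.2 + c') (h : c ∈ wirePoints a.1)
    (h' : c' ∈ wirePoints b.1) (ha : 5 * a.2 + wireClass a.1 < 5 * r + 3)
    (hb : 5 * b.2 + wireClass b.1 < 5 * r + 3) (h1 : 7 ≤ n) (h2 : n ≤ 16 * r + 14) :
    ∃ k < 16 * r + 6, column k = n := by
  obtain ⟨-, -, p1, p2⟩ := wirePoints_bounds _ c h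
  obtain ⟨-, -, p1', p2'⟩ := wirePoints_bounds _ c' h'
  have same : a.1 = b.1 → a.2 = b.2 → False := fun h1 h2 => hab (Prod.ext h1 h2)
  refine exists_column h1 h2 (fun hn => ?_) fun hn => ?_
  · obtain ⟨q1, r1⟩ := (p1 (by omega)).resolve_right (by omega)
    obtain ⟨q2, r2⟩ := (p1' (by omega)).resolve_right (by omega)
    exact same (q1.trans q2.symm) (by omega)
  · obtain ⟨q1, r1⟩ := p2 (by omega)
    obtain ⟨q2, r2⟩ := p2' (by omega)
    exact same ((r1.resolve_right (by omega)).trans (r2.resolve_right (by omega)).symm) (by omega)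

/-- The drawing of the strip on wires. -/
noncomputable def wireLayout (r : ℕ) : MonotoneLayout wireStrip (16 * r + 6) (Fin 6 × ℕ) where
  x k := column k + 1 / 2
  y k := columnHeight (column k % 16) / 2
  f := wireFun
  arcOf := wireOf
  isStripPattern := isStripPattern_wireStrip
  x_injOn i _ j _ h := column_injective (by exact_mod_cast add_right_cancel h)
  continuous_f := continuous_wireFun
  mem_graph i j h _ := by
    obtain ⟨c, c', h1, h2, h3, h4, -⟩ := wire_of_edge h
    exact ⟨(wireFun_of_mem h3 h1).symm, (wireFun_of_mem h4 h2).symm⟩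
  not_between i j w h _ hw hx hy := by
    obtain ⟨c, c', h1, h2, h3, h4, h5⟩ := wire_of_edge h
    have hb := mem_uIcc_column hx
    have hc := wirePoints_bounds _ c h3
    have hc' := wirePoints_bounds _ c' h4
    obtain ⟨d, hd⟩ : ∃ d, column w = 16 * (wireOf i j).2 + d :=
      ⟨column w - 16 * (wireOf i j).2, by omega⟩
    have hmem := (wireFun_center (by omega) (by omega) hd).1 hy.symm
    have hd' := h5 d hmem
    have hw8 := (column_bounds hw).2.2.1
    rcases (by omega : column w = column i ∨ column w = column j) with h | h
    · exact Or.inl (column_injective h)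
    · exact Or.inr (column_injective h)
  meet i j i' j' h hj h' hj' hne t ht ht' hf := by
    obtain ⟨n, c, c', hc, hc', rfl, hp, hp', -⟩ := wire_meet hne (uIcc_subset_wireDom h ht)
      (uIcc_subset_wireDom h' ht') hf
    have hb := mem_uIcc_column ht
    have hij := isStripPattern_wireStrip.lt_of_edge h
    have hi := column_bounds (hij.trans hj)
    have hjb := column_bounds hj
    obtain ⟨w, hw, rfl⟩ := exists_column_of_cross hne hc hc' hp hp' (wireOf_lt h hj)
      (wireOf_lt h' hj') (by omega) (by omega)
    exact ⟨w, hw, rfl, (wireFun_of_mem hp hc).symm⟩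

/-! ### Intersections of the curves -/

/-- The curve with the number `κ` within a period. -/
noncomputable def wireCurve (κ q : ℕ) : Set ℂ :=
  ⋃ τ : Fin 6, ⋃ _ : wireClass τ = κ, graphOver (wireFun (τ, q)) (wireDom (τ, q))

lemma mem_wireCurve {κ q : ℕ} {z : ℂ} : z ∈ wireCurve κ q ↔
    ∃ τ, wireClass τ = κ ∧ z ∈ graphOver (wireFun (τ, q)) (wireDom (τ, q)) := by
  simp only [wireCurve, Set.mem_iUnion, exists_prop]

/-- The columns in which a curve passes through the vertex. -/
def curvePoints (κ : ℕ) : Finset ℕ :=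
  (Finset.univ.filter fun τ : Fin 6 => wireClass τ = κ).biUnion wirePoints

/-- Only one wire of the curve `κ` passes through the vertex in column `c`. -/
def UniqueWire (κ c : ℕ) : Prop :=
  ∀ τ τ' : Fin 6, wireClass τ = κ → wireClass τ' = κ → c ∈ wirePoints τ → c ∈ wirePoints τ' →
    τ = τ'

instance (κ c : ℕ) : Decidable (UniqueWire κ c) := by
  unfold UniqueWire
  infer_instance

/-- The common columns of the curves `κ` and `κ'` if their periods are shifted by `d` and `d'`. -/
def commonPoints (κ κ' d d' : ℕ) : Finset ℕ :=
  (curvePoints κ).filter fun c => c + d ∈ (curvePoints κ').image (· + d')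

/-- The curves `κ` and `κ'` have at most one common vertex, or at most two common vertices at which
neither of them has a corner. A curve can have a corner only where two of its wires meet. -/
def CommonSpec (κ κ' d d' : ℕ) : Prop :=
  (commonPoints κ κ' d d').card ≤ 2 ∧ ((commonPoints κ κ' d d').card ≤ 1 ∨
    ∀ c ∈ commonPoints κ κ' d d', UniqueWire κ c ∧ UniqueWire κ' (c + d - d'))

instance (κ κ' d d' : ℕ) : Decidable (CommonSpec κ κ' d d') := by
  unfold CommonSpec
  infer_instance

lemma commonSpec : ∀ κ < 5, ∀ κ' < 5, (κ ≠ κ' → CommonSpec κ κ' 0 0) ∧ CommonSpec κ κ' 0 16 ∧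
    CommonSpec κ κ' 16 0 := by
  decide

/-- The position of the vertex in a column. -/
noncomputable def columnPos (n : ℕ) : ℂ := ⟨n + 1 / 2, columnHeight (n % 16) / 2⟩

open Filter Topology in
/-- A curve is straight near a vertex where only one of its wires passes. -/
lemma eventually_wireCurve {κ q c n : ℕ} {τ : Fin 6} (hτ : wireClass τ = κ) (hc : c ∈ wirePoints τ)
    (hn : n = 16 * q + c) (h : UniqueWire κ c) : ∀ᶠ z in 𝓝 (columnPos n), z ∈ wireCurve κ q →
      z.im - (columnPos n).im = wireSlope τ c * (z.re - (columnPos n).re) := by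
  have key : ∀ τ' : Fin 6, ∀ᶠ z in 𝓝 (columnPos n), wireClass τ' = κ →
      z ∈ graphOver (wireFun (τ', q)) (wireDom (τ', q)) →
      z.im - (columnPos n).im = wireSlope τ c * (z.re - (columnPos n).re) := by
    intro τ'
    by_cases hne : τ' = τ
    · subst hne
      have hb := wirePoints_bounds τ' c hc
      have hlt := wireEnd_lt τ'
      have h1 : ∀ᶠ z in 𝓝 (columnPos n), z.re ∈ Set.Ioo (n : ℝ) (n + 1) :=
        Complex.continuous_re.continuousAt.eventually
          (Ioo_mem_nhds (by change (n : ℝ) < n + 1 / 2; linarith)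
            (by change (n : ℝ) + 1 / 2 < n + 1; linarith))
      filter_upwards [h1] with z hz _ hzg
      have hcen := wireFun_of_mem (a := (τ', q)) hc hn
      rw [hzg.2]
      change _ - (columnHeight (n % 16) : ℝ) / 2 = _ * (z.re - (n + 1 / 2))
      rw [← hcen, wireFun_eq (a := (τ', q)) (c := c) (by omega) hn hz.1.le hz.2.le,
        wireFun_eq (a := (τ', q)) (c := c) (by omega) hn (by linarith) (by linarith), wireSlope]
      push_cast
      ring
    · by_cases hcl : wireClass τ' = κ
      · have hp : columnPos n ∉ graphOver (wireFun (τ', q)) (wireDom (τ', q)) := by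
          rintro ⟨h1, h2⟩
          have h3 : (16 * q + wireStart τ' : ℝ) ≤ n := by
            have : (16 * q + wireStart τ' + 1 / 2 : ℝ) ≤ n + 1 / 2 := h1.1
            linarith
          have h4 : (n : ℝ) ≤ 16 * q + wireEnd τ' := by
            have : (n + 1 / 2 : ℝ) ≤ 16 * q + wireEnd τ' + 1 / 2 := h1.2
            linarith
          have h3' : 16 * q + wireStart τ' ≤ n := by exact_mod_cast h3
          have h4' : n ≤ 16 * q + wireEnd τ' := by exact_mod_cast h4
          exact hne (h τ' τ hcl hτ
            ((wireFun_center (a := (τ', q)) (by dsimp only; omega) (by dsimp only; omega) hn).1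
              h2.symm) hc)
        have hcl := (isClosed_graphOver (continuous_wireFun (τ', q))
          (s := wireDom (τ', q)) isClosed_Icc).isOpen_compl.mem_nhds hp
        filter_upwards [hcl] with z hz _ hzg
        exact absurd hzg hz
      · exact Eventually.of_forall fun z h' => absurd h' hcl
  filter_upwards [eventually_all.2 key] with z hz hzc
  obtain ⟨τ', h1, h2⟩ := mem_wireCurve.1 hzc
  exact hz τ' h1 h2

lemma exists_of_mem_wireCurve {κ κ' q q' : ℕ} (hne : ¬ (κ = κ' ∧ q = q')) {z : ℂ}
    (hz : z ∈ wireCurve κ q) (hz' : z ∈ wireCurve κ' q') : ∃ n c c' : ℕ, ∃ τ τ' : Fin 6,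
      n = 16 * q + c ∧ n = 16 * q' + c' ∧ z = columnPos n ∧ wireClass τ = κ ∧ wireClass τ' = κ' ∧
      c ∈ wirePoints τ ∧ c' ∈ wirePoints τ' ∧ wireSlope τ c ≠ wireSlope τ' c' := by
  obtain ⟨τ, hτ, h1, h2⟩ := mem_wireCurve.1 hz
  obtain ⟨τ', hτ', h1', h2'⟩ := mem_wireCurve.1 hz'
  have hab : (τ, q) ≠ (τ', q') := fun h => hne
    ⟨by rw [← hτ, ← hτ', show τ = τ' from (Prod.ext_iff.1 h).1], (Prod.ext_iff.1 h).2⟩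
  obtain ⟨n, c, c', hn, hn', ht, hc, hc', hs⟩ := wire_meet hab h1 h1' (h2.symm.trans h2')
  refine ⟨n, c, c', τ, τ', hn, hn', Complex.ext ht ?_, hτ, hτ', hc, hc', hs⟩
  rw [h2, ht]
  exact wireFun_of_mem hc hn

lemma mem_curvePoints {κ c : ℕ} {τ : Fin 6} (hτ : wireClass τ = κ) (hc : c ∈ wirePoints τ) :
    c ∈ curvePoints κ :=
  Finset.mem_biUnion.2 ⟨τ, Finset.mem_filter.2 ⟨Finset.mem_univ τ, hτ⟩, hc⟩

lemma intersectionNumber_of_commonSpec {κ κ' q q' d d' : ℕ} (hne : ¬ (κ = κ' ∧ q = q'))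
    (hd : 16 * q' + d = 16 * q + d') (h : CommonSpec κ κ' d d') :
    intersectionNumber (wireCurve κ q) (wireCurve κ' q') ≤ 2 := by
  have hmem : ∀ {n c c' : ℕ} {τ τ' : Fin 6}, n = 16 * q + c → n = 16 * q' + c' →
      wireClass τ = κ → wireClass τ' = κ' → c ∈ wirePoints τ → c' ∈ wirePoints τ' →
      c ∈ commonPoints κ κ' d d' ∧ c + d - d' = c' := by
    intro n c c' τ τ' hn hn' hτ hτ' hc hc'
    exact ⟨Finset.mem_filter.2 ⟨mem_curvePoints hτ hc, Finset.mem_image.2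
      ⟨c', mem_curvePoints hτ' hc', by omega⟩⟩, by omega⟩
  refine intersectionNumber_le_two (g := fun c => columnPos (16 * q + c)) h.1 ?_
    (h.2.imp_right fun h z hz => ?_)
  · rintro z ⟨hz, hz'⟩
    obtain ⟨n, c, c', τ, τ', hn, hn', rfl, hτ, hτ', hc, hc', -⟩ :=
      exists_of_mem_wireCurve hne hz hz'
    exact ⟨c, (hmem hn hn' hτ hτ' hc hc').1, by rw [hn]⟩
  · obtain ⟨n, c, c', τ, τ', hn, hn', rfl, hτ, hτ', hc, hc', hs⟩ :=
      exists_of_mem_wireCurve hne hz.1 hz.2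
    obtain ⟨h1, h2⟩ := hmem hn hn' hτ hτ' hc hc'
    have hu := h c h1
    rw [h2] at hu
    exact meetTransversally_of_slope (by exact_mod_cast hs)
      (eventually_wireCurve hτ hc hn hu.1) (eventually_wireCurve hτ' hc' hn' hu.2)

lemma intersectionNumber_wireCurve {κ κ' q q' : ℕ} (hκ : κ < 5) (hκ' : κ' < 5)
    (hne : ¬ (κ = κ' ∧ q = q')) : intersectionNumber (wireCurve κ q) (wireCurve κ' q') ≤ 2 := by
  obtain ⟨h1, h2, h3⟩ := commonSpec κ hκ κ' hκ'
  rcases (by omega : q = q' ∨ q' = q + 1 ∨ q = q' + 1 ∨ q + 2 ≤ q' ∨ q' + 2 ≤ q) with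
    h | h | h | h
  · exact intersectionNumber_of_commonSpec hne (by omega) (h1 fun h' => hne ⟨h', h⟩)
  · exact intersectionNumber_of_commonSpec hne (by omega) h2
  · exact intersectionNumber_of_commonSpec hne (by omega) h3
  · -- the curves lie above disjoint intervals
    refine intersectionNumber_le_two (S := (∅ : Finset ℕ)) (g := columnPos) (by simp) ?_
      (Or.inl (by simp))
    rintro z ⟨hz, hz'⟩
    exfalso
    obtain ⟨n, c, c', τ, τ', hn, hn', -, -, -, hc, hc', -⟩ := exists_of_mem_wireCurve hne hz hz'
    have b1 := (wirePoints_bounds τ c hc).2.1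
    have b2 := (wirePoints_bounds τ' c' hc').2.1
    have b3 := wireEnd_lt τ
    have b4 := wireEnd_lt τ'
    omega

/-! ### The curves of the drawing -/

/-- The edges on a wire cover the columns from `l` to `m`. -/
def WireCover (n : ℕ) (a : Fin 6 × ℕ) (l m : ℕ) : Prop :=
  ∀ t ∈ Set.Icc (16 * a.2 + l + 1 / 2 : ℝ) (16 * a.2 + m + 1 / 2), ∃ i j,
    StripEdge wireStrip i j ∧ j < n ∧ wireOf i j = a ∧
      t ∈ Set.uIcc ((column i : ℝ) + 1 / 2) (column j + 1 / 2)

lemma WireCover.trans {n : ℕ} {a : Fin 6 × ℕ} {l m k : ℕ} (h : WireCover n a l m)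
    (h' : WireCover n a m k) : WireCover n a l k := fun t ht => by
  rcases le_total t (16 * a.2 + m + 1 / 2) with h1 | h1
  · exact h t ⟨ht.1, h1⟩
  · exact h' t ⟨h1, ht.2⟩

lemma wireCover_of_edge {n i j l m : ℕ} {a : Fin 6 × ℕ} (h : StripEdge wireStrip i j) (hj : j < n)
    (ha : wireOf i j = a) (hlm : (column i = 16 * a.2 + l ∧ column j = 16 * a.2 + m) ∨
      (column i = 16 * a.2 + m ∧ column j = 16 * a.2 + l)) : WireCover n a l m := fun t ht => by
  refine ⟨i, j, h, hj, ha, ?_⟩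
  rcases hlm with ⟨h1, h2⟩ | ⟨h1, h2⟩ <;> rw [h1, h2] <;> push_cast
  · exact Set.Icc_subset_uIcc ht
  · exact Set.Icc_subset_uIcc' ht

/-- An edge that is listed in the table with the ends `l` and `m` covers the columns between them. -/
lemma wireCover_of_table {n : ℕ} {τ : Fin 6} {q l m : ℕ} (s : Bool) (k δ p : ℕ)
    (hrow : wireTable s k = (τ, δ, l, m) ∨ wireTable s k = (τ, δ, m, l)) (hk : k < 16)
    (hs : s = true ∨ 2 < 16 * p + k) (hp : 1 < 16 * p + k) (hq : q + 1 = p + δ)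
    (hn : 16 * p + k < n) : WireCover n (τ, q) l m := by
  have hmod : (16 * p + k) % 16 = k := by omega
  have hdiv : (16 * p + k) / 16 = p := by omega
  have hgap : (bif s then 1 else wireGap k) < 16 * p + k := by
    rcases hs with rfl | hs
    · exact hp
    · cases s
      · rw [cond_false]
        have := (wireGap_spec k hk).2.1
        rcases (by omega : 4 < 16 * p + k ∨ (k = 3 ∧ p = 0) ∨ (k = 4 ∧ p = 0)) with
          h | ⟨rfl, rfl⟩ | ⟨rfl, rfl⟩
        · omega
        · decide
        · decide
      · exact hp
  obtain ⟨h1, h2, h3, h4, h5⟩ := wireOf_of_table (i := 16 * p + k - (bif s then 1 else wireGap k))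
    (j := 16 * p + k) s (by omega) (by rw [hmod]; omega)
  rw [hmod] at h2
  have hof : wireOf (16 * p + k - (bif s then 1 else wireGap k)) (16 * p + k) = (τ, q) := by
    rw [wireOf, h2, hdiv]
    rcases hrow with h | h <;> rw [h] <;> exact Prod.ext rfl (by dsimp only; omega)
  rw [hof, h2] at h4 h5
  refine wireCover_of_edge h1 hn hof ?_
  rcases hrow with h | h <;> rw [h] at h4 h5
  · exact Or.inl ⟨h4, h5⟩
  · exact Or.inr ⟨h4, h5⟩

section

variable {r q : ℕ}

lemma wireCover_zero (hq : q ≤ r) : WireCover (16 * r + 6) (0, q) (if q = 0 then 7 else 0)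
    (if q = r then 14 else 15) := by
  have h1 : WireCover (16 * r + 6) (0, q) (if q = 0 then 7 else 0) 10 := by
    split_ifs with h
    · subst h
      exact wireCover_of_edge (i := 0) (j := 2) (Or.inr ⟨le_rfl, rfl⟩) (by omega) rfl
        (Or.inl ⟨rfl, rfl⟩)
    · have c1 : WireCover (16 * r + 6) (0, q) 0 1 := wireCover_of_table true 9 2 (q - 1)
        (Or.inr rfl) (by omega) (Or.inl rfl) (by omega) (by omega) (by omega)
      have c2 : WireCover (16 * r + 6) (0, q) 1 4 := wireCover_of_table false 12 2 (q - 1)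
        (Or.inl rfl) (by omega) (Or.inr (by omega)) (by omega) (by omega) (by omega)
      have c3 : WireCover (16 * r + 6) (0, q) 4 5 := wireCover_of_table true 13 2 (q - 1)
        (Or.inl rfl) (by omega) (Or.inl rfl) (by omega) (by omega) (by omega)
      have c4 : WireCover (16 * r + 6) (0, q) 5 7 := wireCover_of_table false 15 2 (q - 1)
        (Or.inl rfl) (by omega) (Or.inr (by omega)) (by omega) (by omega) (by omega)
      have c5 : WireCover (16 * r + 6) (0, q) 7 8 := wireCover_of_table true 0 1 q
        (Or.inl rfl) (by omega) (Or.inl rfl) (by omega) (by omega) (by omega)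
      have c6 : WireCover (16 * r + 6) (0, q) 8 10 := wireCover_of_table false 2 1 q
        (Or.inl rfl) (by omega) (Or.inr (by omega)) (by omega) (by omega) (by omega)
      exact ((((c1.trans c2).trans c3).trans c4).trans c5).trans c6
  have h2 : WireCover (16 * r + 6) (0, q) 10 (if q = r then 14 else 15) := by
    have c7 : WireCover (16 * r + 6) (0, q) 10 11 := wireCover_of_table true 3 1 q
      (Or.inl rfl) (by omega) (Or.inl rfl) (by omega) (by omega) (by omega)
    have c8 : WireCover (16 * r + 6) (0, q) 11 14 := wireCover_of_table false 5 1 q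
      (Or.inl rfl) (by omega) (Or.inr (by omega)) (by omega) (by omega) (by omega)
    split_ifs with h
    · exact c7.trans c8
    · have c9 : WireCover (16 * r + 6) (0, q) 14 15 := wireCover_of_table false 7 1 q
        (Or.inl rfl) (by omega) (Or.inr (by omega)) (by omega) (by omega) (by omega)
      exact (c7.trans c8).trans c9
  exact h1.trans h2

lemma wireCover_one (hq : q ≤ r) : WireCover (16 * r + 6) (1, q) (if q = 0 then 7 else 6)
    (if q = r then 12 else 13) := by
  have h1 : WireCover (16 * r + 6) (1, q) (if q = 0 then 7 else 6) 9 := by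
    split_ifs with h
    · subst h
      exact wireCover_of_edge (i := 0) (j := 1) (Or.inl rfl) (by omega) rfl (Or.inl ⟨rfl, rfl⟩)
    · have c1 : WireCover (16 * r + 6) (1, q) 6 7 := wireCover_of_table true 15 2 (q - 1)
        (Or.inl rfl) (by omega) (Or.inl rfl) (by omega) (by omega) (by omega)
      have c2 : WireCover (16 * r + 6) (1, q) 7 9 := wireCover_of_table false 1 1 q
        (Or.inl rfl) (by omega) (Or.inr (by omega)) (by omega) (by omega) (by omega)
      exact c1.trans c2
  have h2 : WireCover (16 * r + 6) (1, q) 9 (if q = r then 12 else 13) := by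
    have c3 : WireCover (16 * r + 6) (1, q) 9 11 := wireCover_of_table false 3 1 q
      (Or.inl rfl) (by omega) (Or.inr (by omega)) (by omega) (by omega) (by omega)
    have c4 : WireCover (16 * r + 6) (1, q) 11 12 := wireCover_of_table true 4 1 q
      (Or.inl rfl) (by omega) (Or.inl rfl) (by omega) (by omega) (by omega)
    split_ifs with h
    · exact c3.trans c4
    · have c5 : WireCover (16 * r + 6) (1, q) 12 13 := wireCover_of_table false 6 1 q
        (Or.inl rfl) (by omega) (Or.inr (by omega)) (by omega) (by omega) (by omega)
      exact (c3.trans c4).trans c5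
  exact h1.trans h2

lemma wireCover_two (hq : q ≤ r) : WireCover (16 * r + 6) (2, q) 9 (if q = r then 14 else 22) := by
  have c1 : WireCover (16 * r + 6) (2, q) 9 10 := wireCover_of_table true 2 1 q
    (Or.inl rfl) (by omega) (Or.inl rfl) (by omega) (by omega) (by omega)
  have c2 : WireCover (16 * r + 6) (2, q) 10 12 := wireCover_of_table false 4 1 q
    (Or.inl rfl) (by omega) (Or.inr (by omega)) (by omega) (by omega) (by omega)
  have c3 : WireCover (16 * r + 6) (2, q) 12 14 := wireCover_of_table true 5 1 q
    (Or.inl rfl) (by omega) (Or.inl rfl) (by omega) (by omega) (by omega)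
  split_ifs with h
  · exact (c1.trans c2).trans c3
  · have c4 : WireCover (16 * r + 6) (2, q) 14 17 := wireCover_of_table false 8 1 q
      (Or.inl rfl) (by omega) (Or.inr (by omega)) (by omega) (by omega) (by omega)
    have c5 : WireCover (16 * r + 6) (2, q) 17 19 := wireCover_of_table false 11 1 q
      (Or.inl rfl) (by omega) (Or.inr (by omega)) (by omega) (by omega) (by omega)
    have c6 : WireCover (16 * r + 6) (2, q) 19 21 := wireCover_of_table false 13 1 q
      (Or.inl rfl) (by omega) (Or.inr (by omega)) (by omega) (by omega) (by omega)
    have c7 : WireCover (16 * r + 6) (2, q) 21 22 := wireCover_of_table true 14 1 q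
      (Or.inl rfl) (by omega) (Or.inl rfl) (by omega) (by omega) (by omega)
    exact (((((c1.trans c2).trans c3).trans c4).trans c5).trans c6).trans c7

lemma wireCover_three (hq : q < r) : WireCover (16 * r + 6) (3, q) 13 18 := by
  have c1 : WireCover (16 * r + 6) (3, q) 13 14 := wireCover_of_table true 6 1 q
    (Or.inr rfl) (by omega) (Or.inl rfl) (by omega) (by omega) (by omega)
  have c2 : WireCover (16 * r + 6) (3, q) 14 16 := wireCover_of_table false 9 1 q
    (Or.inl rfl) (by omega) (Or.inr (by omega)) (by omega) (by omega) (by omega)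
  have c3 : WireCover (16 * r + 6) (3, q) 16 18 := wireCover_of_table true 10 1 q
    (Or.inl rfl) (by omega) (Or.inl rfl) (by omega) (by omega) (by omega)
  exact (c1.trans c2).trans c3

lemma wireCover_five (hq : q < r) : WireCover (16 * r + 6) (5, q) 13 18 := by
  have c1 : WireCover (16 * r + 6) (5, q) 13 15 := wireCover_of_table true 7 1 q
    (Or.inl rfl) (by omega) (Or.inl rfl) (by omega) (by omega) (by omega)
  have c2 : WireCover (16 * r + 6) (5, q) 15 17 := wireCover_of_table true 8 1 q
    (Or.inl rfl) (by omega) (Or.inl rfl) (by omega) (by omega) (by omega)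
  have c3 : WireCover (16 * r + 6) (5, q) 17 18 := wireCover_of_table false 10 1 q
    (Or.inl rfl) (by omega) (Or.inr (by omega)) (by omega) (by omega) (by omega)
  exact (c1.trans c2).trans c3

lemma wireCover_four (hq : q < r) : WireCover (16 * r + 6) (4, q) 18 25 := by
  have c1 : WireCover (16 * r + 6) (4, q) 18 19 := wireCover_of_table true 11 1 q
    (Or.inl rfl) (by omega) (Or.inl rfl) (by omega) (by omega) (by omega)
  have c2 : WireCover (16 * r + 6) (4, q) 19 20 := wireCover_of_table true 12 1 q
    (Or.inl rfl) (by omega) (Or.inl rfl) (by omega) (by omega) (by omega)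
  have c3 : WireCover (16 * r + 6) (4, q) 20 22 := wireCover_of_table false 14 1 q
    (Or.inl rfl) (by omega) (Or.inr (by omega)) (by omega) (by omega) (by omega)
  have c4 : WireCover (16 * r + 6) (4, q) 22 24 := wireCover_of_table false 0 0 (q + 1)
    (Or.inl rfl) (by omega) (Or.inr (by omega)) (by omega) (by omega) (by omega)
  have c5 : WireCover (16 * r + 6) (4, q) 24 25 := wireCover_of_table true 1 0 (q + 1)
    (Or.inl rfl) (by omega) (Or.inl rfl) (by omega) (by omega) (by omega)
  exact (((c1.trans c2).trans c3).trans c4).trans c5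

end

/-- The edges on a wire form the part of its graph between the outermost columns with vertices. -/
lemma union_arcEdges_wire {r l m : ℕ} {a : Fin 6 × ℕ} (h : WireCover (16 * r + 6) a l m)
    (hpts : ∀ c ∈ wirePoints a.1, 7 ≤ 16 * a.2 + c → 16 * a.2 + c ≤ 16 * r + 14 →
      16 * a.2 + c ≠ 16 * r + 13 → l ≤ c ∧ c ≤ m) :
    (wireLayout r).drawing.union ((wireLayout r).arcEdges a) =
      graphOver (wireFun a) (Set.Icc (16 * a.2 + l + 1 / 2) (16 * a.2 + m + 1 / 2)) := by
  refine (wireLayout r).union_arcEdges a ?_ h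
  intro i j hij hj ha
  change wireOf i j = a at ha
  subst ha
  change Set.uIcc ((column i : ℝ) + 1 / 2) (column j + 1 / 2) ⊆ _
  obtain ⟨c, c', h1, h2, h3, h4, -⟩ := wire_of_edge hij
  have key : ∀ k d : ℕ, k < 16 * r + 6 → column k = 16 * (wireOf i j).2 + d →
      d ∈ wirePoints (wireOf i j).1 → (column k : ℝ) + 1 / 2 ∈
        Set.Icc (16 * (wireOf i j).2 + l + 1 / 2 : ℝ) (16 * (wireOf i j).2 + m + 1 / 2) := by
    intro k d hk hkd hd
    have hb := column_bounds hk
    obtain ⟨h5, h6⟩ := hpts d hd (by omega) (by omega) (by omega)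
    have h5' : (l : ℝ) ≤ d := by exact_mod_cast h5
    have h6' : (d : ℝ) ≤ m := by exact_mod_cast h6
    rw [hkd]
    push_cast
    exact ⟨by linarith, by linarith⟩
  exact Set.uIcc_subset_Icc
    (key i c ((isStripPattern_wireStrip.lt_of_edge hij).trans hj) h1 h3) (key j c' hj h2 h4)

/-- The edges on a curve. The curves are numbered through the periods, five in each. -/
def wireEdges (r i : ℕ) : Set (Sym2 (Fin (16 * r + 6))) :=
  {e | e ∈ (stripGraph wireStrip (16 * r + 6)).edgeSet ∧
    5 * ((wireLayout r).arc e).2 + wireClass ((wireLayout r).arc e).1 = i}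

lemma wireClass_spec : ∀ τ : Fin 6, wireClass τ < 5 ∧ (wireClass τ = 3 ↔ τ = 3 ∨ τ = 5) ∧
    (wireClass τ ≠ 3 → ∀ τ', wireClass τ' = wireClass τ → τ' = τ) := by
  decide

lemma wireEdges_of_ne {r q : ℕ} {τ : Fin 6} (hτ : wireClass τ ≠ 3) :
    wireEdges r (5 * q + wireClass τ) = (wireLayout r).arcEdges (τ, q) := by
  ext e
  refine and_congr_right fun _ => ?_
  generalize (wireLayout r).arc e = a
  have h := wireClass_spec a.1
  have h' := wireClass_spec τ
  constructor
  · intro ha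
    exact Prod.ext (h'.2.2 hτ a.1 (by omega)) (by dsimp only; omega)
  · rintro rfl
    rfl

lemma wireEdges_three (r q : ℕ) : wireEdges r (5 * q + 3) =
    (wireLayout r).arcEdges (3, q) ∪ (wireLayout r).arcEdges (5, q) := by
  ext e
  change _ ∧ _ ↔ (_ ∧ _) ∨ (_ ∧ _)
  rw [← and_or_left]
  refine and_congr_right fun _ => ?_
  generalize (wireLayout r).arc e = a
  have h := wireClass_spec a.1
  constructor
  · intro ha
    exact (h.2.1.1 (by omega)).imp (fun h => Prod.ext h (by dsimp only; omega))
      fun h => Prod.ext h (by dsimp only; omega)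
  · rintro (rfl | rfl) <;> rfl

lemma union_wireEdges_subset (r i : ℕ) :
    (wireLayout r).drawing.union (wireEdges r i) ⊆ wireCurve (i % 5) (i / 5) := by
  intro z hz
  simp only [PlanarDrawing.union, Set.mem_iUnion] at hz
  obtain ⟨e, ⟨he, hi⟩, hz⟩ := hz
  obtain ⟨u, v, rfl, huv⟩ := exists_edge_of_mem_edgeSet he
  have hz' : z ∈ (wireLayout r).curve s(u, v) := hz
  rw [(wireLayout r).curve_mk huv] at hz'
  rw [(wireLayout r).arc_mk huv] at hi
  have h := (wireClass_spec (wireOf u v).1).1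
  change 5 * (wireOf u v).2 + wireClass (wireOf u v).1 = i at hi
  refine mem_wireCurve.2 ⟨(wireOf u v).1, by omega, ?_⟩
  rw [show ((wireOf u v).1, i / 5) = wireOf u v from Prod.ext rfl (by dsimp only; omega)]
  exact ⟨uIcc_subset_wireDom huv hz'.1, hz'.2⟩

lemma isSimpleArc_wire {a : Fin 6 × ℕ} {l m : ℕ} (h : l < m) : ∃ p q, IsSimpleArc
    (graphOver (wireFun a) (Set.Icc (16 * a.2 + l + 1 / 2) (16 * a.2 + m + 1 / 2))) p q := by
  have hlt : (16 * a.2 + l + 1 / 2 : ℝ) < 16 * a.2 + m + 1 / 2 := by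
    have : (l : ℝ) < m := by exact_mod_cast h
    linarith
  rw [← Set.uIcc_of_le hlt.le]
  exact ⟨⟨_, _⟩, ⟨_, _⟩, isSimpleArc_graphOver (continuous_wireFun a) hlt.ne ⟨rfl, rfl⟩ ⟨rfl, rfl⟩⟩

/-- The wires `3` and `5` meet in the columns `13` and `18`, where both begin and end. -/
lemma isSimpleClosedCurve_wire (q : ℕ) : IsSimpleClosedCurve
    (graphOver (wireFun (3, q)) (Set.Icc (16 * q + (13 : ℕ) + 1 / 2) (16 * q + (18 : ℕ) + 1 / 2)) ∪
      graphOver (wireFun (5, q))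
        (Set.Icc (16 * q + (13 : ℕ) + 1 / 2) (16 * q + (18 : ℕ) + 1 / 2))) := by
  have hends : ∀ c : ℕ, c ∈ wirePoints 3 → c ∈ wirePoints 5 →
      wireFun (3, q) (16 * q + c + 1 / 2) = wireFun (5, q) (16 * q + c + 1 / 2) := by
    intro c h3 h5
    have e3 := wireFun_of_mem (a := (3, q)) (n := 16 * q + c) h3 rfl
    have e5 := wireFun_of_mem (a := (5, q)) (n := 16 * q + c) h5 rfl
    push_cast at e3 e5
    rw [e3, e5]
  refine isSimpleClosedCurve_union_graphOver (continuous_wireFun _) (continuous_wireFun _)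
    (by push_cast; linarith) (hends 13 (by decide) (by decide)) (hends 18 (by decide) (by decide))
    fun t ht hf => ?_
  obtain ⟨n, c, c', hn, hn', rfl, hc, hc', -⟩ := wire_meet (a := (3, q)) (b := (5, q))
    (by simp) ht ht hf
  obtain rfl : c = c' := by dsimp only at hn hn'; omega
  have : ∀ c ∈ wirePoints 3, c ∈ wirePoints 5 → c = 13 ∨ c = 18 := by decide
  dsimp only at hn
  rw [hn]
  push_cast
  rcases this c hc hc' with rfl | rfl
  · exact Or.inl rfl
  · exact Or.inr rfl

lemma isCurve_wireEdges {r i : ℕ} (hi : i < 5 * r + 3) :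
    (∃ p q : ℂ, IsSimpleArc ((wireLayout r).drawing.union (wireEdges r i)) p q) ∨
      (2 ≤ 2 ∧ IsSimpleClosedCurve ((wireLayout r).drawing.union (wireEdges r i))) := by
  obtain ⟨q, hq⟩ : ∃ q, q = i / 5 := ⟨_, rfl⟩
  rcases (by omega : (i = 5 * q + 0 ∧ q ≤ r) ∨ (i = 5 * q + 1 ∧ q ≤ r) ∨ (i = 5 * q + 2 ∧ q ≤ r) ∨
    (i = 5 * q + 3 ∧ q < r) ∨ (i = 5 * q + 4 ∧ q < r)) with
    ⟨rfl, h⟩ | ⟨rfl, h⟩ | ⟨rfl, h⟩ | ⟨rfl, h⟩ | ⟨rfl, h⟩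
  · left
    rw [show wireEdges r (5 * q + 0) = _ from wireEdges_of_ne (τ := 0) (by decide),
      union_arcEdges_wire (wireCover_zero h) fun c hc h1 h2 h3 => ?_]
    · exact isSimpleArc_wire (by split_ifs <;> omega)
    · have hb : 0 ≤ c ∧ c ≤ 15 := ⟨c.zero_le, (wirePoints_bounds 0 c hc).2.1⟩
      dsimp only at h1 h2 h3
      split_ifs <;> omega
  · left
    rw [show wireEdges r (5 * q + 1) = _ from wireEdges_of_ne (τ := 1) (by decide),
      union_arcEdges_wire (wireCover_one h) fun c hc h1 h2 h3 => ?_]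
    · exact isSimpleArc_wire (by split_ifs <;> omega)
    · have hb : 6 ≤ c ∧ c ≤ 13 :=
        ⟨(wirePoints_bounds 1 c hc).1, (wirePoints_bounds 1 c hc).2.1⟩
      dsimp only at h1 h2 h3
      split_ifs <;> omega
  · left
    rw [show wireEdges r (5 * q + 2) = _ from wireEdges_of_ne (τ := 2) (by decide),
      union_arcEdges_wire (wireCover_two h) fun c hc h1 h2 h3 => ?_]
    · exact isSimpleArc_wire (by split_ifs <;> omega)
    · have hb : 9 ≤ c ∧ c ≤ 22 :=
        ⟨(wirePoints_bounds 2 c hc).1, (wirePoints_bounds 2 c hc).2.1⟩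
      dsimp only at h1 h2 h3
      split_ifs <;> omega
  · right
    rw [wireEdges_three, PlanarDrawing.union_union,
      union_arcEdges_wire (wireCover_three h) fun c hc _ _ _ =>
        ⟨(wirePoints_bounds 3 c hc).1, (wirePoints_bounds 3 c hc).2.1⟩,
      union_arcEdges_wire (wireCover_five h) fun c hc _ _ _ =>
        ⟨(wirePoints_bounds 5 c hc).1, (wirePoints_bounds 5 c hc).2.1⟩]
    exact ⟨le_rfl, isSimpleClosedCurve_wire q⟩
  · left
    rw [show wireEdges r (5 * q + 4) = _ from wireEdges_of_ne (τ := 4) (by decide),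
      union_arcEdges_wire (wireCover_four h) fun c hc _ _ _ =>
        ⟨(wirePoints_bounds 4 c hc).1, (wirePoints_bounds 4 c hc).2.1⟩]
    exact isSimpleArc_wire (by norm_num)

lemma pseudoArc_wireStrip_le (r : ℕ) :
    pseudoArc 2 (stripGraph wireStrip (16 * r + 6)) ≤ ((5 * r + 3 : ℕ) : ℕ∞) := by
  refine sInf_le ⟨(wireLayout r).drawing, 5 * r + 3, fun i => wireEdges r i, rfl,
    (wireLayout r).isEdgePartition (fun a => 5 * a.2 + wireClass a.1) fun _ _ h hj =>
      wireOf_lt h hj, fun i => isCurve_wireEdges i.2, fun i j hij => ?_⟩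
  refine (intersectionNumber_mono (union_wireEdges_subset r i)
    (union_wireEdges_subset r j)).trans ?_
  have hne : (i : ℕ) ≠ j := fun h => hij (Fin.ext h)
  exact intersectionNumber_wireCurve (Nat.mod_lt _ (by norm_num)) (Nat.mod_lt _ (by norm_num))
    (by omega)

end OuterpathDrawing

theorem mainTheorem11 (r : ℕ) :
    (∃ P : SimpleGraph (Fin (2 * r + 6)), OuterpathDrawing.IsMaximalOuterpath P ∧
      OuterpathDrawing.seg P ≤ ((r + 5 : ℕ) : ℕ∞) ∧
      ((r + 5 : ℕ) : ℚ) = ((2 * r + 6 : ℕ) : ℚ) / 2 + 2) ∧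
    (∃ Q : SimpleGraph (Fin (3 * r)), OuterpathDrawing.IsMaximalOuterpath Q ∧
      OuterpathDrawing.arc Q ≤ ((r + 1 : ℕ) : ℕ∞) ∧
      ((r + 1 : ℕ) : ℚ) = ((3 * r : ℕ) : ℚ) / 3 + 1) ∧
    (∃ U : SimpleGraph (Fin (16 * r + 6)), OuterpathDrawing.IsMaximalOuterpath U ∧
      OuterpathDrawing.pseudoArc 2 U ≤ ((5 * r + 3 : ℕ) : ℕ∞) ∧
      ((5 * r + 3 : ℕ) : ℚ) = (5 * ((16 * r + 6 : ℕ) : ℚ) + 18) / 16) := by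
  -- the fan with `k` vertices on each side of its apex and `k = r + 2`
  refine ⟨⟨OuterpathDrawing.stripGraph (fun _ => 0) (2 * (r + 2) + 2),
    OuterpathDrawing.isStripPattern_fan.isMaximalOuterpath (by omega),
    OuterpathDrawing.seg_fan_le (by omega), by push_cast; ring⟩, ?_, ?_⟩
  · -- a strip has at least one triangle, so that the case without vertices is separate
    rcases Nat.eq_zero_or_pos r with rfl | hr
    · have : IsEmpty (Fin (3 * 0)) := inferInstanceAs (IsEmpty (Fin 0))
      obtain ⟨h1, h2⟩ := OuterpathDrawing.isOuterpath_of_isEmpty (⊥ : SimpleGraph (Fin (3 * 0)))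
      exact ⟨⊥, h1, h2, by norm_num⟩
    · exact ⟨OuterpathDrawing.stripGraph OuterpathDrawing.arcStrip (3 * r),
        OuterpathDrawing.isStripPattern_arcStrip.isMaximalOuterpath (by omega),
        OuterpathDrawing.arc_arcStrip_le hr, by push_cast; ring⟩
  · exact ⟨OuterpathDrawing.stripGraph OuterpathDrawing.wireStrip (16 * r + 6),
      OuterpathDrawing.isStripPattern_wireStrip.isMaximalOuterpath (by omega),
      OuterpathDrawing.pseudoArc_wireStrip_le r, by push_cast; ring⟩
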